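/- Let $k$ be a field and let $A$, $B$ be associative unital $k$-algebras, not necessarily finite dimensional. A *system* of an algebra is a finite set of orthogonal idempotents (not necessarily primitive) with sum $1$. Let $E$ be a system of $A$ and $F$ a system of $B$. For non-negative integers ${}_fm_e$ and ${}_en_f$ ($e\in E$, $f\in F$) consider the projective bimodules $$M=\bigoplus_{e\in E,\,f\in F}{}_fm_e\,(Bf\otimes_k eA),\qquad N=\bigoplus_{e\in E,\,f\in F}{}_en_f\,(Ae\otimes_k fB),$$ where ${}_fm_e$ and ${}_en_f$ are multiplicities, and let $$\Lambda=\begin{pmatrix}A&N\\ M&B\end{pmatrix}$$ be the corresponding null-square projective algebra, that is, the matrix algebra in which all products $mn$ and $nm$ with $m\in M$, $n\in N$ are zero. Write $HH^n(R)=\mathrm{Ext}^n_{R\otimes_k R^{op}}(R,R)$. For a system $S$ of an algebra $R$, the Peirce $S$-quiver of $R$ has vertex set $S$, and for $x\ne y$ in $S$ one arrow from $x$ to $y$ if $yRx\neq 0$. View $E\cup F$ (disjoint union) as the system of $\Lambda$ located on the diagonal. Let $Q$ be the Peirce $(E\cup F)$-quiver of $\Lambda$, and let $Q'$ be the quiver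 consisting of the disjoint union of the Peirce $E$-quiver of $A$ and the Peirce $F$-quiver of $B$, together with an arrow $e\to f$ whenever ${}_fm_e\neq0$ and an arrow $f\to e$ whenever ${}_en_f\neq0$. (If the idempotents are non-zero, $Q'$ is a subquiver of $Q$.) In $Q$ or $Q'$, an *efficient cycle* is a cycle of positive length in which no two cyclically successive arrows are both between vertices of $E$, and no two cyclically successive arrows are both between vertices of $F$. Suppose that $Q$ has no efficient cycle, or that $Q'$ has no efficient cycle. Then: 1. There exists a positive integer $h$ such that for all $n\ge h$ there is an isomorphism of $k$-vector spaces $$HH^n(\Lambda)\cong HH^n(A)\oplus HH^n(B).$$ 2. Consequently, if $A$ and $B$ are finite dimensional, $HH^n(A)$ and $HH^n(B)$ vanish for all large enough $n$, and at least one of $A$, $B$ has infinite global dimension, then $\Lambda$ is a finite dimensional algebra of infinite global dimension whose Hochschild cohomology vanishes in all large enough degrees. -/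

import Mathlib

open TensorProduct

universe u v w

/-! ### Hochschild cohomology -/

section Hochschild

variable (k : Type u) [Field k] (R : Type v) [Ring R] [Algebra k R]

/-- The algebra `R` as a module over its enveloping algebra `R ⊗ Rᵒᵖ`:
`(x ⊗ y) • r = x * r * y`. -/
noncomputable def regularBimodule : ModuleCat.{v} (R ⊗[k] Rᵐᵒᵖ) :=
  letI : Module (R ⊗[k] Rᵐᵒᵖ) R := TensorProduct.Algebra.module
  ModuleCat.of (R ⊗[k] Rᵐᵒᵖ) R

/-- Hochschild cohomology `HHⁿ(R) = Extⁿ_{R ⊗ Rᵒᵖ}(R, R)`; being a type of `Ext` in a `k`-linear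
category it is a `k`-vector space. -/
abbrev HochschildCohomology (n : ℕ) : Type v :=
  CategoryTheory.Abelian.Ext.{v} (regularBimodule k R) (regularBimodule k R) n

/-- The Hochschild cohomology of `R` is zero in all large enough degrees. -/
def EventuallyZeroHochschild : Prop :=
  ∃ h : ℕ, ∀ n : ℕ, h ≤ n → Subsingleton (HochschildCohomology k R n)

end Hochschild

/-- The (left) global dimension of `R` is infinite: there is no common bound for the projective
dimensions of the left `R`-modules. -/
def InfiniteGlobalDimension (R : Type v) [Ring R] : Prop :=
  ∀ d : ℕ, ∃ X : ModuleCat.{v} R, ¬ CategoryTheory.HasProjectiveDimensionLE X d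

/-! ### The algebra of `2 × 2` matrices with zero products of corners -/

/-- The underlying set of the matrices with rows `(a, n)` and `(m, b)`. -/
@[ext]
structure NullSquare (A : Type*) (N : Type*) (M : Type*) (B : Type*) where
  /-- the upper left entry -/
  a : A
  /-- the upper right entry -/
  n : N
  /-- the lower left entry -/
  m : M
  /-- the lower right entry -/
  b : B

namespace NullSquare

section Additive

variable {A N M B : Type*}

/-- A matrix is the tuple of its four entries. -/
def equivProd : NullSquare A N M B ≃ A × N × M × B where
  toFun x := (x.a, x.n, x.m, x.b)
  invFun x := ⟨x.1, x.2.1, x.2.2.1, x.2.2.2⟩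
  left_inv _ := rfl
  right_inv _ := rfl

variable [AddCommGroup A] [AddCommGroup N] [AddCommGroup M] [AddCommGroup B]

/-- Entrywise addition. -/
instance : AddCommGroup (NullSquare A N M B) := equivProd.addCommGroup

@[simp] theorem add_a (x y : NullSquare A N M B) : (x + y).a = x.a + y.a := rfl
@[simp] theorem add_n (x y : NullSquare A N M B) : (x + y).n = x.n + y.n := rfl
@[simp] theorem add_m (x y : NullSquare A N M B) : (x + y).m = x.m + y.m := rfl
@[simp] theorem add_b (x y : NullSquare A N M B) : (x + y).b = x.b + y.b := rfl
@[simp] theorem zero_a : (0 : NullSquare A N M B).a = 0 := rfl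
@[simp] theorem zero_n : (0 : NullSquare A N M B).n = 0 := rfl
@[simp] theorem zero_m : (0 : NullSquare A N M B).m = 0 := rfl
@[simp] theorem zero_b : (0 : NullSquare A N M B).b = 0 := rfl

variable {k : Type*} [Field k] [Module k A] [Module k N] [Module k M] [Module k B]

/-- Entrywise scalar multiplication. -/
instance : Module k (NullSquare A N M B) := equivProd.module k

@[simp] theorem smul_a (c : k) (x : NullSquare A N M B) : (c • x).a = c • x.a := rfl
@[simp] theorem smul_n (c : k) (x : NullSquare A N M B) : (c • x).n = c • x.n := rfl
@[simp] theorem smul_m (c : k) (x : NullSquare A N M B) : (c • x).m = c • x.m := rfl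
@[simp] theorem smul_b (c : k) (x : NullSquare A N M B) : (c • x).b = c • x.b := rfl

end Additive

section Multiplicative

variable {A B N M : Type*} [Ring A] [Ring B] [AddCommGroup N] [AddCommGroup M]

instance : One (NullSquare A N M B) := ⟨⟨1, 0, 0, 1⟩⟩

@[simp] theorem one_a : (1 : NullSquare A N M B).a = 1 := rfl
@[simp] theorem one_n : (1 : NullSquare A N M B).n = 0 := rfl
@[simp] theorem one_m : (1 : NullSquare A N M B).m = 0 := rfl
@[simp] theorem one_b : (1 : NullSquare A N M B).b = 1 := rfl
variable [Module A N] [Module Bᵐᵒᵖ N] [Module B M] [Module Aᵐᵒᵖ M]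

/-- Matrix multiplication, where products of two corner entries are zero:
`(a, n; m, b) (a', n'; m', b') = (a a', a n' + n b'; m a' + b m', b b')`. -/
instance : Mul (NullSquare A N M B) :=
  ⟨fun x y => ⟨x.a * y.a, x.a • y.n + MulOpposite.op y.b • x.n,
    MulOpposite.op y.a • x.m + x.b • y.m, x.b * y.b⟩⟩

@[simp] theorem mul_a (x y : NullSquare A N M B) : (x * y).a = x.a * y.a := rfl
@[simp] theorem mul_n (x y : NullSquare A N M B) :
    (x * y).n = x.a • y.n + MulOpposite.op y.b • x.n := rfl
@[simp] theorem mul_m (x y : NullSquare A N M B) :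
    (x * y).m = MulOpposite.op y.a • x.m + x.b • y.m := rfl
@[simp] theorem mul_b (x y : NullSquare A N M B) : (x * y).b = x.b * y.b := rfl

variable [SMulCommClass A Bᵐᵒᵖ N] [SMulCommClass B Aᵐᵒᵖ M]

instance : Ring (NullSquare A N M B) :=
  { (inferInstance : AddCommGroup (NullSquare A N M B)) with
    one := 1
    mul := (· * ·)
    left_distrib := fun x y z => by
      ext <;> simp [mul_add, add_smul, smul_add] <;> abel
    right_distrib := fun x y z => by
      ext <;> simp [add_mul, add_smul, smul_add] <;> abel
    zero_mul := fun x => by ext <;> simp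
    mul_zero := fun x => by ext <;> simp
    mul_assoc := fun x y z => by
      ext <;> simp [mul_assoc, mul_smul, smul_add, add_assoc, smul_comm]
    one_mul := fun x => by ext <;> simp
    mul_one := fun x => by ext <;> simp }

variable {k : Type*} [Field k] [Algebra k A] [Algebra k B] [Module k N] [Module k M]
  [IsScalarTower k A N] [IsScalarTower k Bᵐᵒᵖ N] [IsScalarTower k B M] [IsScalarTower k Aᵐᵒᵖ M]

instance : Algebra k (NullSquare A N M B) :=
  Algebra.ofModule
    (fun c x y => by
      ext
      · simp
      · simp only [mul_n, smul_a, smul_n, smul_add, smul_assoc]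
        rw [← algebraMap_smul Bᵐᵒᵖ c x.n, ← algebraMap_smul Bᵐᵒᵖ c (MulOpposite.op y.b • x.n),
          smul_smul, smul_smul, Algebra.commutes]
      · simp only [mul_m, smul_m, smul_b, smul_add, smul_assoc]
        rw [← algebraMap_smul Aᵐᵒᵖ c x.m, ← algebraMap_smul Aᵐᵒᵖ c (MulOpposite.op y.a • x.m),
          smul_smul, smul_smul, Algebra.commutes]
      · simp)
    (fun c x y => by
      ext
      · simp
      · simp only [mul_n, smul_b, smul_n, smul_add, MulOpposite.op_smul, smul_assoc]
        rw [← algebraMap_smul A c y.n, ← algebraMap_smul A c (x.a • y.n),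
          smul_smul, smul_smul, Algebra.commutes]
      · simp only [mul_m, smul_m, smul_a, smul_add, MulOpposite.op_smul, smul_assoc]
        rw [← algebraMap_smul B c y.m, ← algebraMap_smul B c (x.b • y.m),
          smul_smul, smul_smul, Algebra.commutes]
      · simp)

end Multiplicative

end NullSquare

/-! ### Projective bimodules given by idempotents -/

section CornerBimodules

variable (k : Type u) [Field k] {R S : Type v} [Ring R] [Ring S] [Algebra k R] [Algebra k S]

/-- `R r ⊗ s S`, the tensor product over `k` of the left ideal `R r` and the right ideal `s S`. -/
def IdealTensor (r : R) (s : S) : Type v :=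
  (Submodule.span R {r}) ⊗[k] (Submodule.span Sᵐᵒᵖ {s})

namespace IdealTensor

variable {k} (r : R) (s : S)

noncomputable instance : AddCommGroup (IdealTensor k r s) :=
  inferInstanceAs (AddCommGroup ((Submodule.span R {r}) ⊗[k] (Submodule.span Sᵐᵒᵖ {s})))

noncomputable instance : Module k (IdealTensor k r s) :=
  inferInstanceAs (Module k ((Submodule.span R {r}) ⊗[k] (Submodule.span Sᵐᵒᵖ {s})))

/-- `x • (p ⊗ q) = (x * p) ⊗ q`. -/
noncomputable instance : Module R (IdealTensor k r s) :=
  inferInstanceAs (Module R ((Submodule.span R {r}) ⊗[k] (Submodule.span Sᵐᵒᵖ {s})))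

instance : IsScalarTower k R (IdealTensor k r s) :=
  inferInstanceAs (IsScalarTower k R ((Submodule.span R {r}) ⊗[k] (Submodule.span Sᵐᵒᵖ {s})))

/-- The endomorphism `p ⊗ q ↦ p ⊗ (q * y)` for `y` in `S`, as a ring morphism from `Sᵒᵖ`. -/
noncomputable def rightAction : Sᵐᵒᵖ →+* Module.End R (IdealTensor k r s) where
  toFun y := TensorProduct.AlgebraTensorModule.map
    (LinearMap.id : Submodule.span R {r} →ₗ[R] Submodule.span R {r})
    (Module.toModuleEnd k (S := Sᵐᵒᵖ) (Submodule.span Sᵐᵒᵖ {s}) y)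
  map_one' := by
    rw [map_one]; exact TensorProduct.AlgebraTensorModule.map_id
  map_mul' x y := by
    rw [map_mul]
    exact TensorProduct.AlgebraTensorModule.map_comp LinearMap.id LinearMap.id _ _
  map_zero' := by
    rw [map_zero]
    refine TensorProduct.AlgebraTensorModule.ext fun p q => ?_
    exact TensorProduct.tmul_zero _ p
  map_add' x y := by
    rw [map_add]; exact TensorProduct.AlgebraTensorModule.map_add_right _ _ _

/-- `(p ⊗ q) • y = p ⊗ (q * y)`. -/
noncomputable instance : Module Sᵐᵒᵖ (IdealTensor k r s) :=
  Module.compHom (IdealTensor k r s) (rightAction (k := k) r s)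

theorem op_smul_def (y : Sᵐᵒᵖ) (t : IdealTensor k r s) : y • t = rightAction r s y t := rfl

variable {r s} in
/-- The pure tensor `p ⊗ q`. -/
def tmul (p : Submodule.span R {r}) (q : Submodule.span Sᵐᵒᵖ {s}) : IdealTensor k r s :=
  p ⊗ₜ[k] q

theorem smul_tmul (x : R) (p : Submodule.span R {r}) (q : Submodule.span Sᵐᵒᵖ {s}) :
    x • (tmul p q : IdealTensor k r s) = tmul (x • p) q := rfl

theorem op_smul_tmul (y : S) (p : Submodule.span R {r}) (q : Submodule.span Sᵐᵒᵖ {s}) :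
    MulOpposite.op y • (tmul p q : IdealTensor k r s) = tmul p (MulOpposite.op y • q) := rfl

instance : SMulCommClass R Sᵐᵒᵖ (IdealTensor k r s) :=
  ⟨fun x y t => ((rightAction r s y).map_smul x t).symm⟩

theorem rightAction_smul (c : k) (y : Sᵐᵒᵖ)
    (t : (Submodule.span R {r}) ⊗[k] (Submodule.span Sᵐᵒᵖ {s})) :
    rightAction (k := k) r s (c • y) t = c • rightAction (k := k) r s y t := by
  refine TensorProduct.induction_on t ?_ ?_ ?_
  · exact (map_zero (rightAction (k := k) r s (c • y))).trans
      ((congrArg (c • ·) (map_zero (rightAction (k := k) r s y))).trans (smul_zero c)).symm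
  · intro p q
    have h : (c • y) • q = c • (y • q) := smul_assoc c y q
    exact (congrArg (fun z => p ⊗ₜ[k] z) h).trans (TensorProduct.tmul_smul c p (y • q))
  · intro a b ha hb
    exact (map_add (rightAction (k := k) r s (c • y)) a b).trans
      ((congrArg₂ (· + ·) ha hb).trans
        ((smul_add c _ _).symm.trans
          (congrArg (c • ·) (map_add (rightAction (k := k) r s y) a b).symm)))

instance : IsScalarTower k Sᵐᵒᵖ (IdealTensor k r s) :=
  ⟨fun c y t => rightAction_smul r s c y t⟩

end IdealTensor

/-- For finite families `r` and `s` in `R` and `S` and multiplicities `mult`, the `R`-`S`-bimodule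
`⨁ mult i j • (R rᵢ ⊗ sⱼ S)`; a finite direct sum is a product. -/
abbrev CornerBimodule {ι κ : Type v} (r : ι → R) (s : κ → S) (mult : ι → κ → ℕ) : Type v :=
  ∀ (i : ι) (j : κ), Fin (mult i j) → IdealTensor k (r i) (s j)

/-- The null-square algebra with rows `(A, N)` and `(M, B)`, where
`M = ⨁ mM f e • (B f ⊗ e A)` and `N = ⨁ mN e f • (A e ⊗ f B)`. -/
abbrev NullSquareProjective {A B : Type v} [Ring A] [Ring B] [Algebra k A] [Algebra k B]
    (E : Finset A) (F : Finset B) (mM : F → E → ℕ) (mN : E → F → ℕ) : Type v :=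
  NullSquare A (CornerBimodule k (fun e : E => (e : A)) (fun f : F => (f : B)) mN)
    (CornerBimodule k (fun f : F => (f : B)) (fun e : E => (e : A)) mM) B

end CornerBimodules

/-! ### Systems of idempotents and quivers -/

/-- A system of `R`: a finite complete set of orthogonal idempotents. -/
def IsSystem {R : Type*} [Ring R] (E : Finset R) : Prop :=
  CompleteOrthogonalIdempotents (fun e : E => (e : R))

/-- The Peirce quiver of a family `x` of elements of `R` (used for systems): the vertices are the
indices, and there is an arrow from `i` to `j ≠ i` when `x j * R * x i` is not zero. -/
def peirceQuiver {R ι : Type*} [Ring R] (x : ι → R) : Digraph ι where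
  Adj i j := i ≠ j ∧ ∃ r : R, x j * r * x i ≠ 0

/-- The system `E ∪ F` of the matrix algebra, with `E` and `F` placed on the diagonal. -/
def diagonalSystem {A N M B : Type*} [Ring A] [Ring B] [AddCommGroup N] [AddCommGroup M]
    (E : Finset A) (F : Finset B) : E ⊕ F → NullSquare A N M B :=
  Sum.elim (fun e => ⟨e, 0, 0, 0⟩) (fun f => ⟨0, 0, 0, f⟩)

/-- The disjoint union of the Peirce quivers of `E` and `F` together with one arrow from `e` to `f`
for each non-zero `mM f e`, and one arrow from `f` to `e` for each non-zero `mN e f`. -/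
def multiplicityQuiver {A B : Type*} [Ring A] [Ring B] (E : Finset A) (F : Finset B)
    (mM : F → E → ℕ) (mN : E → F → ℕ) : Digraph (E ⊕ F) where
  Adj
    | .inl e, .inl e' => (peirceQuiver (fun x : E => (x : A))).Adj e e'
    | .inr f, .inr f' => (peirceQuiver (fun x : F => (x : B))).Adj f f'
    | .inl e, .inr f => mM f e ≠ 0
    | .inr f, .inl e => mN e f ≠ 0

/-- There is an efficient cycle: a cycle of length `l > 0`, written as an `l`-periodic sequence of
vertices, which never follows two successive arrows between vertices on the left of the sum, nor
two successive arrows between vertices on the right. -/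
def HasEfficientCycle {V W : Type*} (Q : Digraph (V ⊕ W)) : Prop :=
  ∃ (l : ℕ) (p : ℕ → V ⊕ W), 0 < l ∧ (∀ t, p (t + l) = p t) ∧ (∀ t, Q.Adj (p t) (p (t + 1))) ∧
    ∀ t, ¬ ((p t).isLeft ∧ (p (t + 1)).isLeft ∧ (p (t + 2)).isLeft) ∧
      ¬ ((p t).isRight ∧ (p (t + 1)).isRight ∧ (p (t + 2)).isRight)

/-!
Write `D = A × B` for the diagonal of `Λ`. The projection `Λ → D` is split by the inclusion of `D`,
and its kernel is a square-zero ideal, a finite direct sum of bimodules `D pⱼ ⊗ qⱼ D` with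
idempotents `pⱼ` and `qⱼ`, one for each summand of `M` and of `N`. This is all that most of the
argument uses, and it is recorded in the structure `SquareZeroPresentation`; the structure is stable
under passage to opposite algebras.

*Finite projective dimension.* Over `Λ`, the kernel of the surjection `Λ pⱼ → D pⱼ` is the
direct sum of the modules `D pᵢ ⊗ qᵢ D pⱼ`. So, if the relation `qᵢ D pⱼ ≠ 0` on the indices has no
cycle, induction gives that all modules `D pⱼ` have finite projective dimension
(`SquareZeroPresentation.exists_hasProjectiveDimensionLT_brick`), and the same holds for the right
modules `qⱼ D`. Each index is an arrow of the quivers between `E` and `F`, from the vertex of `qⱼ`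
to the vertex of `pⱼ`, and `qᵢ D pⱼ ≠ 0` says that the end of the arrow `j` is the origin of the
arrow `i`, or is joined to it by an arrow on the same side. A cycle of the relation is therefore an
efficient cycle, in each of the two quivers (`acyclic_of_not_hasEfficientCycle`).

*Comparison of `Ext`.* The bimodules `Λ`, `Λ ⊗_D D` and `Λ ⊗_D Λ` are linked by surjections
`Λ → D ← Λ ⊗_D D ← Λ ⊗_D Λ` whose kernels are direct sums of external tensor products `D pⱼ ⊗ qⱼ D`
and `Λ pⱼ ⊗ qⱼ D`, which have finite projective dimension. Hence `Λ` and `Λ ⊗_D Λ` have the same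
`Ext` in large degrees (`SquareZeroPresentation.exists_ext_regularBimodule_equiv`).

*Reduction to the diagonal.* A morphism from `Λ ⊗_D Λ` to a bimodule `Y` is an element of `Y` which
is centralized by `D`, that is, a pair of central elements of the corners `e Y e` and `e' Y e'` for
the central idempotents `e = (1, 0)` and `e' = (0, 1)` of `D`. As `Λ` is projective as a right and
as a left `D`-module, taking corners preserves injective modules, so that this representation passes to
`Ext` by dimension shifting (`nonempty_ext_linearEquiv_prod`). The corners of `Y = Λ` are `A` and
`B`, because `M` and `N` lie off the diagonal, and the result is the direct sum of the Hochschild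
cohomologies of `A` and `B`.

*Global dimension.* The one-sided corner functor from `Λ`-modules to `A`-modules does not raise
injective dimensions and is essentially surjective, so that a bound on the global dimension of `Λ`
is one for `A`, and likewise for `B` (`SquareZeroPresentation.infiniteGlobalDimension`).
-/

/-! ### Dimension shifting -/

section Homological

open CategoryTheory Abelian

universe w₁ w₂ w₃ v₁ v₂ v₃ u₁ u₂ u₃

/-- An isomorphism which matches the kernels of two surjections induces one of their targets. -/
theorem nonempty_linearEquiv_of_surjective {k M M' P P' : Type*} [Field k]
    [AddCommGroup M] [AddCommGroup M'] [AddCommGroup P] [AddCommGroup P']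
    [Module k M] [Module k M'] [Module k P] [Module k P']
    (a : M →ₗ[k] P) (b : M' →ₗ[k] P') (ha : Function.Surjective a) (hb : Function.Surjective b)
    (e : M ≃ₗ[k] M') (h : ∀ x, a x = 0 ↔ b (e x) = 0) : Nonempty (P ≃ₗ[k] P') := by
  have hker : (LinearMap.ker a).map (e : M →ₗ[k] M') = LinearMap.ker b := by
    ext y
    constructor
    · rintro ⟨x, hx, rfl⟩
      exact (h x).1 hx
    · intro hy
      refine ⟨e.symm y, (h _).2 ?_, by simp⟩
      simpa using hy
  exact ⟨(a.quotKerEquivOfSurjective ha).symm ≪≫ₗ Submodule.Quotient.equiv _ _ e hker ≪≫ₗ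
    b.quotKerEquivOfSurjective hb⟩

variable {C : Type u₁} [Category.{v₁} C] [Abelian C]

/-- An object which is a retract of a finite direct sum of objects of projective dimension `< n` has
projective dimension `< n`; the retraction is given by its components. -/
theorem hasProjectiveDimensionLT_of_id_eq_sum {J : Type*} [Fintype J] {X : C} {T : J → C} {n : ℕ}
    (φ : ∀ j, X ⟶ T j) (ψ : ∀ j, T j ⟶ X) (h : ∑ j, φ j ≫ ψ j = 𝟙 X)
    (hT : ∀ j, HasProjectiveDimensionLT (T j) n) : HasProjectiveDimensionLT X n := by
  let := HasExt.standard C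
  refine HasProjectiveDimensionLT.mk fun i hi Y e => ?_
  have h2 : e = (Ext.mk₀ (∑ j, φ j ≫ ψ j)).comp e (zero_add i) := by
    rw [h, Ext.mk₀_id_comp]
  rw [h2, Ext.mk₀_sum, Ext.sum_comp]
  refine Finset.sum_eq_zero fun j _ => ?_
  rw [← Ext.mk₀_comp_mk₀_assoc,
    (Ext.mk₀ (ψ j)).comp e (zero_add i) |>.eq_zero_of_hasProjectiveDimensionLT n hi,
    Ext.comp_zero]

/-- Passing to a quotient by a subobject of finite projective dimension does not change `Ext` in
large degrees. -/
theorem nonempty_ext_linearEquiv_of_shortExact {k : Type*} [Field k] [Linear k C] [HasExt.{w₁} C]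
    {S : ShortComplex C} (hS : S.ShortExact) {d : ℕ} (hd : HasProjectiveDimensionLT S.X₁ d)
    (Y : C) {n : ℕ} (hn : d + 1 ≤ n) : Nonempty (Ext S.X₃ Y n ≃ₗ[k] Ext S.X₂ Y n) := by
  refine ⟨LinearEquiv.ofBijective
    (Ext.precompOfLinear (Ext.mk₀ S.g) k Y (zero_add n)) ⟨?_, ?_⟩⟩
  · rw [injective_iff_map_eq_zero]
    intro x hx
    obtain ⟨n, rfl⟩ : ∃ m, n = 1 + m := ⟨n - 1, by omega⟩
    obtain ⟨y, hy⟩ := Ext.contravariant_sequence_exact₃ hS Y x hx rfl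
    rw [← hy, y.eq_zero_of_hasProjectiveDimensionLT d (by omega), Ext.comp_zero]
  · intro x
    exact Ext.contravariant_sequence_exact₂ hS Y x
      (Ext.eq_zero_of_hasProjectiveDimensionLT _ d (by omega))

variable {D₁ : Type u₂} [Category.{v₂} D₁] [Abelian D₁]
  {D₂ : Type u₃} [Category.{v₃} D₂] [Abelian D₂]

/-- The connecting map vanishes exactly on the morphisms which lift. -/
theorem ext_one_eq_zero_iff [HasExt.{w₁} C] {S : ShortComplex C} (hS : S.ShortExact) {X : C}
    (f : X ⟶ S.X₃) :
    (Ext.mk₀ f).comp hS.extClass (zero_add 1) = 0 ↔ ∃ g : X ⟶ S.X₂, g ≫ S.g = f := by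
  constructor
  · intro h
    obtain ⟨y, hy⟩ := Ext.covariant_sequence_exact₃ X hS (Ext.mk₀ f) (zero_add 1) h
    obtain ⟨g, rfl⟩ := (Ext.mk₀_bijective X S.X₂).2 y
    refine ⟨g, (Ext.mk₀_bijective X S.X₃).1 ?_⟩
    rw [← hy, Ext.mk₀_comp_mk₀]
  · rintro ⟨g, rfl⟩
    rw [← Ext.mk₀_comp_mk₀_assoc, hS.comp_extClass, Ext.comp_zero]

/-- The connecting map `Hom(X, S.X₃) → Ext¹(X, S.X₁)`. -/
noncomputable def connectingHom (k : Type*) [Field k] [Linear k C] [HasExt.{w₁} C]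
    {S : ShortComplex C} (hS : S.ShortExact) (X : C) : (X ⟶ S.X₃) →ₗ[k] Ext X S.X₁ 1 :=
  Ext.postcompOfLinear hS.extClass k X (zero_add 1) ∘ₗ Ext.linearEquiv₀.symm.toLinearMap

theorem connectingHom_apply (k : Type*) [Field k] [Linear k C] [HasExt.{w₁} C]
    {S : ShortComplex C} (hS : S.ShortExact) (X : C) (f : X ⟶ S.X₃) :
    connectingHom k hS X f = (Ext.mk₀ f).comp hS.extClass (zero_add 1) := rfl

theorem connectingHom_surjective (k : Type*) [Field k] [Linear k C] [HasExt.{w₁} C]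
    {S : ShortComplex C} (hS : S.ShortExact) (X : C) [Injective S.X₂] :
    Function.Surjective (connectingHom k hS X) := by
  intro x
  obtain ⟨y, hy⟩ := Ext.covariant_sequence_exact₁ X hS x (Ext.eq_zero_of_injective _) (zero_add 1)
  obtain ⟨g, rfl⟩ := (Ext.mk₀_bijective X S.X₃).2 y
  exact ⟨g, hy⟩

/-- Dimension shifting along a short exact sequence with injective middle term. -/
noncomputable def extShiftEquiv (k : Type*) [Field k] [Linear k C] [HasExt.{w₁} C]
    {S : ShortComplex C} (hS : S.ShortExact) (X : C) [Injective S.X₂] (n : ℕ) :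
    Ext X S.X₃ (n + 1) ≃ₗ[k] Ext X S.X₁ (n + 2) :=
  LinearEquiv.ofBijective (Ext.postcompOfLinear hS.extClass k X (rfl : (n + 1) + 1 = n + 2)) <| by
    constructor
    · rw [injective_iff_map_eq_zero]
      intro x hx
      obtain ⟨y, hy⟩ := Ext.covariant_sequence_exact₃ X hS x rfl hx
      rw [← hy, Ext.eq_zero_of_injective y, Ext.zero_comp]
    · intro x
      exact Ext.covariant_sequence_exact₁ X hS x (Ext.eq_zero_of_injective _) rfl

/-- If `W` represents `Y ↦ Hom(V₁, G₁ Y) × Hom(V₂, G₂ Y)` and the exact functors `G₁` and `G₂`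
preserve injective objects, then the representation extends to `Ext`. -/
theorem nonempty_ext_linearEquiv_prod {k : Type*} [Field k] [Linear k C] [Linear k D₁]
    [Linear k D₂] [HasExt.{w₁} C] [HasExt.{w₂} D₁] [HasExt.{w₃} D₂] [EnoughInjectives C]
    (G₁ : C ⥤ D₁) (G₂ : C ⥤ D₂) [G₁.Additive] [G₂.Additive]
    (h₁ : ∀ S : ShortComplex C, S.ShortExact → (S.map G₁).ShortExact)
    (h₂ : ∀ S : ShortComplex C, S.ShortExact → (S.map G₂).ShortExact)
    (hI₁ : ∀ I : C, Injective I → Injective (G₁.obj I))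
    (hI₂ : ∀ I : C, Injective I → Injective (G₂.obj I))
    {W : C} {V₁ : D₁} {V₂ : D₂}
    (e : ∀ Y : C, (W ⟶ Y) ≃ₗ[k] (V₁ ⟶ G₁.obj Y) × (V₂ ⟶ G₂.obj Y))
    (he : ∀ {Y Z : C} (f : Y ⟶ Z) (g : W ⟶ Y),
      e Z (g ≫ f) = ((e Y g).1 ≫ G₁.map f, (e Y g).2 ≫ G₂.map f)) (n : ℕ) (Y : C) :
    Nonempty (Ext W Y n ≃ₗ[k] Ext V₁ (G₁.obj Y) n × Ext V₂ (G₂.obj Y) n) := by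
  induction n using Nat.strong_induction_on generalizing Y with
  | _ n ih =>
  obtain ⟨P⟩ := EnoughInjectives.presentation Y
  have := P.injective
  let S : ShortComplex C := ShortComplex.mk P.f (Limits.cokernel.π P.f) (by simp)
  have hS : S.ShortExact := { exact := ShortComplex.exact_cokernel P.f }
  have hS₁ := h₁ S hS
  have hS₂ := h₂ S hS
  have : Injective S.X₂ := this
  have : Injective (S.map G₁).X₂ := hI₁ _ this
  have : Injective (S.map G₂).X₂ := hI₂ _ ‹Injective S.X₂›
  match n with
  | 0 =>
    exact ⟨Ext.linearEquiv₀ ≪≫ₗ e Y ≪≫ₗ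
      LinearEquiv.prodCongr Ext.linearEquiv₀.symm Ext.linearEquiv₀.symm⟩
  | 1 =>
    -- Both sides are the quotient of `Hom` to the cosyzygy by the morphisms which lift to the
    -- injective object; this is where `e` has to be natural.
    refine nonempty_linearEquiv_of_surjective (connectingHom k hS W)
      ((connectingHom k hS₁ V₁).prodMap (connectingHom k hS₂ V₂))
      (connectingHom_surjective k hS W)
      (Function.Surjective.prodMap (connectingHom_surjective k hS₁ V₁)
        (connectingHom_surjective k hS₂ V₂)) (e S.X₃) fun f => ?_
    refine Iff.trans ?_ (Prod.mk_eq_zero (x := connectingHom k hS₁ V₁ (e S.X₃ f).1)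
      (y := connectingHom k hS₂ V₂ (e S.X₃ f).2)).symm
    rw [connectingHom_apply, ext_one_eq_zero_iff]
    refine Iff.trans ?_ (and_congr (ext_one_eq_zero_iff hS₁ _) (ext_one_eq_zero_iff hS₂ _)).symm
    constructor
    · rintro ⟨g, rfl⟩
      rw [he]
      exact ⟨⟨_, rfl⟩, ⟨_, rfl⟩⟩
    · rintro ⟨⟨g₁, hg₁⟩, ⟨g₂, hg₂⟩⟩
      refine ⟨(e S.X₂).symm (g₁, g₂), (e S.X₃).injective ?_⟩
      rw [he, LinearEquiv.apply_symm_apply]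
      exact Prod.ext hg₁ hg₂
  | n + 2 =>
    obtain ⟨i⟩ := ih (n + 1) (by omega) S.X₃
    exact ⟨(extShiftEquiv k hS W n).symm ≪≫ₗ i ≪≫ₗ
      LinearEquiv.prodCongr (extShiftEquiv k hS₁ V₁ n) (extShiftEquiv k hS₂ V₂ n)⟩

/-- An exact functor preserving injective objects does not raise injective dimensions. -/
theorem hasInjectiveDimensionLT_obj [EnoughInjectives C] (G : C ⥤ D₁) [G.Additive]
    (hG : ∀ S : ShortComplex C, S.ShortExact → (S.map G).ShortExact)
    (hI : ∀ I : C, Injective I → Injective (G.obj I)) (n : ℕ) (Y : C)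
    (hY : HasInjectiveDimensionLT Y n) : HasInjectiveDimensionLT (G.obj Y) n := by
  induction n using Nat.strong_induction_on generalizing Y with
  | _ n ih =>
  match n with
  | 0 =>
    rw [hasInjectiveDimensionLT_zero_iff_isZero] at hY ⊢
    exact G.map_isZero hY
  | 1 =>
    rw [← injective_iff_hasInjectiveDimensionLT_one] at hY ⊢
    exact hI Y hY
  | n + 2 =>
    obtain ⟨P⟩ := EnoughInjectives.presentation Y
    have := P.injective
    let S : ShortComplex C := ShortComplex.mk P.f (Limits.cokernel.π P.f) (by simp)
    have hS : S.ShortExact := { exact := ShortComplex.exact_cokernel P.f }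
    have h₂ : Injective S.X₂ := this
    exact ((hG S hS).hasInjectiveDimensionLT_X₃_iff n (hI _ h₂)).1
      (ih (n + 1) (by omega) S.X₃ ((hS.hasInjectiveDimensionLT_X₃_iff n h₂).2 hY))

/-- Invariance of `Ext` under isomorphisms. -/
noncomputable def extCongr (k : Type*) [Field k] [Linear k C] [HasExt.{w₁} C] {X X' Y Y' : C}
    (e : X ≅ X') (f : Y ≅ Y') (n : ℕ) : Ext X Y n ≃ₗ[k] Ext X' Y' n :=
  LinearEquiv.ofLinearMap
    (Ext.precompOfLinear (Ext.mk₀ e.inv) k Y' (zero_add n) ∘ₗ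
      Ext.postcompOfLinear (Ext.mk₀ f.hom) k X (add_zero n))
    (Ext.precompOfLinear (Ext.mk₀ e.hom) k Y (zero_add n) ∘ₗ
      Ext.postcompOfLinear (Ext.mk₀ f.inv) k X' (add_zero n))
    (by
      ext x
      simp [Ext.comp_assoc_of_second_deg_zero])
    (by
      ext x
      simp [Ext.comp_assoc_of_second_deg_zero])

end Homological

/-! ### Corners of modules -/

section Corner

open CategoryTheory

/-- For a non-unital ring morphism `ι : S → R`, the image `ι 1 • Y` of the idempotent `ι 1` acting
on an `R`-module `Y`, encoded as the set of its fixed points. -/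
def Corner {R S : Type*} [Ring R] [Ring S] (ι : S →ₙ+* R) (Y : Type*) [AddCommGroup Y]
    [Module R Y] : Type _ :=
  (DistribSMul.toAddMonoidHom Y (ι 1) - AddMonoidHom.id Y).ker

namespace Corner

variable {R S : Type*} [Ring R] [Ring S] (ι : S →ₙ+* R) (Y : Type*) [AddCommGroup Y] [Module R Y]

instance : AddCommGroup (Corner ι Y) :=
  inferInstanceAs (AddCommGroup (DistribSMul.toAddMonoidHom Y (ι 1) - AddMonoidHom.id Y).ker)

variable {ι Y}

/-- The underlying element of `Y`. -/
def val (y : Corner ι Y) : Y := Subtype.val y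

theorem one_smul_val (y : Corner ι Y) : ι 1 • y.val = y.val :=
  sub_eq_zero.1 (show (ι 1 • y.val - y.val : Y) = 0 from y.2)

/-- The element of the corner given by a fixed point of `ι 1`. -/
def mk (y : Y) (hy : ι 1 • y = y) : Corner ι Y :=
  ⟨y, show ι 1 • y - y = 0 from sub_eq_zero.2 hy⟩

@[simp] theorem val_mk (y : Y) (hy : ι 1 • y = y) : (mk y hy).val = y := rfl

@[ext] theorem ext {x y : Corner ι Y} (h : x.val = y.val) : x = y := Subtype.ext h

@[simp] theorem val_add (x y : Corner ι Y) : (x + y).val = x.val + y.val := rfl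

@[simp] theorem val_zero : (0 : Corner ι Y).val = 0 := rfl

instance : SMul S (Corner ι Y) :=
  ⟨fun s y => mk (ι s • y.val) (by rw [smul_smul, ← map_mul, one_mul])⟩

@[simp] theorem val_smul (s : S) (y : Corner ι Y) : (s • y).val = ι s • y.val := rfl

instance : Module S (Corner ι Y) where
  one_smul y := ext (one_smul_val y)
  mul_smul s t y := ext (by simp [mul_smul])
  smul_zero s := ext (by simp)
  smul_add s x y := ext (by simp)
  add_smul s t y := ext (by simp [add_smul])
  zero_smul y := ext (by simp)

variable {Z : Type*} [AddCommGroup Z] [Module R Z]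

/-- Functoriality of the corner. -/
def map (ι : S →ₙ+* R) (f : Y →ₗ[R] Z) : Corner ι Y →ₗ[S] Corner ι Z where
  toFun y := mk (f y.val) (by rw [← map_smul, one_smul_val])
  map_add' x y := ext (by simp)
  map_smul' s y := ext (by simp)

end Corner

/-- The corner as a functor from `R`-modules to `S`-modules. -/
def cornerFunctor {R S : Type*} [Ring R] [Ring S] (ι : S →ₙ+* R) :
    ModuleCat.{v} R ⥤ ModuleCat.{v} S where
  obj Y := ModuleCat.of S (Corner ι Y)
  map f := ModuleCat.ofHom (Corner.map ι f.hom)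

instance {R S : Type*} [Ring R] [Ring S] (ι : S →ₙ+* R) : (cornerFunctor.{v} ι).Additive where
  map_add := by
    intros
    ext
    rfl

/-- The corner functor is exact, since the idempotent `ι 1` acts on all terms compatibly. -/
theorem cornerFunctor_shortExact {R S : Type*} [Ring R] [Ring S] (ι : S →ₙ+* R)
    (T : ShortComplex (ModuleCat.{v} R)) (hT : T.ShortExact) :
    (T.map (cornerFunctor ι)).ShortExact := by
  have hinj := hT.moduleCat_injective_f
  have hsurj := hT.moduleCat_surjective_g
  have hex := (ShortComplex.ShortExact.moduleCat_exact_iff_function_exact _).1 hT.exact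
  have hidem : ι 1 * ι 1 = ι 1 := by rw [← map_mul, one_mul]
  refine { exact := ?_, mono_f := ?_, epi_g := ?_ }
  · rw [ShortComplex.ShortExact.moduleCat_exact_iff_function_exact]
    intro y
    constructor
    · intro hy
      obtain ⟨x, hx⟩ := (hex (Corner.val y)).1 (congrArg Corner.val hy)
      refine ⟨Corner.mk x (hinj ?_), Corner.ext hx⟩
      exact (map_smul T.f.hom (ι 1) x).trans ((congrArg (ι 1 • ·) hx).trans
        ((Corner.one_smul_val y).trans hx.symm))
    · rintro ⟨x, rfl⟩
      exact Corner.ext ((hex _).2 ⟨_, rfl⟩)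
  · rw [ModuleCat.mono_iff_injective]
    intro x y h
    exact Corner.ext (hinj (congrArg Corner.val h))
  · rw [ModuleCat.epi_iff_surjective]
    intro z
    obtain ⟨y, hy⟩ := hsurj (Corner.val z)
    refine ⟨Corner.mk (ι 1 • y) (by rw [smul_smul, hidem]), Corner.ext ?_⟩
    change T.g.hom (ι 1 • y) = _
    rw [map_smul]
    exact (congrArg (ι 1 • ·) hy).trans (Corner.one_smul_val z)

variable {k : Type u} [Field k]

/-- A splitting `s` of the multiplication `R ⊗ S → R ι(1)` which is linear for the right actions
of `S`; its existence says that the right `S`-module `R ι(1)` is projective. -/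
structure IsCornerSection {R S : Type*} [Ring R] [Ring S] [Algebra k R] [Algebra k S]
    (ι : S →ₙₐ[k] R) (s : R →ₗ[k] R ⊗[k] S) : Prop where
  map_mul : ∀ r t, s (r * ι t) = LinearMap.lTensor R (LinearMap.mulRight k t) (s r)
  mul_map : ∀ r, LinearMap.mul' k R (LinearMap.lTensor R (ι : S →ₗ[k] R) (s r)) = r * ι 1

/-- If `R ι(1)` is projective as a right `S`-module, then the corner of an injective module is
injective. Baer's criterion is used twice: a morphism from a left ideal `J` of `S` to the corner
extends to the left ideal of `R` generated by `ι(J)`. -/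
theorem Corner.injective {R S : Type v} [Ring R] [Ring S] [Algebra k R] [Algebra k S]
    {ι : S →ₙₐ[k] R} {s : R →ₗ[k] R ⊗[k] S} (hs : IsCornerSection ι s) (I : Type v)
    [AddCommGroup I] [Module R I] (hI : Module.Injective R I) :
    Module.Injective S (Corner (ι : S →ₙ+* R) I) := by
  let : Module k I := Module.restrictScalars k R I
  have : IsScalarTower k R I := IsScalarTower.restrictScalars k R I
  refine Module.Baer.injective fun J g => ?_
  -- The map `g` is first extended to `S` as a `k`-linear map only.
  let g₀ : J.restrictScalars k →ₗ[k] I :=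
    { toFun := fun x => (g x).val
      map_add' := fun x y => congrArg Corner.val (g.map_add x y)
      map_smul' := fun c x => by
        have h : g (c • x) = algebraMap k S c • g x :=
          (congrArg g (Subtype.ext (Algebra.smul_def c (x : S)))).trans (g.map_smul _ x)
        refine (congrArg Corner.val h).trans ?_
        rw [Corner.val_smul, Algebra.algebraMap_eq_smul_one]
        change ι (c • (1 : S)) • _ = _
        rw [map_smul, smul_assoc]
        exact congrArg (c • ·) (Corner.one_smul_val (g x)) }
  obtain ⟨g', hg'⟩ := g₀.exists_extend
  have hg (x : S) (hx : x ∈ J) : g' x = (g ⟨x, hx⟩).val := LinearMap.congr_fun hg' ⟨x, hx⟩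
  -- The extension of `g` to the left ideal of `R` generated by `ι(J)` is `x ↦ act (s x)`.
  let act : R ⊗[k] S →ₗ[k] I :=
    TensorProduct.lift (LinearMap.mk₂ k (fun r t => r • g' t)
      (fun r r' t => add_smul r r' _) (fun c r t => smul_assoc c r _)
      (fun r t t' => by rw [map_add, smul_add])
      (fun c r t => by rw [map_smul, smul_algebra_smul_comm]))
  have hact (r : R) (t : S) : act (r ⊗ₜ t) = r • g' t := rfl
  have key (x : S) (hx : x ∈ J) (r : R) : act (s (r * ι x)) = r • (g ⟨x, hx⟩).val := by
    have h (z : R ⊗[k] S) : act (LinearMap.lTensor R (LinearMap.mulRight k x) z) =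
        LinearMap.mul' k R (LinearMap.lTensor R (ι : S →ₗ[k] R) z) • (g ⟨x, hx⟩).val := by
      induction z with
      | zero => simp
      | add a b ha hb => simp only [map_add, ha, hb, add_smul]
      | tmul a b =>
        rw [LinearMap.lTensor_tmul, LinearMap.lTensor_tmul, LinearMap.mul'_apply, hact,
          LinearMap.mulRight_apply, hg _ (J.mul_mem_left b hx), mul_smul]
        have h' : g ⟨b * x, J.mul_mem_left b hx⟩ = b • g ⟨x, hx⟩ := by
          rw [← map_smul]
          rfl
        rw [h']
        rfl
    rw [hs.map_mul, h, hs.mul_map, mul_smul]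
    exact congrArg (r • ·) (Corner.one_smul_val (g ⟨x, hx⟩))
  let K : Ideal R := Submodule.span R (ι '' (J : Set S))
  have hK (x : R) (hx : x ∈ K) : ∀ r : R, act (s (r * x)) = r • act (s x) := by
    induction hx using Submodule.span_induction with
    | mem x hx =>
      obtain ⟨t, ht, rfl⟩ := hx
      intro r
      rw [key t ht]
      congr 1
      rw [← one_mul (ι t), key t ht, one_smul]
    | zero => simp
    | add x y _ _ hx hy =>
      intro r
      rw [mul_add, map_add, map_add, map_add, map_add, hx, hy, smul_add]
    | smul a x _ hx =>
      intro r
      rw [smul_eq_mul, ← mul_assoc, hx, hx, mul_smul]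
  obtain ⟨F, hF⟩ := Module.Baer.of_injective hI K
    { toFun := fun x => act (s x)
      map_add' := fun x y => by simp
      map_smul' := fun r x => hK x x.2 r }
  have hz (x : S) (hx : x ∈ J) : ι x • F 1 = (g ⟨x, hx⟩).val := by
    rw [← map_smul, smul_eq_mul, mul_one, hF _ (Submodule.subset_span ⟨x, hx, rfl⟩)]
    change act (s (ι x)) = _
    rw [← one_mul (ι x), key x hx, one_smul]
  refine ⟨{ toFun := fun t => Corner.mk (ι t • F 1) ?_
            map_add' := fun x y => Corner.ext ?_
            map_smul' := fun a x => Corner.ext ?_ }, fun x hx => Corner.ext (hz x hx)⟩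
  · change ι 1 • ι t • F 1 = _
    rw [smul_smul, ← map_mul, one_mul]
  · change ι (x + y) • F 1 = ι x • F 1 + ι y • F 1
    rw [map_add, add_smul]
  · change ι (a * x) • F 1 = ι a • ι x • F 1
    rw [map_mul, mul_smul]

theorem cornerFunctor_injective {R S : Type v} [Ring R] [Ring S] [Algebra k R] [Algebra k S]
    {ι : S →ₙₐ[k] R} {s : R →ₗ[k] R ⊗[k] S} (hs : IsCornerSection ι s) (I : ModuleCat.{v} R)
    (hI : Injective I) : Injective ((cornerFunctor (ι : S →ₙ+* R)).obj I) :=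
  have := Corner.injective hs I
    ((Module.injective_iff_injective_object R I).2 hI)
  Module.injective_object_of_injective_module S (Corner (ι : S →ₙ+* R) I)

/-- The tensor product of non-unital algebra morphisms. -/
noncomputable def nonUnitalTensorMap {R₁ S₁ R₂ S₂ : Type*} [Ring R₁] [Ring S₁] [Ring R₂] [Ring S₂]
    [Algebra k R₁] [Algebra k S₁] [Algebra k R₂] [Algebra k S₂]
    (ι₁ : S₁ →ₙₐ[k] R₁) (ι₂ : S₂ →ₙₐ[k] R₂) : S₁ ⊗[k] S₂ →ₙₐ[k] R₁ ⊗[k] R₂ :=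
  { TensorProduct.map (ι₁ : S₁ →ₗ[k] R₁) (ι₂ : S₂ →ₗ[k] R₂) with
    map_zero' := map_zero _
    map_mul' := fun x y => by
      change TensorProduct.map _ _ (x * y) = TensorProduct.map _ _ x * TensorProduct.map _ _ y
      induction x with
      | zero => simp
      | add a b ha hb => rw [add_mul, map_add, ha, hb, map_add, add_mul]
      | tmul a b =>
        induction y with
        | zero => simp
        | add c d hc hd => rw [mul_add, map_add, hc, hd, map_add, mul_add]
        | tmul c d => simp }

@[simp] theorem nonUnitalTensorMap_tmul {R₁ S₁ R₂ S₂ : Type*} [Ring R₁] [Ring S₁] [Ring R₂]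
    [Ring S₂] [Algebra k R₁] [Algebra k S₁] [Algebra k R₂] [Algebra k S₂]
    (ι₁ : S₁ →ₙₐ[k] R₁) (ι₂ : S₂ →ₙₐ[k] R₂) (x : S₁) (y : S₂) :
    nonUnitalTensorMap ι₁ ι₂ (x ⊗ₜ y) = ι₁ x ⊗ₜ[k] ι₂ y := rfl

theorem IsCornerSection.tensor {R₁ S₁ R₂ S₂ : Type*} [Ring R₁] [Ring S₁] [Ring R₂] [Ring S₂]
    [Algebra k R₁] [Algebra k S₁] [Algebra k R₂] [Algebra k S₂]
    {ι₁ : S₁ →ₙₐ[k] R₁} {ι₂ : S₂ →ₙₐ[k] R₂} {s₁ : R₁ →ₗ[k] R₁ ⊗[k] S₁} {s₂ : R₂ →ₗ[k] R₂ ⊗[k] S₂}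
    (h₁ : IsCornerSection ι₁ s₁) (h₂ : IsCornerSection ι₂ s₂) :
    IsCornerSection (nonUnitalTensorMap ι₁ ι₂)
      ((TensorProduct.tensorTensorTensorComm k R₁ S₁ R₂ S₂).toLinearMap ∘ₗ
        TensorProduct.map s₁ s₂) where
  map_mul r t := by
    have key (t₁ : S₁) (t₂ : S₂) (z₁ : R₁ ⊗[k] S₁) (z₂ : R₂ ⊗[k] S₂) :
        TensorProduct.tensorTensorTensorComm k R₁ S₁ R₂ S₂
          (LinearMap.lTensor R₁ (LinearMap.mulRight k t₁) z₁ ⊗ₜ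
            LinearMap.lTensor R₂ (LinearMap.mulRight k t₂) z₂) =
        LinearMap.lTensor (R₁ ⊗[k] R₂) (LinearMap.mulRight k (t₁ ⊗ₜ[k] t₂))
          (TensorProduct.tensorTensorTensorComm k R₁ S₁ R₂ S₂ (z₁ ⊗ₜ z₂)) := by
      induction z₁ with
      | zero => simp
      | add a b ha hb => simp only [map_add, TensorProduct.add_tmul, ha, hb]
      | tmul a b =>
        induction z₂ with
        | zero => simp
        | add c d hc hd => simp only [map_add, TensorProduct.tmul_add, hc, hd]
        | tmul c d => simp
    induction t with
    | zero => simp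
    | add a b ha hb =>
      have hadd : LinearMap.mulRight k (a + b) = LinearMap.mulRight k a + LinearMap.mulRight k b :=
        LinearMap.ext fun x => mul_add x a b
      rw [map_add, mul_add, map_add, ha, hb, hadd, LinearMap.lTensor_add, LinearMap.add_apply]
    | tmul t₁ t₂ =>
      induction r with
      | zero => simp
      | add a b ha hb => rw [add_mul, map_add, ha, hb, map_add, map_add]
      | tmul r₁ r₂ =>
        rw [nonUnitalTensorMap_tmul, Algebra.TensorProduct.tmul_mul_tmul]
        simp only [LinearMap.comp_apply, TensorProduct.map_tmul, h₁.map_mul, h₂.map_mul]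
        exact key t₁ t₂ _ _
  mul_map r := by
    have key (z₁ : R₁ ⊗[k] S₁) (z₂ : R₂ ⊗[k] S₂) :
        LinearMap.mul' k (R₁ ⊗[k] R₂) (LinearMap.lTensor (R₁ ⊗[k] R₂)
          (nonUnitalTensorMap ι₁ ι₂ : S₁ ⊗[k] S₂ →ₗ[k] R₁ ⊗[k] R₂)
          (TensorProduct.tensorTensorTensorComm k R₁ S₁ R₂ S₂ (z₁ ⊗ₜ z₂))) =
        LinearMap.mul' k R₁ (LinearMap.lTensor R₁ (ι₁ : S₁ →ₗ[k] R₁) z₁) ⊗ₜ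
          LinearMap.mul' k R₂ (LinearMap.lTensor R₂ (ι₂ : S₂ →ₗ[k] R₂) z₂) := by
      induction z₁ with
      | zero => simp
      | add a b ha hb => simp only [map_add, TensorProduct.add_tmul, ha, hb]
      | tmul a b =>
        induction z₂ with
        | zero => simp
        | add c d hc hd => simp only [map_add, TensorProduct.tmul_add, hc, hd]
        | tmul c d => simp
    induction r with
    | zero => simp
    | add a b ha hb => simp only [map_add, ha, hb, add_mul]
    | tmul r₁ r₂ =>
      rw [Algebra.TensorProduct.one_def, nonUnitalTensorMap_tmul,
        Algebra.TensorProduct.tmul_mul_tmul, ← h₁.mul_map, ← h₂.mul_map, ← key]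
      rfl

end Corner

/-! ### External tensor products -/

section ExternalTensor

open CategoryTheory

open scoped ModuleCat

/-- If an exact functor sends projective objects to objects of bounded projective dimension, then
it preserves finiteness of projective dimensions. -/
theorem hasProjectiveDimensionLT_obj {C C' : Type*} [Category* C] [Abelian C] [Category* C']
    [Abelian C'] [EnoughProjectives C] (G : C ⥤ C') [G.Additive]
    (hG : ∀ S : ShortComplex C, S.ShortExact → (S.map G).ShortExact) (c : ℕ)
    (hP : ∀ P : C, Projective P → HasProjectiveDimensionLT (G.obj P) c) (n : ℕ) (X : C)
    (hX : HasProjectiveDimensionLT X n) : HasProjectiveDimensionLT (G.obj X) (n + c) := by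
  induction n using Nat.strong_induction_on generalizing X with
  | _ n ih =>
  match n with
  | 0 =>
    have := (G.map_isZero
      ((hasProjectiveDimensionLT_zero_iff_isZero X).1 hX)).hasProjectiveDimensionLT_zero
    exact hasProjectiveDimensionLT_of_ge _ 0 _ (Nat.zero_le _)
  | 1 =>
    have := hP X (projective_iff_hasProjectiveDimensionLT_one.2 hX)
    exact hasProjectiveDimensionLT_of_ge _ c _ (by omega)
  | n + 2 =>
    obtain ⟨P⟩ := EnoughProjectives.presentation X
    have := P.projective
    let S : ShortComplex C := ShortComplex.mk (Limits.kernel.ι P.f) P.f (by simp)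
    have hS : S.ShortExact := { exact := ShortComplex.exact_kernel P.f }
    have h₂ : Projective S.X₂ := this
    have h₁ : HasProjectiveDimensionLT S.X₁ (n + 1) :=
      (hS.hasProjectiveDimensionLT_X₃_iff n h₂).1 hX
    have h₁' := ih (n + 1) (by omega) S.X₁ h₁
    have := hP _ h₂
    have h₂' : HasProjectiveDimensionLT (G.obj S.X₂) (n + 1 + c + 1) :=
      hasProjectiveDimensionLT_of_ge _ c _ (by omega)
    have h := (hG S hS).hasProjectiveDimensionLT_X₃ (n + 1 + c) h₁' h₂'
    have e : n + 1 + c + 1 = n + 2 + c := by omega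
    rwa [e] at h

variable {k : Type u} [Field k] {A B : Type v} [Ring A] [Ring B] [Algebra k A] [Algebra k B]

theorem tensor_shortExact_aux {S : ShortComplex (ModuleCat.{v} A)} (hS : S.ShortExact)
    (U : Type v) [AddCommGroup U] [Module k U] :
    Function.Injective (LinearMap.rTensor U (S.f.hom.restrictScalars k)) ∧
    Function.Exact (LinearMap.rTensor U (S.f.hom.restrictScalars k))
      (LinearMap.rTensor U (S.g.hom.restrictScalars k)) ∧
    Function.Surjective (LinearMap.rTensor U (S.g.hom.restrictScalars k)) :=
  ⟨Module.Flat.rTensor_preserves_injective_linearMap _ hS.moduleCat_injective_f,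
    rTensor_exact U ((ShortComplex.ShortExact.moduleCat_exact_iff_function_exact S).1 hS.exact)
      hS.moduleCat_surjective_g,
    LinearMap.rTensor_surjective U hS.moduleCat_surjective_g⟩

/-- The functor `P ↦ P ⊗ U` on `A`-modules, for a vector space `U`. -/
noncomputable def tensorSpace (k : Type u) [Field k] (A : Type v) [Ring A] [Algebra k A]
    (U : Type v) [AddCommGroup U] [Module k U] : ModuleCat.{v} A ⥤ ModuleCat.{v} A where
  obj P := ModuleCat.of A (P ⊗[k] U)
  map f := ModuleCat.ofHom (AlgebraTensorModule.map f.hom (LinearMap.id : U →ₗ[k] U))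
  map_id P := by ext1; exact AlgebraTensorModule.map_id
  map_comp f g := by
    ext1
    exact AlgebraTensorModule.map_comp g.hom f.hom LinearMap.id LinearMap.id

instance (U : Type v) [AddCommGroup U] [Module k U] : (tensorSpace k A U).Additive where
  map_add := by
    intro P Q f g
    ext1
    exact AlgebraTensorModule.map_add_left f.hom g.hom _

theorem hasProjectiveDimensionLT_tensorSpace (U : Type v) [AddCommGroup U] [Module k U] (n : ℕ)
    (P : ModuleCat.{v} A) (hP : HasProjectiveDimensionLT P n) :
    HasProjectiveDimensionLT ((tensorSpace k A U).obj P) (n + 1) := by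
  refine hasProjectiveDimensionLT_obj (tensorSpace k A U) (fun S hS => ?_) 1 (fun Q hQ => ?_) n P hP
  · obtain ⟨h₁, h₂, h₃⟩ := tensor_shortExact_aux (k := k) hS U
    exact { exact := (ShortComplex.ShortExact.moduleCat_exact_iff_function_exact _).2 h₂
            mono_f := (ModuleCat.mono_iff_injective _).2 h₁
            epi_g := (ModuleCat.epi_iff_surjective _).2 h₃ }
  · have : Module.Projective A (Q ⊗[k] U) := Module.Projective.tensorProduct
    rw [← projective_iff_hasProjectiveDimensionLT_one]
    exact ModuleCat.projective_of_categoryTheory_projective (ModuleCat.of A (Q ⊗[k] U))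

/-- The type `P ⊗ Q`, as a carrier of the action `(x ⊗ y) • (p ⊗ q) = (x • p) ⊗ (y • q)` of
`A ⊗ B`. -/
def BoxCarrier (k : Type u) [Field k] {A B : Type v} [Ring A] [Ring B] [Algebra k A]
    [Algebra k B] (P : ModuleCat.{v} A) (Q : ModuleCat.{v} B) : Type v :=
  P ⊗[k] Q

noncomputable instance (P : ModuleCat.{v} A) (Q : ModuleCat.{v} B) :
    AddCommGroup (BoxCarrier k P Q) :=
  inferInstanceAs (AddCommGroup (P ⊗[k] Q))

noncomputable instance (P : ModuleCat.{v} A) (Q : ModuleCat.{v} B) :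
    Module (A ⊗[k] B) (BoxCarrier k P Q) :=
  Module.compHom (P ⊗[k] Q)
    ((Module.endTensorEndAlgHom (R := k) (S := k) (A := k) (M := P) (N := Q)).comp
      (Algebra.TensorProduct.map (Algebra.lsmul k k P) (Algebra.lsmul k k Q))).toRingHom

/-- The external tensor product of an `A`-module and a `B`-module. -/
noncomputable def box (k : Type u) [Field k] {A B : Type v} [Ring A] [Ring B] [Algebra k A]
    [Algebra k B] (P : ModuleCat.{v} A) (Q : ModuleCat.{v} B) : ModuleCat.{v} (A ⊗[k] B) :=
  ModuleCat.of (A ⊗[k] B) (BoxCarrier k P Q)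

/-- The identity of `P ⊗ Q`, with the module structure of `box` on the target. -/
noncomputable def toBox (P : ModuleCat.{v} A) (Q : ModuleCat.{v} B) : P ⊗[k] Q ≃+ box k P Q :=
  AddEquiv.refl (P ⊗[k] Q)

theorem smul_toBox_tmul (P : ModuleCat.{v} A) (Q : ModuleCat.{v} B) (x : A) (y : B) (p : P)
    (q : Q) : (x ⊗ₜ[k] y : A ⊗[k] B) • (toBox P Q (p ⊗ₜ q) : box k P Q) =
      toBox P Q ((x • p) ⊗ₜ (y • q)) := rfl

theorem smul_toBox (P : ModuleCat.{v} A) (Q : ModuleCat.{v} B) (x : A) (y : B) (z : P ⊗[k] Q) :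
    (x ⊗ₜ[k] y : A ⊗[k] B) • (toBox P Q z : box k P Q) =
      toBox P Q (TensorProduct.map (Algebra.lsmul k k P x) (Algebra.lsmul k k Q y) z) := rfl

/-- An additive map out of an external tensor product is linear if it is compatible with the
actions of pure tensors on pure tensors. -/
noncomputable def boxLift (P : ModuleCat.{v} A) (Q : ModuleCat.{v} B) {Y : Type*}
    [AddCommGroup Y] [Module (A ⊗[k] B) Y] (f : P ⊗[k] Q →+ Y)
    (hf : ∀ x y p q, f ((x • p) ⊗ₜ (y • q)) = (x ⊗ₜ[k] y : A ⊗[k] B) • f (p ⊗ₜ q)) :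
    box k P Q →ₗ[A ⊗[k] B] Y where
  toFun z := f ((toBox P Q).symm z)
  map_add' x y := by rw [map_add, map_add]
  map_smul' r z := by
    obtain ⟨z, rfl⟩ := (toBox P Q).surjective z
    rw [RingHom.id_apply, AddEquiv.symm_apply_apply]
    induction r with
    | zero => rw [zero_smul, zero_smul, map_zero, map_zero]
    | add a b ha hb => rw [add_smul, add_smul, map_add, map_add, ha, hb]
    | tmul x y =>
      induction z with
      | zero => rw [map_zero, smul_zero, map_zero, map_zero, smul_zero]
      | add a b ha hb => rw [map_add, smul_add, map_add, map_add, ha, hb, map_add, smul_add]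
      | tmul p q => rw [smul_toBox_tmul, AddEquiv.symm_apply_apply, hf]

/-- The canonical surjection `A^(P) ⊗ B^(Q) → P ⊗ Q` splits, being a tensor product of split
surjections. -/
theorem box_projective (P : ModuleCat.{v} A) (Q : ModuleCat.{v} B) (hP : Projective P)
    (hQ : Projective Q) : Projective (box k P Q) := by
  obtain ⟨s, hs⟩ := Module.Projective.out (R := A) (P := P)
  obtain ⟨t, ht⟩ := Module.Projective.out (R := B) (P := Q)
  let F : P ⊗[k] Q →ₗ[k] (P × Q →₀ A ⊗[k] B) :=
    (finsuppTensorFinsupp k k A B P Q).toLinearMap ∘ₗ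
      TensorProduct.map (s.restrictScalars k) (t.restrictScalars k)
  let L : (P × Q →₀ A ⊗[k] B) →ₗ[A ⊗[k] B] box k P Q :=
    Finsupp.linearCombination (A ⊗[k] B) fun z => toBox P Q (z.1 ⊗ₜ z.2)
  have hF : ∀ x y p q, F ((x • p) ⊗ₜ (y • q)) = (x ⊗ₜ[k] y : A ⊗[k] B) • F (p ⊗ₜ q) := by
    intro x y p q
    ext ⟨i, j⟩
    simp [F, finsuppTensorFinsupp_apply]
  have hL (a : P →₀ A) (b : Q →₀ B) : L (finsuppTensorFinsupp k k A B P Q (a ⊗ₜ b)) =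
      toBox P Q (Finsupp.linearCombination A id a ⊗ₜ Finsupp.linearCombination B id b) := by
    induction a using Finsupp.induction_linear with
    | zero => simp
    | add a a' h h' => simp only [TensorProduct.add_tmul, map_add, h, h']
    | single p x =>
      induction b using Finsupp.induction_linear with
      | zero => simp
      | add a a' h h' => simp only [TensorProduct.tmul_add, map_add, h, h']
      | single q y =>
        rw [finsuppTensorFinsupp_single, Finsupp.linearCombination_single,
          Finsupp.linearCombination_single, Finsupp.linearCombination_single]
        exact smul_toBox_tmul P Q x y p q
  have : Module.Projective (A ⊗[k] B) (box k P Q) := by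
    refine Module.Projective.of_split (boxLift P Q F.toAddMonoidHom hF) L ?_
    ext z
    obtain ⟨z, rfl⟩ := (toBox P Q).surjective z
    change L (F z) = toBox P Q z
    induction z with
    | zero => simp
    | add a b ha hb => rw [map_add, map_add, ha, hb, map_add]
    | tmul p q =>
      refine (hL (s p) (t q)).trans ?_
      rw [hs p, ht q]
  exact ModuleCat.projective_of_categoryTheory_projective _

/-- Functoriality of the external tensor product. -/
noncomputable def boxMap {P P' : ModuleCat.{v} A} {Q Q' : ModuleCat.{v} B} (f : P ⟶ P')
    (g : Q ⟶ Q') : box k P Q ⟶ box k P' Q' :=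
  ModuleCat.ofHom (boxLift (Y := box k P' Q') P Q ((toBox P' Q').toAddMonoidHom.comp
    (TensorProduct.map (f.hom.restrictScalars k) (g.hom.restrictScalars k)).toAddMonoidHom)
    fun x y p q => by
      change toBox P' Q' (f.hom (x • p) ⊗ₜ g.hom (y • q)) = _
      rw [map_smul, map_smul]
      rfl)

/-- `P ↦ P ⊗ Q` as a functor from `A`-modules to `A ⊗ B`-modules. -/
noncomputable def boxRight (A : Type v) [Ring A] [Algebra k A] (Q : ModuleCat.{v} B) :
    ModuleCat.{v} A ⥤ ModuleCat.{v} (A ⊗[k] B) where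
  obj P := box k P Q
  map f := boxMap f (𝟙 Q)
  map_id P := by
    ext1
    refine LinearMap.ext fun z => ?_
    obtain ⟨z, rfl⟩ := (toBox P Q).surjective z
    exact congrArg (toBox P Q) (LinearMap.congr_fun TensorProduct.map_id z)
  map_comp {P P' P''} f g := by
    ext1
    refine LinearMap.ext fun z => ?_
    obtain ⟨z, rfl⟩ := (toBox P Q).surjective z
    exact congrArg (toBox P'' Q) (LinearMap.congr_fun
      (LinearMap.rTensor_comp (M := Q) (g.hom.restrictScalars k) (f.hom.restrictScalars k)) z)

/-- `Q ↦ P ⊗ Q` as a functor from `B`-modules to `A ⊗ B`-modules. -/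
noncomputable def boxLeft (B : Type v) [Ring B] [Algebra k B] (P : ModuleCat.{v} A) :
    ModuleCat.{v} B ⥤ ModuleCat.{v} (A ⊗[k] B) where
  obj Q := box k P Q
  map f := boxMap (𝟙 P) f
  map_id Q := by
    ext1
    refine LinearMap.ext fun z => ?_
    obtain ⟨z, rfl⟩ := (toBox P Q).surjective z
    exact congrArg (toBox P Q) (LinearMap.congr_fun TensorProduct.map_id z)
  map_comp {Q Q' Q''} f g := by
    ext1
    refine LinearMap.ext fun z => ?_
    obtain ⟨z, rfl⟩ := (toBox P Q).surjective z
    exact congrArg (toBox P Q'') (LinearMap.congr_fun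
      (LinearMap.lTensor_comp (M := P) (g.hom.restrictScalars k) (f.hom.restrictScalars k)) z)

instance (Q : ModuleCat.{v} B) : (boxRight (k := k) A Q).Additive where
  map_add := by
    intro P P' f g
    ext1
    refine LinearMap.ext fun z => ?_
    obtain ⟨z, rfl⟩ := (toBox P Q).surjective z
    exact congrArg (toBox P' Q) (LinearMap.congr_fun
      (LinearMap.rTensor_add (M := Q) (f.hom.restrictScalars k) (g.hom.restrictScalars k)) z)

instance (P : ModuleCat.{v} A) : (boxLeft (k := k) B P).Additive where
  map_add := by
    intro Q Q' f g
    ext1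
    refine LinearMap.ext fun z => ?_
    obtain ⟨z, rfl⟩ := (toBox P Q).surjective z
    exact congrArg (toBox P Q') (LinearMap.congr_fun
      (LinearMap.lTensor_add (M := P) (f.hom.restrictScalars k) (g.hom.restrictScalars k)) z)

theorem boxRight_shortExact (Q : ModuleCat.{v} B) (S : ShortComplex (ModuleCat.{v} A))
    (hS : S.ShortExact) : (S.map (boxRight (k := k) A Q)).ShortExact := by
  obtain ⟨h₁, h₂, h₃⟩ := tensor_shortExact_aux (k := k) hS Q
  exact { exact := (ShortComplex.ShortExact.moduleCat_exact_iff_function_exact _).2 h₂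
          mono_f := (ModuleCat.mono_iff_injective _).2 h₁
          epi_g := (ModuleCat.epi_iff_surjective _).2 h₃ }

theorem boxLeft_shortExact (P : ModuleCat.{v} A) (S : ShortComplex (ModuleCat.{v} B))
    (hS : S.ShortExact) : (S.map (boxLeft (k := k) B P)).ShortExact where
  exact := (ShortComplex.ShortExact.moduleCat_exact_iff_function_exact _).2
    (lTensor_exact P (f := S.f.hom.restrictScalars k) (g := S.g.hom.restrictScalars k)
      ((ShortComplex.ShortExact.moduleCat_exact_iff_function_exact S).1 hS.exact)
      hS.moduleCat_surjective_g)
  mono_f := (ModuleCat.mono_iff_injective _).2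
    (Module.Flat.lTensor_preserves_injective_linearMap (M := P) (S.f.hom.restrictScalars k)
      hS.moduleCat_injective_f)
  epi_g := (ModuleCat.epi_iff_surjective _).2
    (LinearMap.lTensor_surjective P (g := S.g.hom.restrictScalars k) hS.moduleCat_surjective_g)

/-- External tensor products of modules of finite projective dimension have finite projective
dimension. -/
theorem hasProjectiveDimensionLT_box (P : ModuleCat.{v} A) (Q : ModuleCat.{v} B) {m n : ℕ}
    (hP : HasProjectiveDimensionLT P m) (hQ : HasProjectiveDimensionLT Q n) :
    HasProjectiveDimensionLT (box k P Q) (m + (n + 1)) :=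
  hasProjectiveDimensionLT_obj (boxRight A Q) (boxRight_shortExact Q) (n + 1)
    (fun P' hP' => hasProjectiveDimensionLT_obj (boxLeft B P') (boxLeft_shortExact P') 1
      (fun Q' hQ' => projective_iff_hasProjectiveDimensionLT_one.1 (box_projective P' Q' hP' hQ'))
      n Q hQ) m P hP

end ExternalTensor

/-! ### Split square-zero extensions -/

section SquareZero

open CategoryTheory

open scoped ModuleCat

/-- The map `d ⊗ d' ↦ d * g * d'` with values in an algebra `Λ` over `D`. -/
noncomputable def tensorEval {k : Type u} [Field k] {D Λ : Type v} [Ring D] [Ring Λ]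
    [Algebra k D] [Algebra k Λ] (incl : D →ₐ[k] Λ) (g : Λ) : D ⊗[k] D →ₗ[k] Λ :=
  LinearMap.mul' k Λ ∘ₗ TensorProduct.map
    (LinearMap.mulRight k g ∘ₗ incl.toLinearMap) incl.toLinearMap

@[simp] theorem tensorEval_tmul {k : Type u} [Field k] {D Λ : Type v} [Ring D] [Ring Λ]
    [Algebra k D] [Algebra k Λ] (incl : D →ₐ[k] Λ) (g : Λ) (d d' : D) :
    tensorEval incl g (d ⊗ₜ[k] d') = incl d * g * incl d' := rfl

/-- A presentation of a `k`-algebra `Λ` as the extension of an algebra `D` by a square-zero ideal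
`ker proj` which is a direct sum of bimodules `D pⱼ ⊗ qⱼ D`. The summand of index `j` is generated
by the element `gen j`, and `coord j x` is the component of the part of `x` in the ideal, considered
as an element of `D ⊗ D`, which contains `D pⱼ ⊗ qⱼ D`. -/
structure SquareZeroPresentation (k : Type u) [Field k] (D Λ : Type v) [Ring D] [Ring Λ]
    [Algebra k D] [Algebra k Λ] (J : Type w) [Fintype J] where
  /-- the inclusion of `D` -/
  incl : D →ₐ[k] Λ
  /-- the projection to `D` -/
  proj : Λ →ₐ[k] D
  /-- the idempotents on the left -/
  p : J → D
  /-- the idempotents on the right -/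
  q : J → D
  /-- the generators of the ideal -/
  gen : J → Λ
  /-- the coordinates of an element -/
  coord : J → Λ →ₗ[k] D ⊗[k] D
  proj_incl : ∀ d, proj (incl d) = d
  p_mul_p : ∀ j, p j * p j = p j
  q_mul_q : ∀ j, q j * q j = q j
  proj_gen : ∀ j, proj (gen j) = 0
  p_mul_gen : ∀ j, incl (p j) * gen j = gen j
  gen_mul_q : ∀ j, gen j * incl (q j) = gen j
  mul_eq_zero : ∀ x y, proj x = 0 → proj y = 0 → x * y = 0
  coord_incl : ∀ j d, coord j (incl d) = 0
  coord_mul : ∀ j x y, coord j (x * y) =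
    LinearMap.rTensor D (LinearMap.mulLeft k (proj x)) (coord j y) +
      LinearMap.lTensor D (LinearMap.mulRight k (proj y)) (coord j x)
  sum_coord : ∀ x, incl (proj x) + ∑ j, tensorEval incl (gen j) (coord j x) = x

namespace SquareZeroPresentation

variable {k : Type u} [Field k] {D Λ : Type v} [Ring D] [Ring Λ] [Algebra k D] [Algebra k Λ]
  {J : Type w} [Fintype J] (S : SquareZeroPresentation k D Λ J)

/-- The map `d ⊗ d' ↦ d * gen j * d'`. -/
noncomputable def eval (j : J) : D ⊗[k] D →ₗ[k] Λ := tensorEval S.incl (S.gen j)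

@[simp] theorem eval_tmul (j : J) (d d' : D) :
    S.eval j (d ⊗ₜ d') = S.incl d * S.gen j * S.incl d' := rfl

theorem sum_eval_coord (x : Λ) : S.incl (S.proj x) + ∑ j, S.eval j (S.coord j x) = x :=
  S.sum_coord x

theorem proj_eval (j : J) (z : D ⊗[k] D) : S.proj (S.eval j z) = 0 := by
  induction z with
  | zero => simp
  | add a b ha hb => rw [map_add, map_add, ha, hb, add_zero]
  | tmul a b => rw [eval_tmul, map_mul, map_mul, S.proj_gen, mul_zero, zero_mul]

/-- Multiplication by `x` on elements of the ideal only depends on the image of `x` in `D`. -/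
theorem mul_eq_incl_mul (x y : Λ) (hy : S.proj y = 0) : x * y = S.incl (S.proj x) * y := by
  rw [← sub_eq_zero, ← sub_mul]
  exact S.mul_eq_zero _ _ (by rw [map_sub, S.proj_incl, sub_self]) hy

theorem mul_eq_mul_incl (x y : Λ) (hx : S.proj x = 0) : x * y = x * S.incl (S.proj y) := by
  rw [← sub_eq_zero, ← mul_sub]
  exact S.mul_eq_zero _ _ hx (by rw [map_sub, S.proj_incl, sub_self])

theorem coord_mul_incl (j : J) (x : Λ) (d : D) :
    S.coord j (x * S.incl d) = LinearMap.lTensor D (LinearMap.mulRight k d) (S.coord j x) := by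
  rw [S.coord_mul, S.coord_incl, map_zero, zero_add, S.proj_incl]

/-- The exchange of factors `D ⊗ D → Dᵒᵖ ⊗ Dᵒᵖ`. -/
noncomputable def opSwap (k : Type u) [Field k] (D : Type v) [Ring D] [Algebra k D] :
    D ⊗[k] D →ₗ[k] Dᵐᵒᵖ ⊗[k] Dᵐᵒᵖ :=
  TensorProduct.map (MulOpposite.opLinearEquiv k).toLinearMap
    (MulOpposite.opLinearEquiv k).toLinearMap ∘ₗ (TensorProduct.comm k D D).toLinearMap

@[simp] theorem opSwap_tmul (a b : D) :
    opSwap k D (a ⊗ₜ b) = MulOpposite.op b ⊗ₜ[k] MulOpposite.op a := rfl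

theorem opSwap_rTensor (d : D) (z : D ⊗[k] D) :
    opSwap k D (LinearMap.rTensor D (LinearMap.mulLeft k d) z) =
      LinearMap.lTensor Dᵐᵒᵖ (LinearMap.mulRight k (MulOpposite.op d)) (opSwap k D z) := by
  induction z with
  | zero => simp
  | add a b ha hb => simp only [map_add, ha, hb]
  | tmul a b => simp

theorem opSwap_lTensor (d : D) (z : D ⊗[k] D) :
    opSwap k D (LinearMap.lTensor D (LinearMap.mulRight k d) z) =
      LinearMap.rTensor Dᵐᵒᵖ (LinearMap.mulLeft k (MulOpposite.op d)) (opSwap k D z) := by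
  induction z with
  | zero => simp
  | add a b ha hb => simp only [map_add, ha, hb]
  | tmul a b => simp

/-- The presentation of the opposite algebra. -/
noncomputable def op : SquareZeroPresentation k Dᵐᵒᵖ Λᵐᵒᵖ J where
  incl := AlgHom.op S.incl
  proj := AlgHom.op S.proj
  p j := MulOpposite.op (S.q j)
  q j := MulOpposite.op (S.p j)
  gen j := MulOpposite.op (S.gen j)
  coord j := opSwap k D ∘ₗ S.coord j ∘ₗ (MulOpposite.opLinearEquiv k).symm.toLinearMap
  proj_incl d := MulOpposite.unop_injective (S.proj_incl d.unop)
  p_mul_p j := MulOpposite.unop_injective (S.q_mul_q j)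
  q_mul_q j := MulOpposite.unop_injective (S.p_mul_p j)
  proj_gen j := MulOpposite.unop_injective (S.proj_gen j)
  p_mul_gen j := MulOpposite.unop_injective (S.gen_mul_q j)
  gen_mul_q j := MulOpposite.unop_injective (S.p_mul_gen j)
  mul_eq_zero x y hx hy := MulOpposite.unop_injective (S.mul_eq_zero y.unop x.unop
    (MulOpposite.op_injective hy) (MulOpposite.op_injective hx))
  coord_incl j d := by
    change opSwap k D (S.coord j (S.incl d.unop)) = 0
    rw [S.coord_incl, map_zero]
  coord_mul j x y := by
    change opSwap k D (S.coord j (y.unop * x.unop)) = _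
    rw [S.coord_mul, map_add, opSwap_rTensor, opSwap_lTensor, add_comm]
    rfl
  sum_coord x := by
    have h (j : J) (z : D ⊗[k] D) : tensorEval (AlgHom.op S.incl) (MulOpposite.op (S.gen j))
        (opSwap k D z) = MulOpposite.op (S.eval j z) := by
      induction z with
      | zero => simp
      | add a b ha hb => simp only [map_add, ha, hb, MulOpposite.op_add]
      | tmul a b => simp [mul_assoc]
    refine Eq.trans ?_ (congrArg MulOpposite.op (S.sum_eval_coord x.unop))
    rw [MulOpposite.op_add, Finset.op_sum]
    congr 1
    exact Finset.sum_congr rfl fun j _ => h j _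

/-! ### The section of the multiplication map -/

/-- `τ : D → C` and `ν : C → D` identify `C` with a direct factor of the algebra `D`. -/
structure IsBlock {D C : Type*} [Ring D] [Ring C] [Algebra k D] [Algebra k C] (τ : D →ₐ[k] C)
    (ν : C →ₙₐ[k] D) : Prop where
  left_inv : ∀ c, τ (ν c) = c
  mul_one : ∀ d, ν (τ d) = d * ν 1
  one_mul : ∀ d, ν (τ d) = ν 1 * d

/-- The opposite of a non-unital algebra morphism. -/
def nonUnitalOp {D C : Type*} [Ring D] [Ring C] [Algebra k D] [Algebra k C] (ν : C →ₙₐ[k] D) :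
    Cᵐᵒᵖ →ₙₐ[k] Dᵐᵒᵖ where
  toFun c := MulOpposite.op (ν c.unop)
  map_smul' c x := by simp
  map_zero' := by simp
  map_add' x y := by simp
  map_mul' x y := by simp

theorem IsBlock.op {D C : Type*} [Ring D] [Ring C] [Algebra k D] [Algebra k C] {τ : D →ₐ[k] C}
    {ν : C →ₙₐ[k] D} (h : IsBlock τ ν) : IsBlock (AlgHom.op τ) (nonUnitalOp ν) where
  left_inv c := MulOpposite.unop_injective (h.left_inv c.unop)
  mul_one d := MulOpposite.unop_injective (h.one_mul d.unop)
  one_mul d := MulOpposite.unop_injective (h.mul_one d.unop)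

variable {C : Type v} [Ring C] [Algebra k C]

/-- The embedding in `Λ` of a direct factor of `D`. -/
def blockIncl (ν : C →ₙₐ[k] D) : C →ₙₐ[k] Λ := (S.incl : D →ₙₐ[k] Λ).comp ν

@[simp] theorem blockIncl_apply (ν : C →ₙₐ[k] D) (c : C) : S.blockIncl ν c = S.incl (ν c) := rfl

/-- The map `x ↦ 1 ⊗ proj x + ∑ⱼ (d * gen j) ⊗ d'`, where `coord j x = d ⊗ d'`, which splits the
multiplication `Λ ⊗ D → Λ`, followed by the projection to a direct factor of `D`. -/
noncomputable def blockSection (τ : D →ₐ[k] C) : Λ →ₗ[k] Λ ⊗[k] C :=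
  TensorProduct.mk k Λ C 1 ∘ₗ τ.toLinearMap ∘ₗ S.proj.toLinearMap +
    ∑ j, TensorProduct.map (LinearMap.mulRight k (S.gen j) ∘ₗ S.incl.toLinearMap)
      τ.toLinearMap ∘ₗ S.coord j

theorem blockSection_apply (τ : D →ₐ[k] C) (x : Λ) :
    S.blockSection τ x = 1 ⊗ₜ τ (S.proj x) +
      ∑ j, TensorProduct.map (LinearMap.mulRight k (S.gen j) ∘ₗ S.incl.toLinearMap)
        τ.toLinearMap (S.coord j x) := by
  simp [blockSection]

/-- The algebra `Λ` is projective as a right module over each direct factor of `D`. -/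
theorem isCornerSection {τ : D →ₐ[k] C} {ν : C →ₙₐ[k] D} (h : IsBlock τ ν) :
    IsCornerSection (S.blockIncl ν) (S.blockSection τ) where
  map_mul x c := by
    have key (j : J) (z : D ⊗[k] D) :
        TensorProduct.map (LinearMap.mulRight k (S.gen j) ∘ₗ S.incl.toLinearMap) τ.toLinearMap
          (LinearMap.lTensor D (LinearMap.mulRight k (ν c)) z) =
        LinearMap.lTensor Λ (LinearMap.mulRight k c) (TensorProduct.map
          (LinearMap.mulRight k (S.gen j) ∘ₗ S.incl.toLinearMap) τ.toLinearMap z) := by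
      induction z with
      | zero => simp
      | add a b ha hb => simp only [map_add, ha, hb]
      | tmul a b => simp [h.left_inv]
    rw [blockSection_apply, blockSection_apply, map_add, map_sum, blockIncl_apply, map_mul,
      S.proj_incl, map_mul, h.left_inv]
    congr 1
    refine Finset.sum_congr rfl fun j _ => ?_
    rw [S.coord_mul_incl, key]
  mul_map x := by
    have key (j : J) (z : D ⊗[k] D) :
        LinearMap.mul' k Λ (LinearMap.lTensor Λ (S.blockIncl ν : C →ₗ[k] Λ) (TensorProduct.map
          (LinearMap.mulRight k (S.gen j) ∘ₗ S.incl.toLinearMap) τ.toLinearMap z)) =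
        S.eval j z * S.incl (ν 1) := by
      induction z with
      | zero => simp
      | add a b ha hb => simp only [map_add, ha, hb, add_mul]
      | tmul a b => simp [h.mul_one, mul_assoc]
    rw [blockSection_apply, map_add, map_sum, map_add, map_sum, Finset.sum_congr rfl
      fun j _ => key j (S.coord j x), ← Finset.sum_mul]
    nth_rewrite 3 [← S.sum_eval_coord x]
    rw [add_mul]
    simp [h.mul_one]

/-! ### The modules `D pⱼ` over the extension -/

/-- The left ideal `R e` for an idempotent `e`, as the set of fixed points of the right
multiplication by `e`. -/
def leftFix {R : Type*} [Ring R] (e : R) : Submodule R R where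
  carrier := {x | x * e = x}
  add_mem' {x y} hx hy := by
    rw [Set.mem_ofPred_eq] at *
    rw [add_mul, hx, hy]
  zero_mem' := zero_mul e
  smul_mem' c x hx := by
    rw [Set.mem_ofPred_eq] at *
    rw [smul_eq_mul, mul_assoc, hx]

theorem leftFix_projective {R : Type v} [Ring R] {e : R} (he : e * e = e) :
    Projective (ModuleCat.of R (leftFix e)) := by
  have : Module.Projective R (leftFix e) := by
    refine Module.Projective.of_split (leftFix e).subtype
      (LinearMap.codRestrict (leftFix e) (LinearMap.toSpanSingleton R R e) fun x => ?_) ?_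
    · change x * e * e = x * e
      rw [mul_assoc, he]
    · ext x
      exact x.2
  exact ModuleCat.projective_of_categoryTheory_projective _

/-- The left ideal `D pⱼ` of `D`, as the carrier of a `Λ`-module. -/
def Brick (j : J) : Type v := leftFix (S.p j)

instance (j : J) : AddCommGroup (S.Brick j) := inferInstanceAs (AddCommGroup (leftFix (S.p j)))

/-- `Λ` acts on `D pⱼ` through the projection to `D`. -/
instance (j : J) : Module Λ (S.Brick j) :=
  Module.compHom (leftFix (S.p j)) S.proj.toRingHom

/-- The `Λ`-module `D pⱼ`. -/
def brick (j : J) : ModuleCat.{v} Λ := ModuleCat.of Λ (S.Brick j)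

/-- The underlying element of `D`. -/
def brickVal (j : J) : S.brick j →ₗ[k] D where
  toFun x := Subtype.val (p := fun d : D => d ∈ leftFix (S.p j)) x
  map_add' _ _ := rfl
  map_smul' c x := by
    change S.proj (algebraMap k Λ c) * _ = _
    rw [AlgHom.commutes, ← Algebra.smul_def]
    rfl

/-- Right multiplication by `pⱼ`. -/
def toBrick (j : J) : D →ₗ[k] S.brick j where
  toFun d := (⟨d * S.p j, by change d * S.p j * S.p j = _; rw [mul_assoc, S.p_mul_p]⟩ :
    leftFix (S.p j))
  map_add' x y := Subtype.ext (add_mul x y _)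
  map_smul' c x := Subtype.ext (by
    change (c • x) * S.p j = S.proj (algebraMap k Λ c) * (x * S.p j)
    rw [AlgHom.commutes, ← Algebra.smul_def, smul_mul_assoc])

theorem brickVal_toBrick (j : J) (d : D) : S.brickVal j (S.toBrick j d) = d * S.p j := rfl

theorem brickVal_smul (j : J) (x : Λ) (b : S.brick j) :
    S.brickVal j (x • b) = S.proj x * S.brickVal j b := rfl

theorem smul_toBrick (j : J) (x : Λ) (d : D) :
    x • S.toBrick j d = S.toBrick j (S.proj x * d) :=
  Subtype.ext (mul_assoc (S.proj x) d (S.p j)).symm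

/-- The projection `Λ pⱼ → D pⱼ`. -/
def projBrick (j : J) : leftFix (S.incl (S.p j)) →ₗ[Λ] S.brick j where
  toFun x := (⟨S.proj x, by
    have hx : (x : Λ) * S.incl (S.p j) = x := x.2
    have h := congrArg S.proj hx
    rwa [map_mul, S.proj_incl] at h⟩ : leftFix (S.p j))
  map_add' x y := Subtype.ext (map_add S.proj _ _)
  map_smul' c x := Subtype.ext (map_mul S.proj _ _)

theorem projBrick_surjective (j : J) : Function.Surjective (S.projBrick j) := by
  rintro ⟨d, hd⟩
  have hd' : d * S.p j = d := hd
  exact ⟨⟨S.incl d, show S.incl d * S.incl (S.p j) = S.incl d by rw [← map_mul, hd']⟩,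
    Subtype.ext (S.proj_incl d)⟩

/-- The space `qᵢ D pⱼ`. -/
def link (i j : J) : Submodule k D :=
  LinearMap.range (LinearMap.mulLeft k (S.q i) ∘ₗ LinearMap.mulRight k (S.p j))

/-- The projection `D → qᵢ D pⱼ`. -/
def toLink (i j : J) : D →ₗ[k] S.link i j :=
  (LinearMap.mulLeft k (S.q i) ∘ₗ LinearMap.mulRight k (S.p j)).rangeRestrict

theorem toLink_apply (i j : J) (d : D) : (S.toLink i j d : D) = S.q i * (d * S.p j) := rfl

theorem link_mul_p (i j : J) (d : S.link i j) : (d : D) * S.p j = d := by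
  obtain ⟨_, ⟨d, rfl⟩⟩ := d
  change S.q i * (d * S.p j) * S.p j = S.q i * (d * S.p j)
  rw [mul_assoc, mul_assoc, S.p_mul_p]

/-- The component `ker(Λ pⱼ → D pⱼ) → D pᵢ ⊗ qᵢ D pⱼ`. -/
noncomputable def kerToBrick (i j : J) :
    LinearMap.ker (S.projBrick j) →ₗ[Λ] S.brick i ⊗[k] S.link i j where
  toFun x := TensorProduct.map (S.toBrick i) (S.toLink i j)
    (S.coord i ((x : leftFix (S.incl (S.p j))) : Λ))
  map_add' x y := by
    rw [← map_add, ← map_add]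
    rfl
  map_smul' a x := by
    have hx : S.proj (x : leftFix (S.incl (S.p j))) = 0 := congrArg Subtype.val x.2
    have key (z : D ⊗[k] D) : TensorProduct.map (S.toBrick i) (S.toLink i j)
        (LinearMap.rTensor D (LinearMap.mulLeft k (S.proj a)) z) =
        a • TensorProduct.map (S.toBrick i) (S.toLink i j) z := by
      induction z with
      | zero => simp
      | add a b ha hb => simp only [map_add, ha, hb, smul_add]
      | tmul c d =>
        rw [LinearMap.rTensor_tmul, TensorProduct.map_tmul, TensorProduct.map_tmul,
          LinearMap.mulLeft_apply, ← smul_toBrick, TensorProduct.smul_tmul']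
    change TensorProduct.map _ _ (S.coord i (a * (x : leftFix (S.incl (S.p j))))) = _
    rw [S.coord_mul, hx, LinearMap.mulRight_zero_eq_zero, LinearMap.lTensor_zero,
      LinearMap.zero_apply, add_zero, key]
    rfl

/-- The inclusion `D pᵢ ⊗ qᵢ D pⱼ → ker(Λ pⱼ → D pⱼ)`. -/
noncomputable def brickToKer (i j : J) :
    S.brick i ⊗[k] S.link i j →ₗ[Λ] LinearMap.ker (S.projBrick j) :=
  have hmem (z : S.brick i ⊗[k] S.link i j) :
      S.eval i (TensorProduct.map (S.brickVal i) (S.link i j).subtype z) ∈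
        leftFix (S.incl (S.p j)) := by
    induction z with
    | zero => simp
    | add a b ha hb => rw [map_add, map_add]; exact add_mem ha hb
    | tmul c d =>
      change S.incl _ * S.gen i * S.incl (d : D) * S.incl (S.p j) = _
      rw [mul_assoc, ← map_mul, link_mul_p]
      rfl
  { toFun z := ⟨⟨_, hmem z⟩, LinearMap.mem_ker.2 (Subtype.ext (S.proj_eval _ _))⟩
    map_add' x y := Subtype.ext (Subtype.ext (by
      change S.eval i (TensorProduct.map _ _ _) = S.eval i (TensorProduct.map _ _ _) +
        S.eval i (TensorProduct.map _ _ _)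
      rw [map_add, map_add]))
    map_smul' a z := Subtype.ext (Subtype.ext (by
      change S.eval i (TensorProduct.map (S.brickVal i) (S.link i j).subtype (a • z)) =
        a * S.eval i (TensorProduct.map (S.brickVal i) (S.link i j).subtype z)
      induction z with
      | zero => simp
      | add a b ha hb => simp only [map_add, ha, hb, smul_add, mul_add]
      | tmul c d =>
        rw [TensorProduct.smul_tmul', TensorProduct.map_tmul, TensorProduct.map_tmul,
          brickVal_smul, S.mul_eq_incl_mul a _ (S.proj_eval _ _), eval_tmul, eval_tmul, map_mul]
        simp only [mul_assoc])) }

theorem eval_link (i j : J) (z : D ⊗[k] D) :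
    S.eval i (TensorProduct.map (S.brickVal i) (S.link i j).subtype
      (TensorProduct.map (S.toBrick i) (S.toLink i j) z)) = S.eval i z * S.incl (S.p j) := by
  induction z with
  | zero => simp
  | add a b ha hb => simp only [map_add, ha, hb, add_mul]
  | tmul c d =>
    rw [TensorProduct.map_tmul, TensorProduct.map_tmul, brickVal_toBrick, Submodule.subtype_apply,
      toLink_apply, eval_tmul, eval_tmul]
    simp only [map_mul]
    rw [mul_assoc (S.incl c), S.p_mul_gen, ← mul_assoc _ (S.incl (S.q i)), mul_assoc (S.incl c),
      S.gen_mul_q]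
    simp only [mul_assoc]

theorem sum_brickToKer_kerToBrick (j : J) (x : LinearMap.ker (S.projBrick j)) :
    ∑ i, S.brickToKer i j (S.kerToBrick i j x) = x := by
  refine Subtype.ext (Subtype.ext ?_)
  have hx : S.proj (x : leftFix (S.incl (S.p j))) = 0 := congrArg Subtype.val x.2
  have hx' : (x : leftFix (S.incl (S.p j))) * S.incl (S.p j) = (x : leftFix (S.incl (S.p j))) :=
    (x : leftFix (S.incl (S.p j))).2
  rw [AddSubmonoidClass.coe_finsetSum, AddSubmonoidClass.coe_finsetSum]
  refine Eq.trans (Finset.sum_congr rfl fun i _ =>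
    S.eval_link i j (S.coord i ((x : leftFix (S.incl (S.p j))) : Λ))) ?_
  rw [← Finset.sum_mul]
  have h := S.sum_eval_coord (x : leftFix (S.incl (S.p j)))
  rw [hx, map_zero, zero_add] at h
  rw [h, hx']

/-- If the relation "`qᵢ D pⱼ` is not zero" between `i` and `j` is well founded, then the
`Λ`-modules `D pⱼ` have finite projective dimension: the kernel of the surjection
`Λ pⱼ → D pⱼ` is the direct sum of the modules `D pᵢ ⊗ qᵢ D pⱼ`. -/
theorem exists_hasProjectiveDimensionLT_brick
    (hwf : WellFounded fun i j => ∃ d, S.q i * d * S.p j ≠ 0) (j : J) :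
    ∃ n, HasProjectiveDimensionLT (S.brick j) n := by
  induction j using hwf.induction with
  | _ j ih =>
  have h (i : J) : ∃ n, HasProjectiveDimensionLT
      ((tensorSpace k Λ (S.link i j)).obj (S.brick i)) n := by
    by_cases hij : ∃ d, S.q i * d * S.p j ≠ 0
    · obtain ⟨n, hn⟩ := ih i hij
      exact ⟨_, hasProjectiveDimensionLT_tensorSpace _ n _ hn⟩
    · have : Subsingleton (S.link i j) := by
        push Not at hij
        refine subsingleton_of_forall_eq 0 fun x => ?_
        obtain ⟨_, ⟨d, rfl⟩⟩ := x
        exact Subtype.ext ((mul_assoc _ _ _).symm.trans (hij d))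
      have hs : Subsingleton (S.brick i ⊗[k] S.link i j) := by
        refine subsingleton_of_forall_eq 0 fun z => ?_
        induction z with
        | zero => rfl
        | add a b ha hb => rw [ha, hb, add_zero]
        | tmul c d => rw [Subsingleton.elim d 0, TensorProduct.tmul_zero]
      exact ⟨0, (ModuleCat.isZero_of_iff_subsingleton.2 hs).hasProjectiveDimensionLT_zero⟩
  choose n hn using h
  let N := ∑ i, n i
  have hker : HasProjectiveDimensionLT (ModuleCat.of Λ (LinearMap.ker (S.projBrick j))) N := by
    refine hasProjectiveDimensionLT_of_id_eq_sum
      (T := fun i => (tensorSpace k Λ (S.link i j)).obj (S.brick i))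
      (fun i => ModuleCat.ofHom (S.kerToBrick i j)) (fun i => ModuleCat.ofHom (S.brickToKer i j))
      ?_ fun i => ?_
    · ext1
      refine LinearMap.ext fun x => ?_
      rw [ModuleCat.hom_sum, LinearMap.sum_apply]
      exact S.sum_brickToKer_kerToBrick j x
    · have := hn i
      exact hasProjectiveDimensionLT_of_ge _ (n i) _
        (Finset.single_le_sum (f := n) (fun _ _ => Nat.zero_le _) (Finset.mem_univ i))
  have hS := LinearMap.shortExact_shortComplexKer (S.projBrick_surjective j)
  have hP : Projective (ModuleCat.of Λ (leftFix (S.incl (S.p j)))) :=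
    leftFix_projective (by rw [← map_mul, S.p_mul_p])
  have hP' : HasProjectiveDimensionLT (ModuleCat.of Λ (leftFix (S.incl (S.p j)))) (N + 1) :=
    hasProjectiveDimensionLT_of_ge _ 1 _ (by omega)
  exact ⟨N + 1, hS.hasProjectiveDimensionLT_X₃ N hker hP'⟩

end SquareZeroPresentation

end SquareZero

/-! ### Twisted bimodules -/

section Bimodules

open CategoryTheory Abelian

open scoped ModuleCat

variable {k : Type u} [Field k]

/-- An additive map between modules over `A ⊗ B` is linear if it is compatible with the actions of
pure tensors. -/
def linearOfTmul {A B : Type*} [Ring A] [Ring B] [Algebra k A] [Algebra k B] {Y Z : Type*}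
    [AddCommGroup Y] [AddCommGroup Z] [Module (A ⊗[k] B) Y] [Module (A ⊗[k] B) Z] (f : Y →+ Z)
    (hf : ∀ (x : A) (y : B) m, f ((x ⊗ₜ[k] y : A ⊗[k] B) • m) = (x ⊗ₜ[k] y : A ⊗[k] B) • f m) :
    Y →ₗ[A ⊗[k] B] Z :=
  { f with
    map_smul' := fun r m => by
      change f (r • m) = r • f m
      induction r with
      | zero => rw [zero_smul, zero_smul, map_zero]
      | add a b ha hb => rw [add_smul, add_smul, map_add, ha, hb]
      | tmul x y => exact hf x y m }

/-- An element of `R`, as an element of the regular bimodule. -/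
noncomputable def toRegular (k : Type u) [Field k] (R : Type v) [Ring R] [Algebra k R] :
    R ≃+ regularBimodule k R := AddEquiv.refl R

theorem smul_toRegular {R : Type v} [Ring R] [Algebra k R] (x : R) (y : Rᵐᵒᵖ) (r : R) :
    (x ⊗ₜ[k] y : R ⊗[k] Rᵐᵒᵖ) • toRegular k R r = toRegular k R (x * r * y.unop) :=
  (mul_assoc x r y.unop).symm

variable {Λ D : Type v} [Ring Λ] [Ring D] [Algebra k Λ] [Algebra k D]

/-- The algebra `D` with the action `(x ⊗ y) • d = α x * d * β y` of `Λ ⊗ Λᵒᵖ`. -/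
def Twist (_ _ : Λ →ₐ[k] D) : Type v := D

noncomputable instance (α β : Λ →ₐ[k] D) : AddCommGroup (Twist α β) :=
  inferInstanceAs (AddCommGroup D)

noncomputable instance (α β : Λ →ₐ[k] D) : Module (Λ ⊗[k] Λᵐᵒᵖ) (Twist α β) :=
  letI : Module (D ⊗[k] Dᵐᵒᵖ) D := TensorProduct.Algebra.module
  Module.compHom D (Algebra.TensorProduct.map α (AlgHom.op β)).toRingHom

/-- An element of `D`, as an element of the twisted bimodule. -/
def toTwist (α β : Λ →ₐ[k] D) : D ≃+ Twist α β := AddEquiv.refl D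

theorem smul_toTwist (α β : Λ →ₐ[k] D) (x : Λ) (y : Λᵐᵒᵖ) (d : D) :
    (x ⊗ₜ[k] y : Λ ⊗[k] Λᵐᵒᵖ) • toTwist α β d = toTwist α β (α x * d * β y.unop) :=
  (mul_assoc (α x) d (β y.unop)).symm

/-- The regular bimodule is the untwisted one. -/
noncomputable def regularEquivTwist : regularBimodule k Λ ≃ₗ[Λ ⊗[k] Λᵐᵒᵖ]
    Twist (AlgHom.id k Λ) (AlgHom.id k Λ) :=
  { linearOfTmul (k := k) (A := Λ) (B := Λᵐᵒᵖ) (Y := regularBimodule k Λ)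
      ((toRegular k Λ).symm.trans (toTwist (AlgHom.id k Λ) (AlgHom.id k Λ)) :
        regularBimodule k Λ →+ Twist (AlgHom.id k Λ) (AlgHom.id k Λ)) (fun _ _ _ => rfl) with
    invFun := (toTwist (AlgHom.id k Λ) (AlgHom.id k Λ)).symm.trans (toRegular k Λ)
    left_inv := fun _ => rfl
    right_inv := fun _ => rfl }

namespace SquareZeroPresentation

variable {J : Type w} [Fintype J] (S : SquareZeroPresentation k D Λ J)

/-- Left multiplication by `qⱼ`, with values in the right module `qⱼ D`. -/
noncomputable def toRightBrick (j : J) : D →ₗ[k] S.op.brick j :=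
  S.op.toBrick j ∘ₗ (MulOpposite.opLinearEquiv k).toLinearMap

/-- The element of `D` underlying an element of the right module `qⱼ D`. -/
noncomputable def rightBrickVal (j : J) : S.op.brick j →ₗ[k] D :=
  (MulOpposite.opLinearEquiv k).symm.toLinearMap ∘ₗ S.op.brickVal j

theorem rightBrickVal_toRightBrick (j : J) (d : D) :
    S.rightBrickVal j (S.toRightBrick j d) = S.q j * d := rfl

theorem rightBrickVal_smul (j : J) (y : Λᵐᵒᵖ) (b : S.op.brick j) :
    S.rightBrickVal j (y • b) = S.rightBrickVal j b * S.proj y.unop := rfl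

theorem smul_toRightBrick (j : J) (y : Λᵐᵒᵖ) (d : D) :
    y • S.toRightBrick j d = S.toRightBrick j (d * S.proj y.unop) :=
  S.op.smul_toBrick j y (MulOpposite.op d)

/-! ### The kernel of the projection to `D` -/

section Kernel

variable (β : Λ →ₐ[k] Λ) (hβ : ∀ x, S.proj (β x) = S.proj x)

/-- The projection of `Λ`, with right action twisted by `β`, to the bimodule `D`. -/
noncomputable def twistProj : Twist (AlgHom.id k Λ) β →ₗ[Λ ⊗[k] Λᵐᵒᵖ] Twist S.proj S.proj :=
  linearOfTmul ((toTwist S.proj S.proj).toAddMonoidHom.comp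
      ((S.proj : Λ →+ D).comp (toTwist (AlgHom.id k Λ) β).symm.toAddMonoidHom)) fun x y m => by
    obtain ⟨m, rfl⟩ := (toTwist (AlgHom.id k Λ) β).surjective m
    rw [smul_toTwist]
    refine Eq.trans ?_ (smul_toTwist S.proj S.proj x y (S.proj m)).symm
    change S.proj (x * m * β y.unop) = S.proj x * S.proj m * S.proj y.unop
    rw [map_mul, map_mul, hβ]

theorem twistProj_surjective : Function.Surjective (S.twistProj β hβ) := fun d =>
  ⟨toTwist _ _ (S.incl d), S.proj_incl d⟩

/-- The component `ker(Λ → D) → D pⱼ ⊗ qⱼ D`. -/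
noncomputable def kerToBox (j : J) : LinearMap.ker (S.twistProj β hβ) →ₗ[Λ ⊗[k] Λᵐᵒᵖ]
    box k (S.brick j) (S.op.brick j) :=
  linearOfTmul (Y := LinearMap.ker (S.twistProj β hβ))
    { toFun := fun x => toBox _ _ (TensorProduct.map (S.toBrick j) (S.toRightBrick j)
        (S.coord j ((toTwist (AlgHom.id k Λ) β).symm (x : Twist (AlgHom.id k Λ) β))))
      map_zero' := by
        rw [ZeroMemClass.coe_zero, map_zero, map_zero, map_zero, map_zero]
      map_add' := fun x y => by
        rw [← map_add (toBox (k := k) (S.brick j) (S.op.brick j)), ← map_add, ← map_add]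
        rfl } fun a b x => by
    obtain ⟨x, hx⟩ := x
    obtain ⟨x, rfl⟩ := (toTwist (AlgHom.id k Λ) β).surjective x
    have hx' : S.proj x = 0 := hx
    have key (z : D ⊗[k] D) : TensorProduct.map (S.toBrick j) (S.toRightBrick j)
        (LinearMap.lTensor D (LinearMap.mulRight k (S.proj b.unop))
          (LinearMap.rTensor D (LinearMap.mulLeft k (S.proj a)) z)) =
        TensorProduct.map (Algebra.lsmul k k (S.brick j) a) (Algebra.lsmul k k (S.op.brick j) b)
          (TensorProduct.map (S.toBrick j) (S.toRightBrick j) z) := by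
      induction z with
      | zero => simp
      | add a b ha hb => simp only [map_add, ha, hb]
      | tmul c d =>
        simp only [LinearMap.rTensor_tmul, LinearMap.lTensor_tmul, TensorProduct.map_tmul,
          LinearMap.mulLeft_apply, LinearMap.mulRight_apply, Algebra.lsmul_coe, smul_toBrick,
          smul_toRightBrick]
    change toBox _ _ (TensorProduct.map (S.toBrick j) (S.toRightBrick j)
      (S.coord j (a * (x * β b.unop)))) = (a ⊗ₜ[k] b : Λ ⊗[k] Λᵐᵒᵖ) • toBox _ _
        (TensorProduct.map (S.toBrick j) (S.toRightBrick j) (S.coord j x))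
    have hax : S.proj (a * x) = 0 := by rw [map_mul, hx', mul_zero]
    rw [← mul_assoc, smul_toBox, ← key, S.coord_mul, S.coord_mul, hax, hx', hβ,
      LinearMap.mulLeft_zero_eq_zero, LinearMap.rTensor_zero, LinearMap.zero_apply, zero_add,
      LinearMap.mulRight_zero_eq_zero, LinearMap.lTensor_zero, LinearMap.zero_apply, add_zero]

/-- The inclusion `D pⱼ ⊗ qⱼ D → ker(Λ → D)`. -/
noncomputable def boxToKer (j : J) : box k (S.brick j) (S.op.brick j) →ₗ[Λ ⊗[k] Λᵐᵒᵖ]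
    LinearMap.ker (S.twistProj β hβ) :=
  have hadd (x y : S.brick j ⊗[k] S.op.brick j) :
      S.eval j (TensorProduct.map (S.brickVal j) (S.rightBrickVal j) (x + y)) =
        S.eval j (TensorProduct.map (S.brickVal j) (S.rightBrickVal j) x) +
          S.eval j (TensorProduct.map (S.brickVal j) (S.rightBrickVal j) y) := by
    rw [map_add, map_add]
  boxLift (Y := LinearMap.ker (S.twistProj β hβ)) _ _
    (AddMonoidHom.mk' (fun z => ⟨toTwist (AlgHom.id k Λ) β (S.eval j
      (TensorProduct.map (S.brickVal j) (S.rightBrickVal j) z)), S.proj_eval j _⟩)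
      fun x y => Subtype.ext (hadd x y)) fun a b c d => Subtype.ext (by
    change S.eval j (TensorProduct.map (S.brickVal j) (S.rightBrickVal j) ((a • c) ⊗ₜ (b • d))) =
      ((a ⊗ₜ[k] b : Λ ⊗[k] Λᵐᵒᵖ) • toTwist (AlgHom.id k Λ) β
        (S.eval j (TensorProduct.map (S.brickVal j) (S.rightBrickVal j) (c ⊗ₜ d))) : Twist _ _)
    rw [smul_toTwist]
    change _ = a * _ * β b.unop
    rw [mul_assoc, S.mul_eq_mul_incl _ (β b.unop) (S.proj_eval _ _), hβ,
      S.mul_eq_incl_mul a _ (by rw [map_mul, S.proj_eval, zero_mul])]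
    simp only [TensorProduct.map_tmul, eval_tmul, brickVal_smul, rightBrickVal_smul, map_mul,
      mul_assoc])

theorem eval_brick (j : J) (z : D ⊗[k] D) :
    S.eval j (TensorProduct.map (S.brickVal j) (S.rightBrickVal j)
      (TensorProduct.map (S.toBrick j) (S.toRightBrick j) z)) = S.eval j z := by
  induction z with
  | zero => simp
  | add a b ha hb => simp only [map_add, ha, hb]
  | tmul c d =>
    rw [TensorProduct.map_tmul, TensorProduct.map_tmul, brickVal_toBrick,
      rightBrickVal_toRightBrick, eval_tmul, eval_tmul, map_mul, map_mul, mul_assoc (S.incl c),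
      S.p_mul_gen, ← mul_assoc _ (S.incl (S.q j)), mul_assoc (S.incl c), S.gen_mul_q]

theorem sum_boxToKer_kerToBox (x : LinearMap.ker (S.twistProj β hβ)) :
    ∑ j, S.boxToKer β hβ j (S.kerToBox β hβ j x) = x := by
  refine Subtype.ext ?_
  obtain ⟨x, hx⟩ := x
  obtain ⟨x, rfl⟩ := (toTwist (AlgHom.id k Λ) β).surjective x
  have hx' : S.proj x = 0 := hx
  rw [AddSubmonoidClass.coe_finsetSum]
  refine Eq.trans (Finset.sum_congr rfl fun j _ =>
    congrArg (toTwist (AlgHom.id k Λ) β) (S.eval_brick j (S.coord j x))) ?_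
  rw [← map_sum]
  have h := S.sum_eval_coord x
  rw [hx', map_zero, zero_add] at h
  rw [h]

/-- The kernel of the projection to `D` is the direct sum of the bimodules `D pⱼ ⊗ qⱼ D`, whatever
the twist: products of two elements of the ideal are zero, so that the right action on the ideal
only depends on `proj ∘ β`. -/
theorem hasProjectiveDimensionLT_ker {N : ℕ}
    (hN : ∀ j, HasProjectiveDimensionLT (box k (S.brick j) (S.op.brick j)) N) :
    HasProjectiveDimensionLT (ModuleCat.of (Λ ⊗[k] Λᵐᵒᵖ) (LinearMap.ker (S.twistProj β hβ))) N := by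
  refine hasProjectiveDimensionLT_of_id_eq_sum
    (fun j => ModuleCat.ofHom (Y := box k (S.brick j) (S.op.brick j)) (S.kerToBox β hβ j))
    (fun j => ModuleCat.ofHom (X := box k (S.brick j) (S.op.brick j)) (S.boxToKer β hβ j)) ?_ hN
  ext1
  refine LinearMap.ext fun x => ?_
  rw [ModuleCat.hom_sum, LinearMap.sum_apply]
  exact S.sum_boxToKer_kerToBox β hβ x

end Kernel

end SquareZeroPresentation

end Bimodules

/-! ### The bimodule `Λ ⊗_D Λ` -/

section Balanced

open CategoryTheory Abelian

open scoped ModuleCat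

variable {k : Type u} [Field k] {Λ D : Type v} [Ring Λ] [Ring D] [Algebra k Λ] [Algebra k D]
  {J : Type w} [Fintype J]

namespace SquareZeroPresentation

variable (S : SquareZeroPresentation k D Λ J)

/-- The left ideal of `Λ ⊗ Λᵒᵖ` generated by the elements `d ⊗ 1 - 1 ⊗ d` for `d` in `D`. The
quotient by it is the bimodule `Λ ⊗_D Λ`. -/
def balanced : Ideal (Λ ⊗[k] Λᵐᵒᵖ) :=
  Ideal.span (Set.range fun d => S.incl d ⊗ₜ[k] 1 - 1 ⊗ₜ[k] MulOpposite.op (S.incl d))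

/-- The endomorphism of `Λ` with image `D`. -/
noncomputable def retraction : Λ →ₐ[k] Λ := S.incl.comp S.proj

theorem proj_retraction (x : Λ) : S.proj (S.retraction x) = S.proj x := S.proj_incl _

/-- The bimodule `Λ ⊗_D D`: the left module `Λ` with the right action of `Λ` through `D`. -/
abbrev RightTwist : Type v := Twist (AlgHom.id k Λ) S.retraction

/-- The action on `1` of the twisted bimodule, `x ⊗ y ↦ x * incl (proj y)`. -/
noncomputable def actOne : Λ ⊗[k] Λᵐᵒᵖ →ₗ[Λ ⊗[k] Λᵐᵒᵖ] S.RightTwist :=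
  LinearMap.toSpanSingleton _ _ (toTwist _ _ 1)

theorem actOne_tmul (x : Λ) (y : Λᵐᵒᵖ) :
    S.actOne (x ⊗ₜ y) = toTwist _ _ (x * S.incl (S.proj y.unop)) := by
  refine (smul_toTwist (AlgHom.id k Λ) S.retraction x y 1).trans ?_
  rw [mul_one]
  rfl

theorem actOne_generator (d : D) :
    S.actOne (S.incl d ⊗ₜ[k] 1 - 1 ⊗ₜ[k] MulOpposite.op (S.incl d)) = 0 := by
  rw [map_sub, actOne_tmul, actOne_tmul, ← map_sub, MulOpposite.unop_one, map_one, map_one, mul_one,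
    one_mul, MulOpposite.unop_op, S.proj_incl, sub_self, map_zero]

theorem balanced_le_ker_actOne : S.balanced ≤ LinearMap.ker S.actOne := by
  refine Ideal.span_le.2 ?_
  rintro _ ⟨d, rfl⟩
  exact S.actOne_generator d

/-- The projection `Λ ⊗_D Λ → Λ ⊗_D D`. -/
noncomputable def balancedProj : (Λ ⊗[k] Λᵐᵒᵖ) ⧸ S.balanced →ₗ[Λ ⊗[k] Λᵐᵒᵖ] S.RightTwist :=
  S.balanced.liftQ S.actOne S.balanced_le_ker_actOne

theorem balancedProj_mk (r : Λ ⊗[k] Λᵐᵒᵖ) :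
    S.balancedProj (S.balanced.mkQ r) = S.actOne r := rfl

theorem balancedProj_surjective : Function.Surjective S.balancedProj := fun x => by
  refine ⟨S.balanced.mkQ (((toTwist _ _).symm x) ⊗ₜ 1), ?_⟩
  rw [balancedProj_mk, actOne_tmul, MulOpposite.unop_one, map_one, map_one, mul_one,
    AddEquiv.apply_symm_apply]

/-- The projective module `Λ pⱼ`. -/
def cover (j : J) : ModuleCat.{v} Λ := ModuleCat.of Λ (leftFix (S.incl (S.p j)))

/-- The element of `Λ` underlying an element of `Λ pⱼ`. -/
def coverVal (j : J) : S.cover j →ₗ[Λ] Λ := (leftFix (S.incl (S.p j))).subtype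

/-- Right multiplication by `pⱼ`. -/
def toCover (j : J) : Λ →ₗ[Λ] S.cover j :=
  LinearMap.codRestrict (leftFix (S.incl (S.p j)))
    (LinearMap.toSpanSingleton Λ Λ (S.incl (S.p j))) fun x => by
      change x * S.incl (S.p j) * S.incl (S.p j) = x * S.incl (S.p j)
      rw [mul_assoc, ← map_mul, S.p_mul_p]

/-- The map `y ↦ coord j y` with values in `Λ pⱼ ⊗ qⱼ D`. -/
noncomputable def coordCover (j : J) : Λᵐᵒᵖ →ₗ[k] S.cover j ⊗[k] S.op.brick j :=
  TensorProduct.map ((S.toCover j).restrictScalars k ∘ₗ S.incl.toLinearMap) (S.toRightBrick j) ∘ₗ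
    S.coord j ∘ₗ (MulOpposite.opLinearEquiv k).symm.toLinearMap

theorem coordCover_apply (j : J) (y : Λᵐᵒᵖ) : S.coordCover j y =
    TensorProduct.map ((S.toCover j).restrictScalars k ∘ₗ S.incl.toLinearMap) (S.toRightBrick j)
      (S.coord j y.unop) := rfl

theorem coordCover_incl (j : J) (d : D) : S.coordCover j (MulOpposite.op (S.incl d)) = 0 := by
  rw [coordCover_apply, MulOpposite.unop_op, S.coord_incl, map_zero]

theorem coordCover_mul (j : J) (b y : Λᵐᵒᵖ) : S.coordCover j (b * y) =
    S.incl (S.proj y.unop) • S.coordCover j b +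
      LinearMap.lTensor (S.cover j) (Algebra.lsmul k k (S.op.brick j) b) (S.coordCover j y) := by
  rw [coordCover_apply, MulOpposite.unop_mul, S.coord_mul, map_add, coordCover_apply,
    coordCover_apply]
  congr 1
  · induction S.coord j b.unop with
    | zero => simp
    | add a b ha hb => simp only [map_add, ha, hb, smul_add]
    | tmul c d =>
      rw [LinearMap.rTensor_tmul, TensorProduct.map_tmul, TensorProduct.map_tmul,
        TensorProduct.smul_tmul']
      congr 1
      change S.toCover j (S.incl (S.proj y.unop * c)) = S.incl (S.proj y.unop) •
        S.toCover j (S.incl c)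
      rw [← map_smul, map_mul, smul_eq_mul]
  · induction S.coord j y.unop with
    | zero => simp
    | add a b ha hb => simp only [map_add, ha, hb]
    | tmul c d =>
      rw [LinearMap.lTensor_tmul, TensorProduct.map_tmul, TensorProduct.map_tmul,
        LinearMap.lTensor_tmul, LinearMap.mulRight_apply]
      exact congrArg _ (S.smul_toRightBrick j b d).symm

/-- The map `x ⊗ y ↦ x • coord j y` with values in `Λ pⱼ ⊗ qⱼ D`. -/
noncomputable def tensorCover (j : J) : Λ ⊗[k] Λᵐᵒᵖ →ₗ[k] S.cover j ⊗[k] S.op.brick j :=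
  TensorProduct.lift (LinearMap.mk₂ k (fun x y => x • S.coordCover j y)
    (fun x x' y => add_smul x x' _) (fun c x y => smul_assoc c x _)
    (fun x y y' => by rw [map_add, smul_add])
    (fun c x y => by rw [map_smul, smul_algebra_smul_comm]))

theorem tensorCover_tmul (j : J) (x : Λ) (y : Λᵐᵒᵖ) :
    S.tensorCover j (x ⊗ₜ y) = x • S.coordCover j y := rfl

/-- The failure of `tensorCover` to be linear is governed by the projection to the twisted
bimodule. -/
theorem tensorCover_mul (j : J) (a : Λ) (b : Λᵐᵒᵖ) (r : Λ ⊗[k] Λᵐᵒᵖ) :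
    S.tensorCover j ((a ⊗ₜ b) * r) =
      (a * (toTwist _ _).symm (S.actOne r)) • S.coordCover j b +
        TensorProduct.map (Algebra.lsmul k k (S.cover j) a) (Algebra.lsmul k k (S.op.brick j) b)
          (S.tensorCover j r) := by
  have h (x : Λ) (z : S.cover j ⊗[k] S.op.brick j) :
      (a * x) • LinearMap.lTensor (S.cover j) (Algebra.lsmul k k (S.op.brick j) b) z =
      TensorProduct.map (Algebra.lsmul k k (S.cover j) a) (Algebra.lsmul k k (S.op.brick j) b)
        (x • z) := by
    induction z with
    | zero => simp
    | add c d hc hd => simp only [map_add, smul_add, hc, hd]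
    | tmul c d =>
      rw [LinearMap.lTensor_tmul, TensorProduct.smul_tmul', TensorProduct.smul_tmul',
        TensorProduct.map_tmul, mul_smul]
      rfl
  induction r with
  | zero => simp
  | add c d hc hd =>
    rw [mul_add, map_add, hc, hd, map_add, map_add, map_add, map_add, mul_add, add_smul]
    abel
  | tmul x y =>
    rw [Algebra.TensorProduct.tmul_mul_tmul, tensorCover_tmul, coordCover_mul, smul_add, smul_smul,
      actOne_tmul, AddEquiv.symm_apply_apply, tensorCover_tmul, h, mul_assoc]

/-- The map `tensorCover` is only linear on the kernel of `actOne`, so the two maps are shown to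
vanish on the left ideal at the same time. -/
theorem tensorCover_balanced (j : J) (r : Λ ⊗[k] Λᵐᵒᵖ) (hr : r ∈ S.balanced) :
    S.tensorCover j r = 0 := by
  refine And.right (a := S.actOne r = 0) ?_
  induction hr using Submodule.span_induction with
  | mem r hr =>
    obtain ⟨d, rfl⟩ := hr
    refine ⟨S.actOne_generator d, ?_⟩
    have h1 : S.coordCover j 1 = 0 := by
      rw [← MulOpposite.op_one, ← map_one S.incl, coordCover_incl]
    rw [map_sub, tensorCover_tmul, tensorCover_tmul, coordCover_incl, h1, smul_zero, smul_zero,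
      sub_self]
  | zero => simp
  | add r s _ _ hr hs => rw [map_add, map_add, hr.1, hr.2, hs.1, hs.2, add_zero, add_zero]; simp
  | smul a r _ hr =>
    refine ⟨by rw [map_smul, hr.1, smul_zero], ?_⟩
    rw [smul_eq_mul]
    induction a with
    | zero => simp
    | add a b ha hb => rw [add_mul, map_add, ha, hb, add_zero]
    | tmul a b => rw [tensorCover_mul, hr.1, hr.2]; simp

/-- The map induced by `tensorCover` on `Λ ⊗_D Λ`. -/
noncomputable def balancedCover (j : J) :
    (Λ ⊗[k] Λᵐᵒᵖ) ⧸ S.balanced →ₗ[k] S.cover j ⊗[k] S.op.brick j :=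
  (S.balanced.restrictScalars k).liftQ (S.tensorCover j) (S.tensorCover_balanced j) ∘ₗ
    (Submodule.Quotient.restrictScalarsEquiv k S.balanced).symm.toLinearMap

/-- The component `ker(Λ ⊗_D Λ → Λ ⊗_D D) → Λ pⱼ ⊗ qⱼ D`. -/
noncomputable def balancedKerToBox (j : J) : LinearMap.ker S.balancedProj →ₗ[Λ ⊗[k] Λᵐᵒᵖ]
    box k (S.cover j) (S.op.brick j) :=
  linearOfTmul (Y := LinearMap.ker S.balancedProj)
    ((toBox (S.cover j) (S.op.brick j)).toAddMonoidHom.comp ((S.balancedCover j : _ →+ _).comp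
      (LinearMap.ker S.balancedProj).subtype.toAddMonoidHom)) fun a b x => by
    obtain ⟨x, hx⟩ := x
    obtain ⟨r, rfl⟩ := S.balanced.mkQ_surjective x
    have hr : S.actOne r = 0 := hx
    change toBox _ _ (S.tensorCover j ((a ⊗ₜ b) * r)) = (a ⊗ₜ[k] b : Λ ⊗[k] Λᵐᵒᵖ) •
      toBox _ _ (S.tensorCover j r)
    rw [tensorCover_mul, hr, smul_toBox, map_zero, mul_zero, zero_smul, zero_add]

/-- The map `x ⊗ d ↦ x ⊗ gen j * d` from `Λ pⱼ ⊗ qⱼ D` to `Λ ⊗_D Λ`. -/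
noncomputable def coverEval (j : J) : S.cover j ⊗[k] S.op.brick j →ₗ[k] Λ ⊗[k] Λᵐᵒᵖ :=
  TensorProduct.map ((S.coverVal j).restrictScalars k)
    ((MulOpposite.opLinearEquiv k).toLinearMap ∘ₗ LinearMap.mulLeft k (S.gen j) ∘ₗ
      S.incl.toLinearMap ∘ₗ S.rightBrickVal j)

theorem coverEval_tmul (j : J) (x : S.cover j) (b : S.op.brick j) : S.coverEval j (x ⊗ₜ b) =
    S.coverVal j x ⊗ₜ MulOpposite.op (S.gen j * S.incl (S.rightBrickVal j b)) := rfl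

theorem actOne_coverEval (j : J) (z : S.cover j ⊗[k] S.op.brick j) :
    S.actOne (S.coverEval j z) = 0 := by
  induction z with
  | zero => simp
  | add a b ha hb => rw [map_add, map_add, ha, hb, add_zero]
  | tmul x b =>
    rw [coverEval_tmul, actOne_tmul, MulOpposite.unop_op, map_mul S.proj, S.proj_gen, zero_mul,
      map_zero S.incl, mul_zero, map_zero]

/-- The inclusion `Λ pⱼ ⊗ qⱼ D → ker(Λ ⊗_D Λ → Λ ⊗_D D)`. -/
noncomputable def boxToBalancedKer (j : J) : box k (S.cover j) (S.op.brick j) →ₗ[Λ ⊗[k] Λᵐᵒᵖ]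
    LinearMap.ker S.balancedProj :=
  boxLift (Y := LinearMap.ker S.balancedProj) _ _
    (AddMonoidHom.mk' (fun z => ⟨S.balanced.mkQ (S.coverEval j z), S.actOne_coverEval j z⟩)
      fun x y => Subtype.ext ((congrArg S.balanced.mkQ (map_add (S.coverEval j) x y)).trans
        (map_add S.balanced.mkQ _ _))) fun a b x y => Subtype.ext (by
    change S.balanced.mkQ (S.coverEval j ((a • x) ⊗ₜ (b • y))) =
      S.balanced.mkQ ((a ⊗ₜ[k] b) * S.coverEval j (x ⊗ₜ y))
    rw [coverEval_tmul, coverEval_tmul, Algebra.TensorProduct.tmul_mul_tmul, rightBrickVal_smul,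
      map_smul, smul_eq_mul]
    congr 2
    refine MulOpposite.unop_injective ?_
    rw [MulOpposite.unop_mul, MulOpposite.unop_op, MulOpposite.unop_op, map_mul, ← mul_assoc]
    exact (S.mul_eq_mul_incl _ b.unop (by rw [map_mul, S.proj_gen, zero_mul])).symm)

/-- Elements of `D` move through the tensor sign in `Λ ⊗_D Λ`. -/
theorem mk_mul_incl (x z : Λ) (d : D) :
    S.balanced.mkQ ((x * S.incl d) ⊗ₜ MulOpposite.op z) =
      S.balanced.mkQ (x ⊗ₜ MulOpposite.op (S.incl d * z)) := by
  rw [← sub_eq_zero, ← map_sub, Submodule.mkQ_apply, Submodule.Quotient.mk_eq_zero]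
  have h := S.balanced.mul_mem_left (x ⊗ₜ[k] MulOpposite.op z)
    (Ideal.subset_span (Set.mem_range_self d))
  rwa [mul_sub, Algebra.TensorProduct.tmul_mul_tmul, Algebra.TensorProduct.tmul_mul_tmul, mul_one,
    mul_one, ← MulOpposite.op_mul] at h

theorem mk_coverEval (j : J) (x : Λ) (z : D ⊗[k] D) :
    S.balanced.mkQ (S.coverEval j (x • TensorProduct.map ((S.toCover j).restrictScalars k ∘ₗ
      S.incl.toLinearMap) (S.toRightBrick j) z)) =
      S.balanced.mkQ (x ⊗ₜ MulOpposite.op (S.eval j z)) := by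
  induction z with
  | zero => simp
  | add a b ha hb =>
    rw [map_add, smul_add, map_add, map_add, ha, hb, map_add, MulOpposite.op_add,
      TensorProduct.tmul_add, map_add]
  | tmul c d =>
    rw [TensorProduct.map_tmul, TensorProduct.smul_tmul', coverEval_tmul, map_smul,
      rightBrickVal_toRightBrick, eval_tmul]
    change S.balanced.mkQ ((x * (S.incl c * S.incl (S.p j))) ⊗ₜ _) = _
    rw [← map_mul S.incl, mk_mul_incl, map_mul, map_mul, ← mul_assoc (S.gen j), S.gen_mul_q,
      mul_assoc (S.incl c), ← mul_assoc (S.incl (S.p j)), S.p_mul_gen, mul_assoc]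

theorem sum_coverEval_tensorCover (r : Λ ⊗[k] Λᵐᵒᵖ) :
    ∑ j, S.balanced.mkQ (S.coverEval j (S.tensorCover j r)) =
      S.balanced.mkQ r - S.balanced.mkQ ((toTwist _ _).symm (S.actOne r) ⊗ₜ 1) := by
  induction r with
  | zero => simp
  | add a b ha hb =>
    simp only [map_add, Finset.sum_add_distrib, ha, hb, TensorProduct.add_tmul]
    abel
  | tmul x y =>
    rw [actOne_tmul, AddEquiv.symm_apply_apply, ← MulOpposite.op_one, mk_mul_incl, mul_one,
      ← map_sub, ← TensorProduct.tmul_sub]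
    refine (Finset.sum_congr rfl fun j _ => S.mk_coverEval j x _).trans ?_
    rw [← map_sum, ← TensorProduct.tmul_sum, ← Finset.op_sum]
    congr 2
    refine MulOpposite.unop_injective ?_
    exact eq_sub_of_add_eq' (S.sum_eval_coord y.unop)

theorem sum_boxToBalancedKer_balancedKerToBox (x : LinearMap.ker S.balancedProj) :
    ∑ j, S.boxToBalancedKer j (S.balancedKerToBox j x) = x := by
  refine Subtype.ext ?_
  obtain ⟨x, hx⟩ := x
  obtain ⟨r, rfl⟩ := S.balanced.mkQ_surjective x
  have hr : S.actOne r = 0 := hx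
  rw [AddSubmonoidClass.coe_finsetSum]
  refine (S.sum_coverEval_tensorCover r).trans ?_
  rw [hr, map_zero, TensorProduct.zero_tmul, map_zero, sub_zero]

theorem hasProjectiveDimensionLT_ker_balancedProj {N : ℕ}
    (hN : ∀ j, HasProjectiveDimensionLT (box k (S.cover j) (S.op.brick j)) N) :
    HasProjectiveDimensionLT (ModuleCat.of (Λ ⊗[k] Λᵐᵒᵖ) (LinearMap.ker S.balancedProj)) N := by
  refine hasProjectiveDimensionLT_of_id_eq_sum
    (fun j => ModuleCat.ofHom (Y := box k (S.cover j) (S.op.brick j)) (S.balancedKerToBox j))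
    (fun j => ModuleCat.ofHom (X := box k (S.cover j) (S.op.brick j)) (S.boxToBalancedKer j)) ?_ hN
  ext1
  refine LinearMap.ext fun x => ?_
  rw [ModuleCat.hom_sum, LinearMap.sum_apply]
  exact S.sum_boxToBalancedKer_balancedKerToBox x

/-- If the left modules `D pⱼ` and the right modules `qⱼ D` have finite projective dimension, then
`Λ` and `Λ ⊗_D Λ` have the same `Ext` in large degrees, because in the chain of surjections
`Λ → D ← Λ ⊗_D D ← Λ ⊗_D Λ` all kernels have finite projective dimension. -/
theorem exists_ext_regularBimodule_equiv
    (hl : ∀ j, ∃ n, HasProjectiveDimensionLT (S.brick j) n)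
    (hr : ∀ j, ∃ n, HasProjectiveDimensionLT (S.op.brick j) n) :
    ∃ h : ℕ, ∀ n, h ≤ n → ∀ Y : ModuleCat.{v} (Λ ⊗[k] Λᵐᵒᵖ),
      Nonempty (Ext.{v} (regularBimodule k Λ) Y n ≃ₗ[k]
        Ext.{v} (ModuleCat.of (Λ ⊗[k] Λᵐᵒᵖ) ((Λ ⊗[k] Λᵐᵒᵖ) ⧸ S.balanced)) Y n) := by
  choose m hm using hl
  choose n hn using hr
  let N := ∑ j, (m j + (1 + (n j + 1)))
  have hle (j : J) : m j + (1 + (n j + 1)) ≤ N :=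
    Finset.single_le_sum (f := fun j => m j + (1 + (n j + 1))) (fun _ _ => Nat.zero_le _)
      (Finset.mem_univ j)
  have h₁ (j : J) : HasProjectiveDimensionLT (box k (S.brick j) (S.op.brick j)) N := by
    have := hasProjectiveDimensionLT_box (k := k) _ _ (hm j) (hn j)
    exact hasProjectiveDimensionLT_of_ge _ (m j + (n j + 1)) _ (le_trans (by omega) (hle j))
  have h₂ (j : J) : HasProjectiveDimensionLT (box k (S.cover j) (S.op.brick j)) N := by
    have hP : Projective (S.cover j) := leftFix_projective (by rw [← map_mul, S.p_mul_p])
    have := hasProjectiveDimensionLT_box (k := k) _ _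
      (projective_iff_hasProjectiveDimensionLT_one.1 hP) (hn j)
    exact hasProjectiveDimensionLT_of_ge _ (1 + (n j + 1)) _ (le_trans (by omega) (hle j))
  have hid (x : Λ) : S.proj (AlgHom.id k Λ x) = S.proj x := rfl
  refine ⟨N + 1, fun i hi Y => ?_⟩
  obtain ⟨e₁⟩ := nonempty_ext_linearEquiv_of_shortExact (k := k)
    (LinearMap.shortExact_shortComplexKer (S.twistProj_surjective (AlgHom.id k Λ) hid))
    (S.hasProjectiveDimensionLT_ker _ hid h₁) Y hi
  obtain ⟨e₂⟩ := nonempty_ext_linearEquiv_of_shortExact (k := k)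
    (LinearMap.shortExact_shortComplexKer (S.twistProj_surjective S.retraction S.proj_retraction))
    (S.hasProjectiveDimensionLT_ker _ S.proj_retraction h₁) Y hi
  obtain ⟨e₃⟩ := nonempty_ext_linearEquiv_of_shortExact (k := k)
    (LinearMap.shortExact_shortComplexKer S.balancedProj_surjective)
    (S.hasProjectiveDimensionLT_ker_balancedProj h₂) Y hi
  exact ⟨(extCongr k (regularEquivTwist (k := k) (Λ := Λ)).toModuleIso (Iso.refl Y) i) ≪≫ₗ e₁.symm
    ≪≫ₗ e₂ ≪≫ₗ e₃⟩

end SquareZeroPresentation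

end Balanced

/-! ### Reduction to the direct factors of `D` -/

section Blocks

open CategoryTheory Abelian

open scoped ModuleCat

variable {k : Type u} [Field k] {Λ D : Type v} [Ring Λ] [Ring D] [Algebra k Λ] [Algebra k D]
  {J : Type w} [Fintype J]

/-- If a ring morphism `ρ : R → T` is a retraction of the non-unital morphism `ι`, then every
`T`-module is the corner of an `R`-module. -/
noncomputable def cornerRestrictScalarsIso {R T : Type v} [Ring R] [Ring T] (ι : T →ₙ+* R)
    (ρ : R →+* T) (h : ∀ t, ρ (ι t) = t) (V : ModuleCat.{v} T) :
    (cornerFunctor ι).obj ((ModuleCat.restrictScalars ρ).obj V) ≅ V :=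
  let Y := (ModuleCat.restrictScalars ρ).obj V
  have hY (r : R) (y : Y) : (r • y : Y) = (ρ r • (y : V) : V) := rfl
  LinearEquiv.toModuleIso (X₁ := Corner ι Y) (X₂ := V)
  { toFun := fun y => Corner.val (Y := Y) y
    map_add' := fun _ _ => rfl
    map_smul' := fun t y => by
      rw [Corner.val_smul, hY, h]
      rfl
    invFun := fun y => Corner.mk (Y := Y) y <|
      (hY _ _).trans ((congrArg (· • y) (h 1)).trans (one_smul T y))
    left_inv := fun _ => rfl
    right_inv := fun _ => rfl }

/-- The morphism of bimodules which maps `1` to a central element `z`. -/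
noncomputable def regularLift {C : Type v} [Ring C] [Algebra k C] {Z : Type*} [AddCommGroup Z]
    [Module (C ⊗[k] Cᵐᵒᵖ) Z] (z : Z) (hz : ∀ c : C, (c ⊗ₜ[k] 1 : C ⊗[k] Cᵐᵒᵖ) • z =
      (1 ⊗ₜ[k] MulOpposite.op c : C ⊗[k] Cᵐᵒᵖ) • z) :
    regularBimodule k C →ₗ[C ⊗[k] Cᵐᵒᵖ] Z :=
  linearOfTmul (k := k) (A := C) (B := Cᵐᵒᵖ) (Y := regularBimodule k C)
    ((AddMonoidHom.mk' (fun c : C => (c ⊗ₜ[k] 1 : C ⊗[k] Cᵐᵒᵖ) • z) fun x y => by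
      rw [TensorProduct.add_tmul, add_smul]).comp
      ((toRegular k C).symm : regularBimodule k C →+ C)) fun x y c => by
    obtain ⟨c, rfl⟩ := (toRegular k C).surjective c
    rw [smul_toRegular]
    change ((x * c * y.unop) ⊗ₜ[k] 1 : C ⊗[k] Cᵐᵒᵖ) • z =
      (x ⊗ₜ[k] y : C ⊗[k] Cᵐᵒᵖ) • (c ⊗ₜ[k] 1 : C ⊗[k] Cᵐᵒᵖ) • z
    have h₁ : ((x * c * y.unop) ⊗ₜ[k] 1 : C ⊗[k] Cᵐᵒᵖ) =
        ((x * c) ⊗ₜ[k] 1) * (y.unop ⊗ₜ[k] 1) := by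
      rw [Algebra.TensorProduct.tmul_mul_tmul, one_mul]
    rw [h₁, mul_smul, hz, smul_smul, smul_smul, Algebra.TensorProduct.tmul_mul_tmul,
      Algebra.TensorProduct.tmul_mul_tmul, one_mul, mul_one, mul_one, MulOpposite.op_unop]

/-- The value at `1` of a morphism of bimodules determines the morphism, and is central. -/
theorem regularBimodule_hom_apply {C : Type v} [Ring C] [Algebra k C]
    {Z : ModuleCat.{v} (C ⊗[k] Cᵐᵒᵖ)} (g : regularBimodule k C ⟶ Z) (x : C) (y : Cᵐᵒᵖ) :
    (x ⊗ₜ[k] y : C ⊗[k] Cᵐᵒᵖ) • g.hom (toRegular k C 1) = g.hom (toRegular k C (x * y.unop)) := by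
  rw [← map_smul, smul_toRegular, mul_one]

namespace SquareZeroPresentation

variable (S : SquareZeroPresentation k D Λ J)

section OneBlock

variable {C : Type v} [Ring C] [Algebra k C] (ν : C →ₙₐ[k] D)

/-- The embedding of enveloping algebras induced by the embedding in `Λ` of a direct factor
of `D`. -/
noncomputable def envelopeIncl : C ⊗[k] Cᵐᵒᵖ →ₙₐ[k] Λ ⊗[k] Λᵐᵒᵖ :=
  nonUnitalTensorMap (S.blockIncl ν) (S.op.blockIncl (nonUnitalOp ν))

theorem envelopeIncl_tmul (x : C) (y : Cᵐᵒᵖ) : S.envelopeIncl ν (x ⊗ₜ y) =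
    S.incl (ν x) ⊗ₜ MulOpposite.op (S.incl (ν y.unop)) := rfl

theorem envelopeIncl_one : S.envelopeIncl ν 1 =
    S.incl (ν 1) ⊗ₜ MulOpposite.op (S.incl (ν 1)) := rfl

theorem map_mul_one_self (x : C) : S.incl (ν x) * S.incl (ν 1) = S.incl (ν x) := by
  rw [← map_mul, ← map_mul, mul_one]

theorem map_one_mul_self (x : C) : S.incl (ν 1) * S.incl (ν x) = S.incl (ν x) := by
  rw [← map_mul, ← map_mul, one_mul]

/-- The corner `ν(1) Y ν(1)` of a bimodule `Y`. -/
noncomputable abbrev bimoduleCorner : ModuleCat.{v} (Λ ⊗[k] Λᵐᵒᵖ) ⥤ ModuleCat.{v} (C ⊗[k] Cᵐᵒᵖ) :=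
  cornerFunctor (S.envelopeIncl ν : C ⊗[k] Cᵐᵒᵖ →ₙ+* Λ ⊗[k] Λᵐᵒᵖ)

theorem bimoduleCorner_injective {τ : D →ₐ[k] C} {ν : C →ₙₐ[k] D} (h : IsBlock τ ν)
    (I : ModuleCat.{v} (Λ ⊗[k] Λᵐᵒᵖ)) (hI : Injective I) :
    Injective ((S.bimoduleCorner ν).obj I) :=
  cornerFunctor_injective ((S.isCornerSection h).tensor (S.op.isCornerSection h.op)) I hI

/-- The bimodule `Λ ⊗_D Λ`. -/
noncomputable abbrev balancedTensor : ModuleCat.{v} (Λ ⊗[k] Λᵐᵒᵖ) :=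
  ModuleCat.of (Λ ⊗[k] Λᵐᵒᵖ) ((Λ ⊗[k] Λᵐᵒᵖ) ⧸ S.balanced)

/-- The element `ν 1 ⊗ ν 1` of the corner of `Λ ⊗_D Λ`. -/
noncomputable def cornerGenerator : Corner (S.envelopeIncl ν : C ⊗[k] Cᵐᵒᵖ →ₙ+* Λ ⊗[k] Λᵐᵒᵖ)
    S.balancedTensor :=
  Corner.mk (S.balanced.mkQ (S.envelopeIncl ν 1)) (by
    change S.balanced.mkQ (S.envelopeIncl ν 1 * S.envelopeIncl ν 1) = _
    rw [← map_mul, one_mul])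

theorem val_smul_cornerGenerator (r : C ⊗[k] Cᵐᵒᵖ) :
    Corner.val (r • S.cornerGenerator ν) = S.balanced.mkQ (S.envelopeIncl ν r) := by
  change S.balanced.mkQ (S.envelopeIncl ν r * S.envelopeIncl ν 1) = _
  rw [← map_mul, mul_one]

/-- The morphism `c ↦ ν c ⊗ ν 1` from `C` to the corner of `Λ ⊗_D Λ`. -/
noncomputable def cornerUnit :
    regularBimodule k C ⟶ (S.bimoduleCorner ν).obj S.balancedTensor :=
  ModuleCat.ofHom (X := regularBimodule k C) (regularLift (S.cornerGenerator ν) fun c =>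
    Corner.ext (by
      rw [val_smul_cornerGenerator, val_smul_cornerGenerator, envelopeIncl_tmul, envelopeIncl_tmul,
        MulOpposite.unop_one, MulOpposite.unop_op, ← S.map_one_mul_self ν c, mk_mul_incl,
        S.map_one_mul_self ν c, S.map_mul_one_self ν c]))

theorem cornerUnit_val (c : C) : Corner.val ((S.cornerUnit ν).hom (toRegular k C c)) =
    S.balanced.mkQ (S.envelopeIncl ν (c ⊗ₜ 1)) :=
  S.val_smul_cornerGenerator ν _

/-- The map from `Hom(Λ ⊗_D Λ, Y)` to `Hom(C, ν(1) Y ν(1))`. -/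
noncomputable def homToCorner (Y : ModuleCat.{v} (Λ ⊗[k] Λᵐᵒᵖ)) :
    (S.balancedTensor ⟶ Y) →ₗ[k] (regularBimodule k C ⟶ (S.bimoduleCorner ν).obj Y) where
  toFun f := S.cornerUnit ν ≫ (S.bimoduleCorner ν).map f
  map_add' f g := by rw [Functor.map_add, Preadditive.comp_add]
  map_smul' c f := by
    ext x
    refine Corner.ext ?_
    change algebraMap k (Λ ⊗[k] Λᵐᵒᵖ) c • f.hom (Corner.val ((S.cornerUnit ν).hom x)) =
      S.envelopeIncl ν (algebraMap k (C ⊗[k] Cᵐᵒᵖ) c) •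
        f.hom (Corner.val ((S.cornerUnit ν).hom x))
    rw [Algebra.algebraMap_eq_smul_one, Algebra.algebraMap_eq_smul_one, map_smul, smul_assoc,
      smul_assoc, one_smul]
    congr 1
    exact (Corner.one_smul_val ((S.cornerUnit ν ≫ (S.bimoduleCorner ν).map f).hom x)).symm

theorem homToCorner_val (Y : ModuleCat.{v} (Λ ⊗[k] Λᵐᵒᵖ)) (f : S.balancedTensor ⟶ Y) (c : C) :
    Corner.val ((S.homToCorner ν Y f).hom (toRegular k C c)) =
      f.hom (S.balanced.mkQ (S.envelopeIncl ν (c ⊗ₜ 1))) :=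
  congrArg f.hom (S.cornerUnit_val ν c)

theorem homToCorner_comp {Y Z : ModuleCat.{v} (Λ ⊗[k] Λᵐᵒᵖ)} (f : Y ⟶ Z)
    (g : S.balancedTensor ⟶ Y) :
    S.homToCorner ν Z (g ≫ f) = S.homToCorner ν Y g ≫ (S.bimoduleCorner ν).map f := by
  change S.cornerUnit ν ≫ _ = (S.cornerUnit ν ≫ _) ≫ _
  rw [Functor.map_comp, Category.assoc]

/-- The value at `1` of a morphism from `C` to a corner of `Y`. -/
noncomputable def cornerValue {Y : ModuleCat.{v} (Λ ⊗[k] Λᵐᵒᵖ)}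
    (g : regularBimodule k C ⟶ (S.bimoduleCorner ν).obj Y) : Y :=
  Corner.val (g.hom (toRegular k C 1))

theorem smul_cornerValue {Y : ModuleCat.{v} (Λ ⊗[k] Λᵐᵒᵖ)}
    (g : regularBimodule k C ⟶ (S.bimoduleCorner ν).obj Y) (x : C) (y : Cᵐᵒᵖ) :
    (S.incl (ν x) ⊗ₜ[k] MulOpposite.op (S.incl (ν y.unop)) : Λ ⊗[k] Λᵐᵒᵖ) • S.cornerValue ν g =
      Corner.val (g.hom (toRegular k C (x * y.unop))) := by
  exact congrArg Corner.val (regularBimodule_hom_apply g x y)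

theorem one_smul_cornerValue {Y : ModuleCat.{v} (Λ ⊗[k] Λᵐᵒᵖ)}
    (g : regularBimodule k C ⟶ (S.bimoduleCorner ν).obj Y) :
    (S.incl (ν 1) ⊗ₜ[k] MulOpposite.op (S.incl (ν 1)) : Λ ⊗[k] Λᵐᵒᵖ) • S.cornerValue ν g =
      S.cornerValue ν g :=
  Corner.one_smul_val (g.hom (toRegular k C 1))

/-- The element `cornerValue` is centralized by `D`. -/
theorem central_cornerValue {τ : D →ₐ[k] C} {ν : C →ₙₐ[k] D} (h : IsBlock τ ν)
    {Y : ModuleCat.{v} (Λ ⊗[k] Λᵐᵒᵖ)}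
    (g : regularBimodule k C ⟶ (S.bimoduleCorner ν).obj Y) (d : D) :
    (S.incl d ⊗ₜ[k] 1 - 1 ⊗ₜ[k] MulOpposite.op (S.incl d) : Λ ⊗[k] Λᵐᵒᵖ) •
      S.cornerValue ν g = 0 := by
  rw [sub_smul, ← S.one_smul_cornerValue ν g, smul_smul, smul_smul,
    Algebra.TensorProduct.tmul_mul_tmul, Algebra.TensorProduct.tmul_mul_tmul, one_mul, one_mul,
    ← map_mul, ← MulOpposite.op_mul, ← map_mul, ← h.mul_one, ← h.one_mul, sub_eq_zero]
  have h₁ := S.smul_cornerValue ν g (τ d) 1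
  have h₂ := S.smul_cornerValue ν g 1 (MulOpposite.op (τ d))
  rw [MulOpposite.unop_one, mul_one] at h₁
  rw [MulOpposite.unop_op, one_mul] at h₂
  rw [h₁, h₂]

/-- The unit of the corner of `Λ`. -/
noncomputable def regularCornerGenerator :
    Corner (S.envelopeIncl ν : C ⊗[k] Cᵐᵒᵖ →ₙ+* Λ ⊗[k] Λᵐᵒᵖ) (regularBimodule k Λ) :=
  Corner.mk (toRegular k Λ (S.incl (ν 1))) (by
    change S.envelopeIncl ν 1 • _ = _
    rw [envelopeIncl_one, smul_toRegular, MulOpposite.unop_op, map_one_mul_self, map_one_mul_self])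

theorem val_smul_regularCornerGenerator (x : C) (y : Cᵐᵒᵖ) :
    Corner.val ((x ⊗ₜ[k] y : C ⊗[k] Cᵐᵒᵖ) • S.regularCornerGenerator ν) =
      toRegular k Λ (S.incl (ν (x * y.unop))) := by
  change S.envelopeIncl ν (x ⊗ₜ y) • toRegular k Λ (S.incl (ν 1)) = _
  rw [envelopeIncl_tmul, smul_toRegular, MulOpposite.unop_op, map_mul_one_self, ← map_mul,
    ← map_mul]

/-- The morphism from `C` to the corner of `Λ`. -/
noncomputable def regularToCorner : regularBimodule k C →ₗ[C ⊗[k] Cᵐᵒᵖ]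
    Corner (S.envelopeIncl ν : C ⊗[k] Cᵐᵒᵖ →ₙ+* Λ ⊗[k] Λᵐᵒᵖ) (regularBimodule k Λ) :=
  regularLift (S.regularCornerGenerator ν) fun c => Corner.ext (by
    rw [val_smul_regularCornerGenerator, val_smul_regularCornerGenerator, MulOpposite.unop_op,
      MulOpposite.unop_one, one_mul, mul_one])

theorem regularToCorner_val (c : C) :
    Corner.val (S.regularToCorner ν (toRegular k C c)) = toRegular k Λ (S.incl (ν c)) := by
  refine (S.val_smul_regularCornerGenerator ν c 1).trans ?_
  rw [MulOpposite.unop_one, mul_one]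

theorem bijective_regularToCorner {τ : D →ₐ[k] C} {ν : C →ₙₐ[k] D} (h : IsBlock τ ν)
    (h₀ : ∀ x, S.proj x = 0 → S.incl (ν 1) * x * S.incl (ν 1) = 0) :
    Function.Bijective (S.regularToCorner ν) := by
  constructor
  · intro x y hxy
    obtain ⟨x, rfl⟩ := (toRegular k C).surjective x
    obtain ⟨y, rfl⟩ := (toRegular k C).surjective y
    have h' := congrArg Corner.val hxy
    rw [regularToCorner_val, regularToCorner_val] at h'
    have h'' := congrArg (fun z => τ (S.proj z)) ((toRegular k Λ).injective h')
    simp only [S.proj_incl, h.left_inv] at h''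
    rw [h'']
  · intro y
    obtain ⟨x, hx⟩ := (toRegular k Λ).surjective (Corner.val y)
    have h₁ : S.incl (ν 1) * x * S.incl (ν 1) = x := by
      have h₂ : S.envelopeIncl ν 1 • toRegular k Λ x = toRegular k Λ x := by
        rw [hx]
        exact Corner.one_smul_val y
      rw [envelopeIncl_one, smul_toRegular] at h₂
      exact (toRegular k Λ).injective h₂
    refine ⟨toRegular k C (τ (S.proj x)), Corner.ext ?_⟩
    rw [regularToCorner_val, ← hx, h.mul_one]
    congr 1
    have h₂ := h₀ (x - S.incl (S.proj x)) (by rw [map_sub, S.proj_incl, sub_self])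
    rw [mul_sub, sub_mul, h₁, sub_eq_zero, ← map_mul, ← h.one_mul, ← map_mul, ← map_mul,
      mul_one] at h₂
    rw [← h.mul_one, ← h₂]

/-- If the corner of `ker proj` at a direct factor `C` of `D` is zero, then the corner of `Λ` is
`C`. -/
noncomputable def regularCornerIso {τ : D →ₐ[k] C} {ν : C →ₙₐ[k] D} (h : IsBlock τ ν)
    (h₀ : ∀ x, S.proj x = 0 → S.incl (ν 1) * x * S.incl (ν 1) = 0) :
    (S.bimoduleCorner ν).obj (regularBimodule k Λ) ≅ regularBimodule k C :=
  (LinearEquiv.ofBijective _ (S.bijective_regularToCorner h h₀)).toModuleIso.symm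

end OneBlock

/-- The global dimension of `Λ` is infinite if that of a direct factor of `D` is: an upper bound of
the injective dimensions of the `Λ`-modules also bounds the injective dimensions of their
corners, and each `C`-module is the corner of a `Λ`-module. -/
theorem infiniteGlobalDimension (S : SquareZeroPresentation k D Λ J) {C : Type v} [Ring C]
    [Algebra k C] {τ : D →ₐ[k] C} {ν : C →ₙₐ[k] D} (h : IsBlock τ ν)
    (hC : InfiniteGlobalDimension C) : InfiniteGlobalDimension Λ := by
  intro d
  by_contra! hΛ
  obtain ⟨X, hX⟩ := hC d
  refine hX (HasProjectiveDimensionLT.mk fun i hi V x => ?_)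
  have hs (c : C) : (τ.comp S.proj).toRingHom (S.blockIncl ν c) = c := by
    change τ (S.proj (S.incl (ν c))) = c
    rw [S.proj_incl, h.left_inv]
  let e := cornerRestrictScalarsIso (S.blockIncl ν : C →ₙ+* Λ) (τ.comp S.proj).toRingHom hs V
  have hY : HasInjectiveDimensionLT
      ((ModuleCat.restrictScalars (τ.comp S.proj).toRingHom).obj V) (d + 1) :=
    HasInjectiveDimensionLT.mk fun i hi X e =>
      have := hΛ X
      e.eq_zero_of_hasProjectiveDimensionLT (d + 1) hi
  have hG := hasInjectiveDimensionLT_obj (cornerFunctor (S.blockIncl ν : C →ₙ+* Λ))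
    (cornerFunctor_shortExact _) (cornerFunctor_injective (S.isCornerSection h)) _ _ hY
  have hV := hasInjectiveDimensionLT_of_iso e (d + 1)
  exact x.eq_zero_of_hasInjectiveDimensionLT (d + 1) hi

section TwoBlocks

variable {C₁ C₂ : Type v} [Ring C₁] [Ring C₂] [Algebra k C₁] [Algebra k C₂]
  {τ₁ : D →ₐ[k] C₁} {τ₂ : D →ₐ[k] C₂} {ν₁ : C₁ →ₙₐ[k] D} {ν₂ : C₂ →ₙₐ[k] D}

theorem mk_envelopeIncl_one_tmul_one (ν : C₁ →ₙₐ[k] D) :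
    S.balanced.mkQ (S.envelopeIncl ν (1 ⊗ₜ 1)) = S.balanced.mkQ (S.incl (ν 1) ⊗ₜ 1) := by
  have h := S.mk_mul_incl (S.incl (ν 1)) 1 (ν 1)
  rw [mul_one, map_mul_one_self] at h
  exact h.symm

theorem envelopeIncl_smul_cornerValue (hmul : ν₁ 1 * ν₂ 1 = 0)
    {Y : ModuleCat.{v} (Λ ⊗[k] Λᵐᵒᵖ)}
    (g : regularBimodule k C₂ ⟶ (S.bimoduleCorner ν₂).obj Y) (c : C₁) :
    S.envelopeIncl ν₁ (c ⊗ₜ 1) • S.cornerValue ν₂ g = 0 := by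
  rw [← S.one_smul_cornerValue ν₂ g, smul_smul, envelopeIncl_tmul,
    Algebra.TensorProduct.tmul_mul_tmul, ← S.map_mul_one_self ν₁ c, mul_assoc, ← map_mul S.incl,
    hmul, map_zero, mul_zero, TensorProduct.zero_tmul]
  exact zero_smul (Λ ⊗[k] Λᵐᵒᵖ) (S.cornerValue ν₂ g)

/-- A morphism `f` from `Λ ⊗_D Λ` is given by the element `f(1 ⊗ 1)`, which is centralized by `D`
and hence the sum of its components in the two corners. -/
theorem bijective_homToCorner (h₁ : IsBlock τ₁ ν₁) (h₂ : IsBlock τ₂ ν₂) (hadd : ν₁ 1 + ν₂ 1 = 1)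
    (hmul : ν₁ 1 * ν₂ 1 = 0) (hmul' : ν₂ 1 * ν₁ 1 = 0) (Y : ModuleCat.{v} (Λ ⊗[k] Λᵐᵒᵖ)) :
    Function.Bijective ((S.homToCorner ν₁ Y).prod (S.homToCorner ν₂ Y)) := by
  constructor
  · rw [injective_iff_map_eq_zero]
    intro f hf
    have hf₁ : f.hom (S.balanced.mkQ (S.incl (ν₁ 1) ⊗ₜ 1)) = 0 := by
      rw [← mk_envelopeIncl_one_tmul_one, ← S.homToCorner_val ν₁ Y f 1,
        show S.homToCorner ν₁ Y f = 0 from congrArg Prod.fst hf]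
      rfl
    have hf₂ : f.hom (S.balanced.mkQ (S.incl (ν₂ 1) ⊗ₜ 1)) = 0 := by
      rw [← mk_envelopeIncl_one_tmul_one, ← S.homToCorner_val ν₂ Y f 1,
        show S.homToCorner ν₂ Y f = 0 from congrArg Prod.snd hf]
      rfl
    have hf1 : f.hom (S.balanced.mkQ 1) = 0 := by
      rw [Algebra.TensorProduct.one_def, ← map_one S.incl, ← hadd, map_add S.incl,
        TensorProduct.add_tmul, map_add, map_add, hf₁, hf₂, add_zero]
    refine ModuleCat.hom_ext (LinearMap.ext fun x => ?_)
    obtain ⟨r, rfl⟩ := S.balanced.mkQ_surjective x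
    have hr : S.balanced.mkQ r = r • S.balanced.mkQ 1 := by
      rw [← map_smul, smul_eq_mul, mul_one]
    rw [hr, map_smul, hf1, smul_zero]
    rfl
  · rintro ⟨g₁, g₂⟩
    have hle : S.balanced ≤ LinearMap.ker (LinearMap.toSpanSingleton (Λ ⊗[k] Λᵐᵒᵖ) Y
        (S.cornerValue ν₁ g₁ + S.cornerValue ν₂ g₂)) := by
      refine Ideal.span_le.2 ?_
      rintro _ ⟨d, rfl⟩
      refine LinearMap.mem_ker.2 ?_
      rw [LinearMap.toSpanSingleton_apply, smul_add, S.central_cornerValue h₁,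
        S.central_cornerValue h₂, add_zero]
    let f : S.balancedTensor ⟶ Y := ModuleCat.ofHom (S.balanced.liftQ _ hle)
    have hf (r : Λ ⊗[k] Λᵐᵒᵖ) : f.hom (S.balanced.mkQ r) =
        r • S.cornerValue ν₁ g₁ + r • S.cornerValue ν₂ g₂ := smul_add r _ _
    refine ⟨f, Prod.ext ?_ ?_⟩
    · ext x
      obtain ⟨x, rfl⟩ := (toRegular k C₁).surjective x
      refine Corner.ext ((S.homToCorner_val ν₁ Y f x).trans ?_)
      rw [hf, S.envelopeIncl_smul_cornerValue hmul, add_zero, envelopeIncl_tmul,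
        smul_cornerValue, MulOpposite.unop_one, mul_one]
    · ext x
      obtain ⟨x, rfl⟩ := (toRegular k C₂).surjective x
      refine Corner.ext ((S.homToCorner_val ν₂ Y f x).trans ?_)
      rw [hf, S.envelopeIncl_smul_cornerValue hmul', zero_add, envelopeIncl_tmul,
        smul_cornerValue, MulOpposite.unop_one, mul_one]

/-- If `D` is the product of `C₁` and `C₂`, then `Ext(Λ ⊗_D Λ, Λ)` is the product of the
Hochschild cohomologies of `C₁` and `C₂`. -/
theorem nonempty_ext_balancedTensor_equiv (h₁ : IsBlock τ₁ ν₁) (h₂ : IsBlock τ₂ ν₂)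
    (hadd : ν₁ 1 + ν₂ 1 = 1) (hmul : ν₁ 1 * ν₂ 1 = 0) (hmul' : ν₂ 1 * ν₁ 1 = 0)
    (h₁₁ : ∀ x, S.proj x = 0 → S.incl (ν₁ 1) * x * S.incl (ν₁ 1) = 0)
    (h₂₂ : ∀ x, S.proj x = 0 → S.incl (ν₂ 1) * x * S.incl (ν₂ 1) = 0) (n : ℕ) :
    Nonempty (Ext.{v} S.balancedTensor (regularBimodule k Λ) n ≃ₗ[k]
      HochschildCohomology k C₁ n × HochschildCohomology k C₂ n) := by
  obtain ⟨e⟩ := nonempty_ext_linearEquiv_prod (S.bimoduleCorner ν₁) (S.bimoduleCorner ν₂)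
    (cornerFunctor_shortExact _) (cornerFunctor_shortExact _) (S.bimoduleCorner_injective h₁)
    (S.bimoduleCorner_injective h₂)
    (fun Y => LinearEquiv.ofBijective _ (S.bijective_homToCorner h₁ h₂ hadd hmul hmul' Y))
    (fun f g => Prod.ext (S.homToCorner_comp ν₁ f g) (S.homToCorner_comp ν₂ f g)) n
    (regularBimodule k Λ)
  exact ⟨e ≪≫ₗ (extCongr k (Iso.refl _) (S.regularCornerIso h₁ h₁₁) n).prodCongr
    (extCongr k (Iso.refl _) (S.regularCornerIso h₂ h₂₂) n)⟩

/-- If `D` is the product of `C₁` and `C₂`, then in large degrees the Hochschild cohomology of `Λ`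
is the product of those of `C₁` and `C₂`. -/
theorem exists_hochschildCohomology_equiv (h₁ : IsBlock τ₁ ν₁) (h₂ : IsBlock τ₂ ν₂)
    (hadd : ν₁ 1 + ν₂ 1 = 1) (hmul : ν₁ 1 * ν₂ 1 = 0) (hmul' : ν₂ 1 * ν₁ 1 = 0)
    (h₁₁ : ∀ x, S.proj x = 0 → S.incl (ν₁ 1) * x * S.incl (ν₁ 1) = 0)
    (h₂₂ : ∀ x, S.proj x = 0 → S.incl (ν₂ 1) * x * S.incl (ν₂ 1) = 0)
    (hl : ∀ j, ∃ n, HasProjectiveDimensionLT (S.brick j) n)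
    (hr : ∀ j, ∃ n, HasProjectiveDimensionLT (S.op.brick j) n) :
    ∃ h : ℕ, ∀ n, h ≤ n → Nonempty (HochschildCohomology k Λ n ≃ₗ[k]
      HochschildCohomology k C₁ n × HochschildCohomology k C₂ n) := by
  obtain ⟨h, hh⟩ := S.exists_ext_regularBimodule_equiv hl hr
  refine ⟨h, fun n hn => ?_⟩
  obtain ⟨e₁⟩ := hh n hn (regularBimodule k Λ)
  obtain ⟨e₂⟩ := S.nonempty_ext_balancedTensor_equiv h₁ h₂ hadd hmul hmul' h₁₁ h₂₂ n
  exact ⟨e₁ ≪≫ₗ e₂⟩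

end TwoBlocks

end SquareZeroPresentation

theorem eventuallyZeroHochschild_of_equiv {R C₁ C₂ : Type v} [Ring R] [Ring C₁] [Ring C₂]
    [Algebra k R] [Algebra k C₁] [Algebra k C₂] {h : ℕ}
    (hh : ∀ n, h ≤ n → Nonempty (HochschildCohomology k R n ≃ₗ[k]
      HochschildCohomology k C₁ n × HochschildCohomology k C₂ n))
    (h₁ : EventuallyZeroHochschild k C₁) (h₂ : EventuallyZeroHochschild k C₂) :
    EventuallyZeroHochschild k R := by
  obtain ⟨a, ha⟩ := h₁
  obtain ⟨b, hb⟩ := h₂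
  refine ⟨h + a + b, fun n hn => ?_⟩
  obtain ⟨e⟩ := hh n (by omega)
  have := ha n (by omega)
  have := hb n (by omega)
  exact e.toEquiv.subsingleton

end Blocks

/-! ### Efficient cycles -/

section Cycles

/-- A finite walk, as a sequence whose terms after the end of the walk are not specified. -/
theorem exists_sequence_of_transGen {α : Type*} {R : α → α → Prop} {a b : α}
    (h : Relation.TransGen R a b) : ∃ (n : ℕ) (f : ℕ → α), f 0 = a ∧ f (n + 1) = b ∧
      ∀ t ≤ n, R (f t) (f (t + 1)) := by
  induction h with
  | single h =>
    refine ⟨0, fun t => if t = 0 then a else _, rfl, rfl, fun t ht => ?_⟩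
    obtain rfl : t = 0 := by omega
    exact h
  | tail _ h ih =>
    obtain ⟨n, f, h0, hn, hf⟩ := ih
    refine ⟨n + 1, fun t => if t ≤ n + 1 then f t else _, by simp [h0], by simp; rfl,
      fun t ht => ?_⟩
    rcases Nat.lt_or_ge t (n + 1) with h' | h'
    · simpa [h'.le, show t ≤ n by omega] using hf t (by omega)
    · obtain rfl : t = n + 1 := by omega
      simpa [hn] using h

/-- A closed walk, as a periodic sequence. -/
theorem exists_periodic_of_transGen {α : Type*} {R : α → α → Prop} {a : α}
    (h : Relation.TransGen R a a) : ∃ (l : ℕ) (f : ℕ → α), 0 < l ∧ (∀ t, f (t + l) = f t) ∧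
      ∀ t, R (f t) (f (t + 1)) := by
  obtain ⟨n, f, h0, hn, hf⟩ := exists_sequence_of_transGen h
  refine ⟨n + 1, fun t => f (t % (n + 1)), n.succ_pos, fun t => by simp, fun t => ?_⟩
  have hlt : t % (n + 1) < n + 1 := Nat.mod_lt t n.succ_pos
  change R (f (t % (n + 1))) (f ((t + 1) % (n + 1)))
  have h₁ := hf (t % (n + 1)) (by omega)
  rcases Nat.lt_or_ge (t % (n + 1) + 1) (n + 1) with h' | h'
  · have : (t + 1) % (n + 1) = t % (n + 1) + 1 := by
      rw [Nat.add_mod, Nat.mod_eq_of_lt (a := 1) (by omega), Nat.mod_eq_of_lt h']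
    rwa [this]
  · have h₂ : t % (n + 1) = n := by omega
    have h₃ : (t + 1) % (n + 1) = 0 := by
      rw [← Nat.mod_add_mod, h₂, Nat.mod_self]
    rw [h₃, h0, ← hn]
    rwa [h₂] at h₁ ⊢

variable {V W : Type*}

/-- One step of an efficient walk. The boolean attached to a vertex records whether the arrow which
leads to it has both ends on the same side; two such arrows must not follow each other. -/
def EfficientStep (Q : Digraph (V ⊕ W)) (s t : (V ⊕ W) × Bool) : Prop :=
  Q.Adj s.1 t.1 ∧ (t.2 = true ↔ s.1.isLeft = t.1.isLeft) ∧ ¬(s.2 = true ∧ t.2 = true)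

theorem hasEfficientCycle_of_transGen {Q : Digraph (V ⊕ W)} {s : (V ⊕ W) × Bool}
    (h : Relation.TransGen (EfficientStep Q) s s) : HasEfficientCycle Q := by
  obtain ⟨l, f, hl, hper, hf⟩ := exists_periodic_of_transGen h
  have key (t : ℕ) (h₁ : (f t).1.isLeft = (f (t + 1)).1.isLeft)
      (h₂ : (f (t + 1)).1.isLeft = (f (t + 2)).1.isLeft) : False :=
    (hf (t + 1)).2.2 ⟨(hf t).2.1.2 h₁, (hf (t + 1)).2.1.2 h₂⟩
  refine ⟨l, fun t => (f t).1, hl, fun t => congrArg Prod.fst (hper t), fun t => (hf t).1,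
    fun t => ⟨?_, ?_⟩⟩
  · rintro ⟨h₁, h₂, h₃⟩
    exact key t (h₁.trans h₂.symm) (h₂.trans h₃.symm)
  · rintro ⟨h₁, h₂, h₃⟩
    have left (x : V ⊕ W) (hx : x.isRight = true) : x.isLeft = false := by
      cases x
      · exact absurd hx (by simp)
      · rfl
    exact key t ((left _ h₁).trans (left _ h₂).symm) ((left _ h₂).trans (left _ h₃).symm)

theorem wellFounded_of_acyclic {J : Type*} [Finite J] {r : J → J → Prop}
    (h : ∀ j, ¬ Relation.TransGen r j j) : WellFounded r := by
  have : Std.Irrefl (Relation.TransGen r) := ⟨h⟩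
  exact Subrelation.wf (fun h => Relation.TransGen.single h)
    (Finite.wellFounded_of_trans_of_irrefl (Relation.TransGen r))

/-- Let `J` index arrows of `Q` between the two sides. If `Q` has no efficient cycle, then there is
no closed walk of arrows of `J` in which the end of an arrow is equal to, or connected by an arrow
of `Q` on the same side with, the origin of the next one. The relation `r i j` says that `i` can
follow `j`, and the predicate `P` excludes vertices given by zero idempotents. -/
theorem acyclic_of_not_hasEfficientCycle {Q : Digraph (V ⊕ W)} (hQ : ¬ HasEfficientCycle Q)
    {J : Type*} (src tgt : J → V ⊕ W) (hside : ∀ j, (src j).isLeft ≠ (tgt j).isLeft)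
    (P : V ⊕ W → Prop) (hJ : ∀ j, P (src j) → P (tgt j) → Q.Adj (src j) (tgt j))
    (r : J → J → Prop) (hsrc : ∀ i j, r i j → P (src i)) (htgt : ∀ i j, r i j → P (tgt j))
    (hr : ∀ i j, r i j → tgt j ≠ src i →
      Q.Adj (tgt j) (src i) ∧ (tgt j).isLeft = (src i).isLeft) (j : J) :
    ¬ Relation.TransGen r j j := by
  intro h
  -- In the walk, the boolean `false` records that the last arrow goes from one side to the other.
  have step (i j : J) (hij : r i j) (hi : P (tgt i)) :
      Relation.TransGen (EfficientStep Q) (tgt j, false) (tgt i, false) := by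
    have hout : EfficientStep Q (src i, true) (tgt i, false) ∧
        EfficientStep Q (src i, false) (tgt i, false) := by
      simp [EfficientStep, hside i, hJ i (hsrc i j hij) hi]
    by_cases hji : tgt j = src i
    · rw [hji]
      exact .single hout.2
    · obtain ⟨h₁, h₂⟩ := hr i j hij hji
      refine .tail (.single (b := (src i, true)) ?_) hout.1
      simp [EfficientStep, h₁, h₂]
  have walk (i : J) (hi : Relation.TransGen r i j) : P (tgt i) →
      Relation.TransGen (EfficientStep Q) (tgt j, false) (tgt i, false) := by
    induction hi using Relation.TransGen.head_induction_on with
    | single h => exact step _ _ h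
    | head h _ ih => exact fun hi => (ih (htgt _ _ h)).trans (step _ _ h hi)
  obtain ⟨i, -, hi⟩ := Relation.TransGen.tail'_iff.1 h
  exact hQ (hasEfficientCycle_of_transGen (walk j h (htgt _ _ hi)))

end Cycles

/-! ### Finite dimension -/

section Finite

variable {k : Type u} [Field k] {D Λ : Type v} [Ring D] [Ring Λ] [Algebra k D] [Algebra k Λ]
  {J : Type w} [Fintype J]

theorem SquareZeroPresentation.module_finite (S : SquareZeroPresentation k D Λ J)
    [Module.Finite k D] : Module.Finite k Λ := by
  let φ : D × (J → D ⊗[k] D) →ₗ[k] Λ :=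
    LinearMap.coprod S.incl.toLinearMap (∑ j, S.eval j ∘ₗ LinearMap.proj j)
  refine Module.Finite.of_surjective φ fun x => ⟨(S.proj x, fun j => S.coord j x), ?_⟩
  refine Eq.trans ?_ (S.sum_eval_coord x)
  simp [φ]

theorem TensorProduct.tmul_ne_zero_of_field {V W : Type*} [AddCommGroup V] [AddCommGroup W]
    [Module k V] [Module k W] {x : V} {y : W} (hx : x ≠ 0) (hy : y ≠ 0) : x ⊗ₜ[k] y ≠ 0 := by
  intro h
  refine hx ((Module.forall_dual_apply_eq_zero_iff k x).1 fun f => ?_)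
  have h' := congrArg (fun z => TensorProduct.lid k W (LinearMap.rTensor W f z)) h
  rw [LinearMap.rTensor_tmul, TensorProduct.lid_tmul, map_zero, map_zero] at h'
  exact (smul_eq_zero.1 h').resolve_right hy

end Finite

/-! ### The bimodules `R r ⊗ s S` -/

section CornerBimodules

variable {k : Type u} [Field k] {R S D : Type v} [Ring R] [Ring S] [Ring D] [Algebra k R]
  [Algebra k S] [Algebra k D]

namespace IdealTensor

theorem induction_on {r : R} {s : S} {motive : IdealTensor k r s → Prop} (t : IdealTensor k r s)
    (zero : motive 0) (tmul : ∀ p q, motive (tmul p q))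
    (add : ∀ x y, motive x → motive y → motive (x + y)) : motive t :=
  TensorProduct.induction_on t zero tmul add

/-- The map `R r ⊗ s S → D ⊗ D` given by linear maps from `R` and `S` to `D`. -/
def toTensor (r : R) (s : S) (α : R →ₗ[k] D) (β : S →ₗ[k] D) :
    IdealTensor k r s →ₗ[k] D ⊗[k] D :=
  TensorProduct.map (α ∘ₗ (Submodule.span R {r}).subtype.restrictScalars k)
    (β ∘ₗ (Submodule.span Sᵐᵒᵖ {s}).subtype.restrictScalars k)

variable {r : R} {s : S} (α : R →ₗ[k] D) (β : S →ₗ[k] D)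

theorem toTensor_tmul (p : Submodule.span R {r}) (q : Submodule.span Sᵐᵒᵖ {s}) :
    toTensor r s α β (tmul p q) = α p ⊗ₜ β q := rfl

theorem toTensor_smul (x : R) (d : D) (h : ∀ y, α (x * y) = d * α y) (t : IdealTensor k r s) :
    toTensor r s α β (x • t) =
      LinearMap.rTensor D (LinearMap.mulLeft k d) (toTensor r s α β t) := by
  induction t using induction_on with
  | zero => rw [smul_zero, map_zero, map_zero]
  | add a b ha hb => rw [smul_add, map_add, ha, hb, map_add, map_add]
  | tmul p q =>
    rw [smul_tmul, toTensor_tmul, toTensor_tmul, LinearMap.rTensor_tmul, LinearMap.mulLeft_apply,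
      ← h]
    rfl

theorem toTensor_op_smul (x : S) (d : D) (h : ∀ y, β (y * x) = β y * d) (t : IdealTensor k r s) :
    toTensor r s α β (MulOpposite.op x • t) =
      LinearMap.lTensor D (LinearMap.mulRight k d) (toTensor r s α β t) := by
  induction t using induction_on with
  | zero => rw [smul_zero, map_zero, map_zero]
  | add a b ha hb => rw [smul_add, map_add, ha, hb, map_add, map_add]
  | tmul p q =>
    rw [op_smul_tmul, toTensor_tmul, toTensor_tmul, LinearMap.lTensor_tmul,
      LinearMap.mulRight_apply, ← h]
    rfl

variable (k r s) in
/-- The pure tensor `r ⊗ s`. -/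
def generator : IdealTensor k r s :=
  tmul ⟨r, Submodule.mem_span_singleton_self r⟩ ⟨s, Submodule.mem_span_singleton_self s⟩

theorem smul_generator (hr : r * r = r) : r • generator k r s = generator k r s :=
  (smul_tmul r s _ _ _).trans (congrArg (tmul · _) (Subtype.ext hr))

theorem op_smul_generator (hs : s * s = s) :
    MulOpposite.op s • generator k r s = generator k r s :=
  (op_smul_tmul r s _ _ _).trans (congrArg (tmul _ ·) (Subtype.ext hs))

theorem tmul_eq_smul_generator (hr : r * r = r) (hs : s * s = s) (p : Submodule.span R {r})
    (q : Submodule.span Sᵐᵒᵖ {s}) :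
    MulOpposite.op (q : S) • (p : R) • generator k r s = tmul p q := by
  obtain ⟨p, hp⟩ := p
  obtain ⟨q, hq⟩ := q
  obtain ⟨x, rfl⟩ := Submodule.mem_span_singleton.1 hp
  obtain ⟨y, rfl⟩ := Submodule.mem_span_singleton.1 hq
  rw [generator, smul_tmul, op_smul_tmul]
  refine congrArg₂ tmul (Subtype.ext ?_) (Subtype.ext ?_)
  · change x * r * r = x * r
    rw [mul_assoc, hr]
  · change s * (s * y.unop) = s * y.unop
    rw [← mul_assoc, hs]

theorem generator_ne_zero (hr : r ≠ 0) (hs : s ≠ 0) : generator k r s ≠ 0 :=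
  TensorProduct.tmul_ne_zero_of_field (fun h => hr (congrArg Subtype.val h))
    (fun h => hs (congrArg Subtype.val h))

end IdealTensor

open Classical in
/-- The inclusion of a summand in the bimodule given by families of elements. -/
noncomputable def cornerSingle {ι κ : Type v} {r : ι → R} {s : κ → S} {mult : ι → κ → ℕ}
    (x : Σ (i : ι) (j : κ), Fin (mult i j)) :
    IdealTensor k (r x.1) (s x.2.1) →+ CornerBimodule k r s mult where
  toFun t := Pi.single x.1 (Pi.single x.2.1 (Pi.single x.2.2 t))
  map_zero' := by simp
  map_add' t t' := by simp [Pi.single_add]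

section CornerSingle

variable {ι κ : Type v} {r : ι → R} {s : κ → S} {mult : ι → κ → ℕ}

theorem smul_cornerSingle (x : Σ (i : ι) (j : κ), Fin (mult i j)) (a : R)
    (t : IdealTensor k (r x.1) (s x.2.1)) :
    a • cornerSingle x t = cornerSingle (k := k) (r := r) (s := s) x (a • t) := by
  simp [cornerSingle, ← Pi.single_smul]

theorem op_smul_cornerSingle (x : Σ (i : ι) (j : κ), Fin (mult i j)) (a : S)
    (t : IdealTensor k (r x.1) (s x.2.1)) :
    MulOpposite.op a • cornerSingle x t =
      cornerSingle (k := k) (r := r) (s := s) x (MulOpposite.op a • t) := by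
  simp [cornerSingle, ← Pi.single_smul]

theorem cornerSingle_injective (x : Σ (i : ι) (j : κ), Fin (mult i j)) :
    Function.Injective (cornerSingle (k := k) (r := r) (s := s) x) := by
  intro t t' h
  have := congrFun (congrFun (congrFun h x.1) x.2.1) x.2.2
  simpa [cornerSingle] using this

theorem sum_cornerSingle [Fintype ι] [Fintype κ] (m : CornerBimodule k r s mult) :
    ∑ x : Σ (i : ι) (j : κ), Fin (mult i j), cornerSingle x (m x.1 x.2.1 x.2.2) = m := by
  classical
  rw [Fintype.sum_sigma]
  simp only [Fintype.sum_sigma]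
  nth_rewrite 2 [← Finset.univ_sum_single m]
  refine Finset.sum_congr rfl fun i _ => ?_
  conv_rhs => rw [← Finset.univ_sum_single (m i), ← AddMonoidHom.single_apply, map_sum]
  refine Finset.sum_congr rfl fun j _ => ?_
  conv_rhs =>
    rw [← Finset.univ_sum_single (m i j), ← AddMonoidHom.single_apply, map_sum, map_sum]
  refine Finset.sum_congr rfl fun c _ => ?_
  simp [cornerSingle]

end CornerSingle

end CornerBimodules

/-! ### Null-square projective algebras -/

section MatrixAlgebra

variable (k : Type u) [Field k] {A B : Type v} [Ring A] [Ring B]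
  [Algebra k A] [Algebra k B] (E : Finset A) (F : Finset B) (mM : F → E → ℕ) (mN : E → F → ℕ)

namespace NullSquareProjective

/-- The index set of the summands of the square-zero ideal `M ⊕ N`. -/
abbrev Index : Type v := (Σ (f : F) (e : E), Fin (mM f e)) ⊕ (Σ (e : E) (f : F), Fin (mN e f))

/-- The inclusion of the diagonal. -/
noncomputable def diagonal : A × B →ₐ[k] NullSquareProjective k E F mM mN :=
  AlgHom.ofLinearMap
    { toFun := fun x => ⟨x.1, 0, 0, x.2⟩
      map_add' := fun _ _ => by ext <;> simp
      map_smul' := fun _ _ => by ext <;> simp } rfl fun _ _ => by ext <;> simp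

/-- The projection to the diagonal. -/
noncomputable def toDiagonal : NullSquareProjective k E F mM mN →ₐ[k] A × B :=
  AlgHom.ofLinearMap
    { toFun := fun x => (x.a, x.b)
      map_add' := fun _ _ => rfl
      map_smul' := fun _ _ => rfl } rfl fun _ _ => rfl

theorem diagonal_apply (x : A × B) : diagonal k E F mM mN x = ⟨x.1, 0, 0, x.2⟩ := rfl

theorem toDiagonal_apply (x : NullSquareProjective k E F mM mN) :
    toDiagonal k E F mM mN x = (x.a, x.b) := rfl

/-- The matrices whose only non-zero entry is the lower left one. -/
noncomputable def lower : CornerBimodule k (fun f : F => (f : B)) (fun e : E => (e : A)) mM →+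
    NullSquareProjective k E F mM mN :=
  AddMonoidHom.mk' (fun m => ⟨0, 0, m, 0⟩) fun x y => by ext1 <;> simp

/-- The matrices whose only non-zero entry is the upper right one. -/
noncomputable def upper : CornerBimodule k (fun e : E => (e : A)) (fun f : F => (f : B)) mN →+
    NullSquareProjective k E F mM mN :=
  AddMonoidHom.mk' (fun n => ⟨0, n, 0, 0⟩) fun x y => by ext1 <;> simp

theorem lower_apply (m) : lower k E F mM mN m = ⟨0, 0, m, 0⟩ := rfl

theorem upper_apply (n) : upper k E F mM mN n = ⟨0, n, 0, 0⟩ := rfl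

theorem diagonal_mul_lower (d : A × B) (m) :
    diagonal k E F mM mN d * lower k E F mM mN m = lower k E F mM mN (d.2 • m) := by
  ext1 <;> simp [diagonal_apply, lower_apply]

theorem lower_mul_diagonal (d : A × B) (m) : lower k E F mM mN m * diagonal k E F mM mN d =
    lower k E F mM mN (MulOpposite.op d.1 • m) := by
  ext1 <;> simp [diagonal_apply, lower_apply]

theorem diagonal_mul_upper (d : A × B) (n) :
    diagonal k E F mM mN d * upper k E F mM mN n = upper k E F mM mN (d.1 • n) := by
  ext1 <;> simp [diagonal_apply, upper_apply]

theorem upper_mul_diagonal (d : A × B) (n) : upper k E F mM mN n * diagonal k E F mM mN d =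
    upper k E F mM mN (MulOpposite.op d.2 • n) := by
  ext1 <;> simp [diagonal_apply, upper_apply]

/-- The vertex of the right idempotent of a summand: a summand `B f ⊗ e A` is seen as an arrow from
`e` to `f`, and a summand `A e ⊗ f B` as an arrow from `f` to `e`. -/
def source : Index E F mM mN → E ⊕ F :=
  Sum.elim (fun x => .inl x.2.1) (fun x => .inr x.2.1)

/-- The vertex of the left idempotent of a summand. -/
def target : Index E F mM mN → E ⊕ F :=
  Sum.elim (fun x => .inr x.1) (fun x => .inl x.1)

/-- The idempotent of `A × B` at a vertex. -/
def idem : E ⊕ F → A × B := Sum.elim (fun e => (e, 0)) (fun f => (0, f))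

/-- The generators of the summands. -/
noncomputable def generator : Index E F mM mN → NullSquareProjective k E F mM mN :=
  Sum.elim (fun x => lower k E F mM mN (cornerSingle x (IdealTensor.generator k _ _)))
    (fun x => upper k E F mM mN (cornerSingle x (IdealTensor.generator k _ _)))

/-- The components of the entries outside of the diagonal, considered in `D ⊗ D` for
`D = A × B`. -/
noncomputable def coord : Index E F mM mN → NullSquareProjective k E F mM mN →ₗ[k]
    (A × B) ⊗[k] (A × B)
  | .inl x => IdealTensor.toTensor _ _ (LinearMap.inr k A B) (LinearMap.inl k A B) ∘ₗ
      { toFun := fun y => y.m x.1 x.2.1 x.2.2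
        map_add' := fun _ _ => rfl
        map_smul' := fun _ _ => rfl }
  | .inr x => IdealTensor.toTensor _ _ (LinearMap.inl k A B) (LinearMap.inr k A B) ∘ₗ
      { toFun := fun y => y.n x.1 x.2.1 x.2.2
        map_add' := fun _ _ => rfl
        map_smul' := fun _ _ => rfl }

theorem coord_inl (x) (y) : coord k E F mM mN (.inl x) y =
    IdealTensor.toTensor _ _ (LinearMap.inr k A B) (LinearMap.inl k A B)
      (y.m x.1 x.2.1 x.2.2) := rfl

theorem coord_inr (x) (y) : coord k E F mM mN (.inr x) y =
    IdealTensor.toTensor _ _ (LinearMap.inl k A B) (LinearMap.inr k A B)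
      (y.n x.1 x.2.1 x.2.2) := rfl

variable {E F}

theorem eval_inl (hE : ∀ e : E, (e : A) * e = e) (hF : ∀ f : F, (f : B) * f = f)
    (x : Σ (f : F) (e : E), Fin (mM f e)) (t : IdealTensor k (x.1 : B) (x.2.1 : A)) :
    tensorEval (diagonal k E F mM mN) (generator k E F mM mN (.inl x))
      (IdealTensor.toTensor _ _ (LinearMap.inr k A B) (LinearMap.inl k A B) t) =
    lower k E F mM mN (cornerSingle x t) := by
  induction t using IdealTensor.induction_on with
  | zero => simp only [map_zero]
  | add a b ha hb => simp only [map_add, ha, hb]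
  | tmul p q =>
    rw [IdealTensor.toTensor_tmul]
    change diagonal k E F mM mN (0, (p : B)) * lower k E F mM mN _ *
      diagonal k E F mM mN ((q : A), 0) = _
    rw [diagonal_mul_lower, lower_mul_diagonal, smul_cornerSingle, op_smul_cornerSingle,
      IdealTensor.tmul_eq_smul_generator (hF _) (hE _)]

theorem eval_inr (hE : ∀ e : E, (e : A) * e = e) (hF : ∀ f : F, (f : B) * f = f)
    (x : Σ (e : E) (f : F), Fin (mN e f)) (t : IdealTensor k (x.1 : A) (x.2.1 : B)) :
    tensorEval (diagonal k E F mM mN) (generator k E F mM mN (.inr x))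
      (IdealTensor.toTensor _ _ (LinearMap.inl k A B) (LinearMap.inr k A B) t) =
    upper k E F mM mN (cornerSingle x t) := by
  induction t using IdealTensor.induction_on with
  | zero => simp only [map_zero]
  | add a b ha hb => simp only [map_add, ha, hb]
  | tmul p q =>
    rw [IdealTensor.toTensor_tmul]
    change diagonal k E F mM mN ((p : A), 0) * upper k E F mM mN _ *
      diagonal k E F mM mN (0, (q : B)) = _
    rw [diagonal_mul_upper, upper_mul_diagonal, smul_cornerSingle, op_smul_cornerSingle,
      IdealTensor.tmul_eq_smul_generator (hE _) (hF _)]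

theorem idem_mul_self (hE : ∀ e : E, (e : A) * e = e) (hF : ∀ f : F, (f : B) * f = f)
    (x : E ⊕ F) : idem E F x * idem E F x = idem E F x := by
  rcases x with e | f
  · exact Prod.ext (hE e) (mul_zero 0)
  · exact Prod.ext (mul_zero 0) (hF f)

/-- A null-square projective algebra is a square-zero extension of `A × B`. -/
noncomputable def presentation (hE : ∀ e : E, (e : A) * e = e) (hF : ∀ f : F, (f : B) * f = f) :
    SquareZeroPresentation k (A × B) (NullSquareProjective k E F mM mN) (Index E F mM mN) where
  incl := diagonal k E F mM mN
  proj := toDiagonal k E F mM mN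
  p j := idem E F (target E F mM mN j)
  q j := idem E F (source E F mM mN j)
  gen := generator k E F mM mN
  coord := coord k E F mM mN
  proj_incl _ := rfl
  p_mul_p _ := idem_mul_self hE hF _
  q_mul_q _ := idem_mul_self hE hF _
  proj_gen j := by rcases j with x | x <;> rfl
  p_mul_gen j := by
    rcases j with x | x
    · refine (diagonal_mul_lower _ _ _ _ _ _ _).trans (congrArg _ ?_)
      exact (smul_cornerSingle _ _ _).trans
        (congrArg _ (IdealTensor.smul_generator (hF _)))
    · refine (diagonal_mul_upper _ _ _ _ _ _ _).trans (congrArg _ ?_)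
      exact (smul_cornerSingle _ _ _).trans
        (congrArg _ (IdealTensor.smul_generator (hE _)))
  gen_mul_q j := by
    rcases j with x | x
    · refine (lower_mul_diagonal _ _ _ _ _ _ _).trans (congrArg _ ?_)
      exact (op_smul_cornerSingle _ _ _).trans
        (congrArg _ (IdealTensor.op_smul_generator (hE _)))
    · refine (upper_mul_diagonal _ _ _ _ _ _ _).trans (congrArg _ ?_)
      exact (op_smul_cornerSingle _ _ _).trans
        (congrArg _ (IdealTensor.op_smul_generator (hF _)))
  mul_eq_zero x y hx hy := by
    rw [toDiagonal_apply, Prod.mk_eq_zero] at hx hy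
    ext1 <;> simp [hx, hy]
  coord_incl j d := by
    rcases j with x | x
    · exact map_zero (IdealTensor.toTensor (x.1 : B) (x.2.1 : A) (LinearMap.inr k A B)
        (LinearMap.inl k A B))
    · exact map_zero (IdealTensor.toTensor (x.1 : A) (x.2.1 : B) (LinearMap.inl k A B)
        (LinearMap.inr k A B))
  coord_mul j x y := by
    rcases j with i | i
    · rw [coord_inl, coord_inl, coord_inl, NullSquare.mul_m, Pi.add_apply, Pi.add_apply,
        Pi.add_apply, map_add, add_comm]
      congr 1
      · exact IdealTensor.toTensor_smul _ _ x.b _ (fun b => by simp [toDiagonal_apply]) _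
      · exact IdealTensor.toTensor_op_smul _ _ y.a _ (fun b => by simp [toDiagonal_apply]) _
    · rw [coord_inr, coord_inr, coord_inr, NullSquare.mul_n, Pi.add_apply, Pi.add_apply,
        Pi.add_apply, map_add]
      congr 1
      · exact IdealTensor.toTensor_smul _ _ x.a _ (fun b => by simp [toDiagonal_apply]) _
      · exact IdealTensor.toTensor_op_smul _ _ y.b _ (fun b => by simp [toDiagonal_apply]) _
  sum_coord x := by
    rw [Fintype.sum_sum_type]
    simp only [coord_inl, coord_inr, eval_inl k mM mN hE hF, eval_inr k mM mN hE hF]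
    rw [← map_sum, ← map_sum, sum_cornerSingle, sum_cornerSingle]
    ext1 <;> simp [lower_apply, upper_apply, toDiagonal_apply, diagonal_apply]

theorem isBlock_fst : SquareZeroPresentation.IsBlock (AlgHom.fst k A B)
    (NonUnitalAlgHom.inl k A B) where
  left_inv _ := rfl
  mul_one d := Prod.ext (mul_one d.1).symm (mul_zero d.2).symm
  one_mul d := Prod.ext (one_mul d.1).symm (zero_mul d.2).symm

theorem isBlock_snd : SquareZeroPresentation.IsBlock (AlgHom.snd k A B)
    (NonUnitalAlgHom.inr k A B) where
  left_inv _ := rfl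
  mul_one d := Prod.ext (mul_zero d.1).symm (mul_one d.2).symm
  one_mul d := Prod.ext (zero_mul d.1).symm (one_mul d.2).symm

theorem corner_fst (x : NullSquareProjective k E F mM mN) (hx : toDiagonal k E F mM mN x = 0) :
    diagonal k E F mM mN (NonUnitalAlgHom.inl k A B 1) * x *
      diagonal k E F mM mN (NonUnitalAlgHom.inl k A B 1) = 0 := by
  rw [toDiagonal_apply, Prod.mk_eq_zero] at hx
  ext1 <;> simp [hx, diagonal_apply]

theorem corner_snd (x : NullSquareProjective k E F mM mN) (hx : toDiagonal k E F mM mN x = 0) :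
    diagonal k E F mM mN (NonUnitalAlgHom.inr k A B 1) * x *
      diagonal k E F mM mN (NonUnitalAlgHom.inr k A B 1) = 0 := by
  rw [toDiagonal_apply, Prod.mk_eq_zero] at hx
  ext1 <;> simp [hx, diagonal_apply]

theorem source_isLeft_ne {A B : Type v} {E : Finset A} {F : Finset B} (mM : F → E → ℕ)
    (mN : E → F → ℕ) (j : Index E F mM mN) :
    (source E F mM mN j).isLeft ≠ (target E F mM mN j).isLeft := by
  rcases j with x | x <;> simp [source, target]

theorem isLeft_eq_of_idem_mul_ne_zero {v w : E ⊕ F} {d : A × B}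
    (h : idem E F w * d * idem E F v ≠ 0) : v.isLeft = w.isLeft := by
  rcases v with e | f <;> rcases w with e' | f'
  · rfl
  · exact absurd (by ext <;> simp [idem]) h
  · exact absurd (by ext <;> simp [idem]) h
  · rfl

theorem generator_ne_zero (j : Index E F mM mN) (hs : idem E F (source E F mM mN j) ≠ 0)
    (ht : idem E F (target E F mM mN j) ≠ 0) : generator k E F mM mN j ≠ 0 := by
  rcases j with x | x
  · have hs' : (x.2.1 : A) ≠ 0 := fun h => hs (Prod.ext h rfl)
    have ht' : (x.1 : B) ≠ 0 := fun h => ht (Prod.ext rfl h)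
    intro h
    refine IdealTensor.generator_ne_zero (k := k) ht' hs' (cornerSingle_injective x ?_)
    rw [map_zero]
    exact congrArg NullSquare.m h
  · have hs' : (x.2.1 : B) ≠ 0 := fun h => hs (Prod.ext rfl h)
    have ht' : (x.1 : A) ≠ 0 := fun h => ht (Prod.ext h rfl)
    intro h
    refine IdealTensor.generator_ne_zero (k := k) ht' hs' (cornerSingle_injective x ?_)
    rw [map_zero]
    exact congrArg NullSquare.n h

theorem diagonalSystem_eq (v : E ⊕ F) :
    (diagonalSystem E F v : NullSquareProjective k E F mM mN) =
      diagonal k E F mM mN (idem E F v) := by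
  rcases v with e | f <;> rfl

/-- The absence of efficient cycles in one of the quivers excludes the cycles of summands of the
square-zero ideal with non-zero successive products. -/
theorem acyclic (hE : ∀ e : E, (e : A) * e = e) (hF : ∀ f : F, (f : B) * f = f)
    (hcycle :
      ¬ HasEfficientCycle
          (peirceQuiver (diagonalSystem E F : E ⊕ F → NullSquareProjective k E F mM mN)) ∨
        ¬ HasEfficientCycle (multiplicityQuiver E F mM mN)) (j : Index E F mM mN) :
    ¬ Relation.TransGen (fun i j => ∃ d, idem E F (source E F mM mN i) * d *
      idem E F (target E F mM mN j) ≠ 0) j j := by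
  have hsrc (i j : Index E F mM mN) (h : ∃ d, idem E F (source E F mM mN i) * d *
      idem E F (target E F mM mN j) ≠ 0) : idem E F (source E F mM mN i) ≠ 0 := by
    obtain ⟨d, hd⟩ := h
    exact left_ne_zero_of_mul (left_ne_zero_of_mul hd)
  have htgt (i j : Index E F mM mN) (h : ∃ d, idem E F (source E F mM mN i) * d *
      idem E F (target E F mM mN j) ≠ 0) : idem E F (target E F mM mN j) ≠ 0 := by
    obtain ⟨d, hd⟩ := h
    exact right_ne_zero_of_mul hd
  rcases hcycle with hQ | hQ
  · refine acyclic_of_not_hasEfficientCycle hQ (source E F mM mN) (target E F mM mN)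
      (source_isLeft_ne mM mN) (fun v => idem E F v ≠ 0) (fun j hs ht => ⟨?_, ?_⟩) _ hsrc htgt
      (fun i j h hij => ?_) j
    · exact fun h => source_isLeft_ne mM mN j (congrArg Sum.isLeft h)
    · refine ⟨generator k E F mM mN j, ?_⟩
      rw [diagonalSystem_eq, diagonalSystem_eq]
      have h₁ : diagonal k E F mM mN (idem E F (target E F mM mN j)) * generator k E F mM mN j =
        generator k E F mM mN j := (presentation k mM mN hE hF).p_mul_gen j
      have h₂ : generator k E F mM mN j * diagonal k E F mM mN (idem E F (source E F mM mN j)) =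
        generator k E F mM mN j := (presentation k mM mN hE hF).gen_mul_q j
      rw [h₁, h₂]
      exact generator_ne_zero k mM mN j hs ht
    · obtain ⟨d, hd⟩ := h
      refine ⟨⟨hij, diagonal k E F mM mN d, ?_⟩, isLeft_eq_of_idem_mul_ne_zero hd⟩
      rw [diagonalSystem_eq, diagonalSystem_eq, ← map_mul, ← map_mul]
      exact fun h => hd (congrArg (toDiagonal k E F mM mN) h)
  · refine acyclic_of_not_hasEfficientCycle hQ (source E F mM mN) (target E F mM mN)
      (source_isLeft_ne mM mN) (fun v => idem E F v ≠ 0) (fun j _ _ => ?_) _ hsrc htgt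
      (fun i j h hij => ?_) j
    · rcases j with x | x
      · exact (Nat.zero_le _).trans_lt x.2.2.isLt |>.ne'
      · exact (Nat.zero_le _).trans_lt x.2.2.isLt |>.ne'
    · obtain ⟨d, hd⟩ := h
      have hside := isLeft_eq_of_idem_mul_ne_zero hd
      refine ⟨?_, hside⟩
      generalize source E F mM mN i = w at *
      generalize target E F mM mN j = v at *
      rcases v with e | f <;> rcases w with e' | f'
      · exact ⟨fun h => hij (congrArg _ h), d.1, fun h => hd (Prod.ext h (by simp [idem]))⟩
      · exact absurd hside (by simp)
      · exact absurd hside (by simp)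
      · exact ⟨fun h => hij (congrArg _ h), d.2, fun h => hd (Prod.ext (by simp [idem]) h)⟩

end NullSquareProjective

end MatrixAlgebra

theorem mainTheorem12 {k : Type u} [Field k] {A B : Type v} [Ring A] [Ring B]
    [Algebra k A] [Algebra k B] (E : Finset A) (F : Finset B)
    (hE : IsSystem E) (hF : IsSystem F) (mM : F → E → ℕ) (mN : E → F → ℕ)
    (hcycle :
      ¬ HasEfficientCycle
          (peirceQuiver (diagonalSystem E F : E ⊕ F → NullSquareProjective k E F mM mN)) ∨
        ¬ HasEfficientCycle (multiplicityQuiver E F mM mN)) :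
    (∃ h : ℕ, 0 < h ∧ ∀ n : ℕ, h ≤ n →
      Nonempty (HochschildCohomology k (NullSquareProjective k E F mM mN) n ≃ₗ[k]
        HochschildCohomology k A n × HochschildCohomology k B n)) ∧
    (Module.Finite k A → Module.Finite k B →
      EventuallyZeroHochschild k A → EventuallyZeroHochschild k B →
      InfiniteGlobalDimension A ∨ InfiniteGlobalDimension B →
        Module.Finite k (NullSquareProjective k E F mM mN) ∧
        InfiniteGlobalDimension (NullSquareProjective k E F mM mN) ∧
        EventuallyZeroHochschild k (NullSquareProjective k E F mM mN)) := by
  have hE' (e : E) : (e : A) * e = e := hE.idem e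
  have hF' (f : F) : (f : B) * f = f := hF.idem f
  let S := NullSquareProjective.presentation k mM mN hE' hF'
  have hacyc := NullSquareProjective.acyclic k mM mN hE' hF' hcycle
  have hl (j) : ∃ n, CategoryTheory.HasProjectiveDimensionLT (S.brick j) n :=
    S.exists_hasProjectiveDimensionLT_brick (wellFounded_of_acyclic hacyc) j
  have hr (j) : ∃ n, CategoryTheory.HasProjectiveDimensionLT (S.op.brick j) n := by
    refine S.op.exists_hasProjectiveDimensionLT_brick (wellFounded_of_acyclic fun i hi => ?_) j
    refine hacyc i (Relation.transGen_swap.1 (Relation.TransGen.mono ?_ _ _ hi))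
    rintro a b ⟨d, hd⟩
    refine ⟨d.unop, fun h => hd (MulOpposite.unop_injective ?_)⟩
    exact (mul_assoc _ _ _).symm.trans h
  obtain ⟨h, hh⟩ := S.exists_hochschildCohomology_equiv
    (NullSquareProjective.isBlock_fst k) (NullSquareProjective.isBlock_snd k)
    (Prod.ext (add_zero 1) (zero_add 1)) (Prod.ext (mul_zero 1) (zero_mul 1))
    (Prod.ext (zero_mul 1) (mul_zero 1)) (NullSquareProjective.corner_fst k mM mN)
    (NullSquareProjective.corner_snd k mM mN) hl hr
  refine ⟨⟨h + 1, h.succ_pos, fun n hn => hh n (Nat.le_of_succ_le hn)⟩, ?_⟩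
  intro hA hB h₁ h₂ hgl
  refine ⟨S.module_finite, ?_, eventuallyZeroHochschild_of_equiv hh h₁ h₂⟩
  rcases hgl with hgl | hgl
  · exact S.infiniteGlobalDimension (NullSquareProjective.isBlock_fst k) hgl
  · exact S.infiniteGlobalDimension (NullSquareProjective.isBlock_snd k) hgl
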